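/- Write $\langle x\rangle=(1+|x|^2)^{1/2}$, $\widehat f(\eta)=\int_{\mathbb R^n}e^{-i\eta\cdot x}f(x)\,dx$ (extended to tempered distributions), and let $\langle D\rangle^{\alpha}$ be the operator with Fourier symbol $\langle\eta\rangle^{\alpha}$. For $\alpha,\delta\in\mathbb R$ put $W^{\alpha,2}_\delta=\{f\in\mathcal S'(\mathbb R^n):\|f\|_{W^{\alpha,2}_\delta}:=\|\langle\cdot\rangle^{\delta}\langle D\rangle^{\alpha}f\|_{L^2}<\infty\}$ and $W^{\alpha,2}=W^{\alpha,2}_0$; $f\in W^{\alpha,2}_{loc}$ means $\phi f\in W^{\alpha,2}$ for every $\phi\in C_c^\infty(\mathbb R^n)$. Let $\theta\in\mathbb S^{n-1}$ and $H_\theta=\{\eta:\eta\cdot\theta<0\}$. For $\eta\in H_\theta$ put $k=-|\eta|^2/(\theta\cdot\eta)>0$ and $\theta'=k^{-1}(\eta+k\theta)\in\mathbb S^{n-1}$, and $$B_{\theta,2}(q)(\eta)=\int_{\mathbb R^n}e^{-ik\theta'\cdot y}\,q(y)\,R_k\big(q\,e^{ik\theta\cdot(\cdot)}\big)(y)\,dy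 ,$$ where $R_k$ is the outgoing resolvent, with Fourier symbol $(-|\xi|^2+k^2+i0)^{-1}$: the right-hand side is the limit as $\varepsilon\to0^+$ of the same integral with $R_k$ replaced by the bounded operator on $L^2$ with symbol $(-|\xi|^2+k^2+i\varepsilon)^{-1}$. For $\eta\notin H_\theta$ put $B_{\theta,2}(q)(\eta)=0$. The double dispersion operator $Q_{\theta,2}$ of fixed angle scattering is given by $\widehat{Q_{\theta,2}(q)}=B_{\theta,2}(q)+B_{-\theta,2}(q)$. Given $C_0>1$ and $\chi\in C^\infty(\mathbb R^n)$ with $0\le\chi\le1$, $\chi(\xi)=1$ for $|\xi|>2C_0$ and $\chi(\xi)=0$ for $|\xi|<C_0$, its high-frequency part is given by $\widehat{\widetilde Q_{\theta,2}(q)}=\chi\,\widehat{Q_{\theta,2}(q)}$. **Theorem.** Let $n\ge2$, $0\le\beta<\infty$ and $\alpha\in\mathbb R$. (i) Suppose that $$\alpha<\begin{cases}2\beta-\frac{n-3}{2}, & \text{if } \frac{n-3}{2}<\beta<\frac{n-1}{2},\\[2pt] \beta+1, & \text{if } \frac{n-1}{2}\le\beta<\infty\end{cases}$$ (so in particular $\beta>\frac{n-3}{2}$).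 Then there is a constant $C$, depending only on $n,\alpha,\beta$, such that for every $\theta\in\mathbb S^{n-1}$, every $C_0$ and $\chi$ as above, and every $q\in W^{\beta,2}_2$, the limits that define $\widehat{Q_{\theta,2}(q)}(\eta)$ exist for almost every $\eta$ with $\chi(\eta)\neq0$, $\widetilde Q_{\theta,2}(q)$ is a well-defined tempered distribution, and $$\|\widetilde Q_{\theta,2}(q)\|_{W^{\alpha,2}}\le C\,\|q\|_{W^{\beta,2}_2}^2 .$$ (ii) Conversely, let $\theta\in\mathbb S^{n-1}$. If $Q_{\theta,2}(q)\in W^{\alpha,2}_{loc}$ for all real, radial, compactly supported $q\in W^{\beta,2}$, then $$\alpha\le\min\Big(\beta+1,\;2\beta-\frac{n-4}{2}\Big).$$ -/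

import Mathlib

open MeasureTheory Filter Topology FourierTransform
open scoped ENNReal NNReal SchwartzMap ContDiff

noncomputable section

namespace FixedAngle

/-- The ambient space `ℝⁿ` with its Euclidean norm. -/
abbrev Rn (n : ℕ) : Type := EuclideanSpace ℝ (Fin n)

/-- Complex-valued `L²(ℝⁿ)`. -/
abbrev L2 (n : ℕ) : Type := Lp ℂ 2 (volume : Measure (Rn n))

variable {n : ℕ}

/-! ### Weighted Sobolev spaces

Mathlib's Fourier transform is `𝓕 f ξ = ∫ exp (-2 π i x·ξ) f x dx`; the frequency variable of
`∫ exp (-i x·η) f x dx` is `η = 2 π ξ`. -/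

/-- `⟨D⟩^α`, the Fourier multiplier with symbol `⟨η⟩^α = (1 + |η|²)^(α/2)`, `η = 2 π ξ`. -/
def japD (α : ℝ) : 𝓢'(Rn n, ℂ) →L[ℂ] 𝓢'(Rn n, ℂ) :=
  TemperedDistribution.fourierMultiplierCLM ℂ
    (fun ξ : Rn n ↦ (((1 + ‖(2 * Real.pi) • ξ‖ ^ 2) ^ (α / 2) : ℝ) : ℂ))

/-- Multiplication by the weight `⟨x⟩^δ = (1 + |x|²)^(δ/2)`. -/
def japX (δ : ℝ) : 𝓢'(Rn n, ℂ) →L[ℂ] 𝓢'(Rn n, ℂ) :=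
  TemperedDistribution.smulLeftCLM ℂ
    (fun x : Rn n ↦ (((1 + ‖x‖ ^ 2) ^ (δ / 2) : ℝ) : ℂ))

/-- The norm `‖⟨x⟩^δ ⟨D⟩^α f‖_{L²}` of `W^{α,2}_δ`, equal to `∞` if `⟨x⟩^δ ⟨D⟩^α f` is not
in `L²`. -/
def sobolevNorm (α δ : ℝ) (f : 𝓢'(Rn n, ℂ)) : ℝ≥0∞ :=
  ⨅ (g : L2 n) (_ : (g : 𝓢'(Rn n, ℂ)) = japX δ (japD α f)), ‖g‖ₑ

/-- `f ∈ W^{α,2}_loc`: `φ f ∈ W^{α,2}` for every `φ ∈ C_c^∞`. -/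
def MemSobolevLoc (α : ℝ) (f : 𝓢'(Rn n, ℂ)) : Prop :=
  ∀ φ : Rn n → ℂ, ContDiff ℝ ∞ φ → HasCompactSupport φ →
    sobolevNorm α 0 (TemperedDistribution.smulLeftCLM ℂ φ f) < ⊤

/-! ### The resolvent -/

/-- The symbol `(-|η|² + k² + i ε)⁻¹`, `η = 2 π ξ`. -/
def resolventSymbol (k ε : ℝ) (ξ : Rn n) : ℂ :=
  (((-‖(2 * Real.pi) • ξ‖ ^ 2 + k ^ 2 : ℝ) : ℂ) + ε * Complex.I)⁻¹

theorem im_resolventSymbol_inv (a ε : ℝ) : ((a : ℂ) + ε * Complex.I).im = ε := by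
  simp

theorem norm_resolventSymbol_le (k : ℝ) {ε : ℝ} (hε : 0 < ε) (ξ : Rn n) :
    ‖resolventSymbol k ε ξ‖ ≤ ε⁻¹ := by
  unfold resolventSymbol
  rw [norm_inv]
  apply inv_anti₀ hε
  refine le_trans ?_ (Complex.abs_im_le_norm _)
  rw [im_resolventSymbol_inv]
  exact le_abs_self ε

theorem continuous_resolventSymbol (k : ℝ) {ε : ℝ} (hε : 0 < ε) :
    Continuous (resolventSymbol k ε : Rn n → ℂ) := by
  unfold resolventSymbol
  refine Continuous.inv₀ (by fun_prop) fun ξ h ↦ ?_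
  have him := congrArg Complex.im h
  rw [im_resolventSymbol_inv] at him
  exact hε.ne' him

theorem memLp_resolventSymbol_mul (k : ℝ) {ε : ℝ} (hε : 0 < ε) (f : L2 n) :
    MemLp (fun ξ ↦ resolventSymbol k ε ξ * f ξ) 2 (volume : Measure (Rn n)) :=
  (Lp.memLp f).of_le_mul (c := ε⁻¹)
    ((continuous_resolventSymbol k hε).aestronglyMeasurable.mul (Lp.aestronglyMeasurable f))
    (ae_of_all _ fun ξ ↦ by
      rw [norm_mul]
      exact mul_le_mul_of_nonneg_right (norm_resolventSymbol_le k hε ξ) (norm_nonneg _))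

/-- For `ε > 0`, the bounded operator on `L²` with symbol `(-|η|² + k² + i ε)⁻¹`; the outgoing
resolvent `R_k`, with symbol `(-|η|² + k² + i 0)⁻¹`, is its limit as `ε → 0+`. -/
def resolvent (k ε : ℝ) (f : L2 n) : L2 n :=
  if hε : 0 < ε then 𝓕⁻ (memLp_resolventSymbol_mul k hε (𝓕 f)).toLp else 0

theorem memLp_modulate (v : Rn n) (f : L2 n) :
    MemLp (fun y ↦ Complex.exp (Complex.I * ((inner ℝ v y : ℝ) : ℂ)) * f y) 2
      (volume : Measure (Rn n)) :=
  (Lp.memLp f).of_le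
    ((by fun_prop : Continuous fun y : Rn n ↦
      Complex.exp (Complex.I * ((inner ℝ v y : ℝ) : ℂ))).aestronglyMeasurable.mul
        (Lp.aestronglyMeasurable f))
    (ae_of_all _ fun y ↦ by
      rw [norm_mul, mul_comm Complex.I, Complex.norm_exp_ofReal_mul_I, one_mul])

/-- The function `y ↦ exp (i v·y) f y`. -/
def modulate (v : Rn n) (f : L2 n) : L2 n := (memLp_modulate v f).toLp

/-! ### The double dispersion operator -/

/-- `k(η,θ) = -|η|² / (θ·η)`. -/
def waveNumber (θ η : Rn n) : ℝ := -(‖η‖ ^ 2 / inner ℝ θ η)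

/-- `θ'(η,θ) = k⁻¹ (η + k θ)`. -/
def outDir (θ η : Rn n) : Rn n := (waveNumber θ η)⁻¹ • (η + waveNumber θ η • θ)

open Classical in
/-- `∫ exp (-i k θ'·y) q(y) R(q exp (i k θ·(·)))(y) dy` on the half space `H_θ = {η·θ < 0}`
and `0` off it, where `k = k(η,θ)`, `θ' = θ'(η,θ)` and `R` is the resolvent with symbol
`(-|·|² + k² + i ε)⁻¹`. -/
def regB (ε : ℝ) (θ : Rn n) (q : L2 n) (η : Rn n) : ℂ :=
  if inner ℝ η θ < 0 then
    ∫ y : Rn n,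
      Complex.exp (-(Complex.I * ((waveNumber θ η * inner ℝ (outDir θ η) y : ℝ) : ℂ))) *
        (q y * resolvent (waveNumber θ η) ε (modulate (waveNumber θ η • θ) q) y)
  else 0

/-- `b` is the value `B_{θ,2}(q)(η)`, the limit `ε → 0+` that defines the outgoing resolvent. -/
def IsB (θ : Rn n) (q : L2 n) (η : Rn n) (b : ℂ) : Prop :=
  Tendsto (fun ε : ℝ ↦ regB ε θ q η) (𝓝[>] 0) (𝓝 b)

/-- `z = B_{θ,2}(q)(η) + B_{-θ,2}(q)(η)`, the value at `η` of the Fourier transform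
`∫ exp (-i η·x) (·) dx` of `Q_{θ,2}(q)`. -/
def IsQHat (θ : Rn n) (q : L2 n) (η : Rn n) (z : ℂ) : Prop :=
  ∃ b b' : ℂ, IsB θ q η b ∧ IsB (-θ) q η b' ∧ z = b + b'

/-- The tempered distribution `u` has Fourier transform `η ↦ m(η) · (Q_{θ,2}(q))^(η)`, a function
that is defined almost everywhere (off the zeros of `m`) and integrable against Schwartz functions.
For `m = 1` this says `u = Q_{θ,2}(q)`; for a high-frequency cut-off `m = χ` it says that `u` is
the high-frequency part of `Q_{θ,2}(q)`. There is at most one such `u`. -/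
def IsFilteredQ (m : Rn n → ℝ) (θ : Rn n) (q : L2 n) (u : 𝓢'(Rn n, ℂ)) : Prop :=
  ∃ F : Rn n → ℂ,
    (∀ᵐ η : Rn n, m η ≠ 0 → IsQHat θ q η (F η)) ∧
    ∀ φ : 𝓢(Rn n, ℂ),
      Integrable (fun ξ : Rn n ↦
        φ ξ * ((m ((2 * Real.pi) • ξ) : ℂ) * F ((2 * Real.pi) • ξ))) ∧
      𝓕 u φ = ∫ ξ : Rn n, φ ξ * ((m ((2 * Real.pi) • ξ) : ℂ) * F ((2 * Real.pi) • ξ))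

/-- `u = Q_{θ,2}(q)`. -/
def IsQ (θ : Rn n) (q : L2 n) (u : 𝓢'(Rn n, ℂ)) : Prop :=
  IsFilteredQ (fun _ ↦ 1) θ q u

/-- `χ` is a smooth high-frequency cut-off with threshold `C₀`. -/
structure IsCutoff (C₀ : ℝ) (χ : Rn n → ℝ) : Prop where
  smooth : ContDiff ℝ ∞ χ
  nonneg : ∀ ξ, 0 ≤ χ ξ
  le_one : ∀ ξ, χ ξ ≤ 1
  eq_one : ∀ ξ, 2 * C₀ < ‖ξ‖ → χ ξ = 1
  eq_zero : ∀ ξ, ‖ξ‖ < C₀ → χ ξ = 0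

/-! ### Classes of potentials -/

/-- `q` is real-valued. -/
def IsRealValued (q : L2 n) : Prop := ∀ᵐ x : Rn n, (q x).im = 0

/-- `q` is radial. -/
def IsRadial (q : L2 n) : Prop := ∃ g : ℝ → ℂ, ∀ᵐ x : Rn n, q x = g ‖x‖

/-- `q` is compactly supported. -/
def IsCompactlySupported (q : L2 n) : Prop := ∃ R : ℝ, ∀ᵐ x : Rn n, R < ‖x‖ → q x = 0

end FixedAngle

end

noncomputable section

namespace FixedAngle

open scoped LineDeriv

variable {n : ℕ}

/-! ### The radial resolvent symbol -/

/-! Up to a constant and in the variable η/2π, the number B_θ(q)(η) is the limit ε → 0+ of ∫ q̂(w−ξ)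
q̂(ξ−v) (κ²−|ξ|²+iε)⁻¹ dξ with v = kθ/2π, κ = |v| = k/2π and w−v = η/2π (`regB_eq_resForm`). Both
halves of the theorem come from understanding this integral near the sphere |ξ| = κ.

Upper bound. On each ray the amplitude is frozen at the singular radius. The frozen part integrates
to an arctangent, bounded uniformly in ε, and the remainder is a difference quotient. So the
integral across a shell of fixed width is controlled by suprema of the amplitude and its radial
derivative, and the one-dimensional Sobolev inequality turns these suprema into averages over the
shell at the price of one more derivative. Consequently (`exists_norm_integral_res_le`), for κ
bounded below and uniformly in ε, the resolvent may be replaced by the kernel ((κ+|ξ|)(1+|κ−|ξ||))⁻¹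
acting on the 2-jet of the amplitude; no trace on the sphere is ever taken. The weight ⟨x⟩² of the
potential pays for these two derivatives: q̂ = ⟨η⟩^(-β) G with the 2-jet of G in L²
(`eLpNorm_jet_decayFourier_le`). Cauchy–Schwarz then separates the kernel and the brackets from G.
The first factor is O(⟨w−v⟩^(-2α)) by `exists_lintegral_kerK_le`, because ⟨ξ−a⟩^(-s) with s > n−1
has uniformly bounded integrals over thin shells (`exists_lintegral_shell_le`); the hypothesis on α
is what makes a suitable s exist. The second factor is a convolution of squares, which integrates in
w−v to a fourth power of a norm. Since the pointwise estimates are bilinear and uniform in ε,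
existence of the limit passes from Schwartz functions to L² by density, and the norm bound passes by
Fatou.

Converse. The test potential is a compactly supported cut-off of a Bessel kernel, chosen so that q̂
is positive and comparable to ⟨ξ⟩^(-s), for any s > n/2+β (`exists_potential`). For real positive q̂
the imaginary part of the integral has a fixed sign, minus the integral of a positive product
against a Poisson-type kernel that concentrates on the sphere. Hence nothing cancels, not even
between B_θ and B_{-θ}, and lower bounds follow by keeping only some directions: the cap of size 1/κ
about θ yields κ^(-(s+1)), the whole sphere yields κ^(-(2s+2-n)) (`exists_le_neg_im_resForm`). These
bounds hold on balls of radius comparable to R about −Rθ. Local regularity of order α makes smoothed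
values of the Fourier transform, weighted by ⟨·⟩^α, square integrable
(`exists_lintegral_bumpAt_le`), so a lower bound R^(-a) forces α + n/2 ≤ a. Letting s decrease to
n/2+β gives the two necessary conditions. -/

/-- The radial resolvent symbol `(κ² - r² + i ε)⁻¹`. -/
def res (κ ε r : ℝ) : ℂ := (((κ ^ 2 - r ^ 2 : ℝ) : ℂ) + ε * Complex.I)⁻¹

theorem res_denom_ne_zero (κ : ℝ) {ε : ℝ} (hε : 0 < ε) (r : ℝ) :
    ((κ ^ 2 - r ^ 2 : ℝ) : ℂ) + ε * Complex.I ≠ 0 := fun h ↦ by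
  have := congrArg Complex.im h
  rw [im_resolventSymbol_inv] at this
  exact hε.ne' this

@[fun_prop]
theorem continuous_res (κ : ℝ) {ε : ℝ} (hε : 0 < ε) : Continuous (res κ ε) :=
  Continuous.inv₀ (by fun_prop) (res_denom_ne_zero κ hε)

theorem norm_res_le_inv_eps (κ : ℝ) {ε : ℝ} (hε : 0 < ε) (r : ℝ) : ‖res κ ε r‖ ≤ ε⁻¹ := by
  unfold res
  rw [norm_inv]
  apply inv_anti₀ hε
  refine le_trans ?_ (Complex.abs_im_le_norm _)
  rw [im_resolventSymbol_inv]
  exact le_abs_self ε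

theorem norm_res_le (κ ε r : ℝ) (h : κ ^ 2 ≠ r ^ 2) : ‖res κ ε r‖ ≤ |κ ^ 2 - r ^ 2|⁻¹ := by
  unfold res
  rw [norm_inv]
  apply inv_anti₀ (abs_pos.2 (sub_ne_zero.2 h))
  refine le_trans ?_ (Complex.abs_re_le_norm _)
  rw [Complex.add_re, Complex.ofReal_re]
  simp

theorem tendsto_res (κ r : ℝ) (h : κ ^ 2 ≠ r ^ 2) :
    Tendsto (fun ε ↦ res κ ε r) (𝓝[>] 0) (𝓝 ((κ ^ 2 - r ^ 2 : ℝ) : ℂ)⁻¹) := by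
  have : ContinuousAt (fun ε : ℝ ↦ res κ ε r) 0 := by
    unfold res
    refine ContinuousAt.inv₀ (by fun_prop) ?_
    simpa [-Complex.ofReal_sub] using sub_ne_zero.2 h
  have h2 := this.tendsto
  simp only [res, Complex.ofReal_zero, zero_mul, add_zero] at h2
  exact h2.mono_left nhdsWithin_le_nhds

theorem res_eq (κ ε r : ℝ) : res κ ε r =
    (((κ ^ 2 - r ^ 2) / ((κ ^ 2 - r ^ 2) ^ 2 + ε ^ 2) : ℝ) : ℂ) -
      ((ε / ((κ ^ 2 - r ^ 2) ^ 2 + ε ^ 2) : ℝ) : ℂ) * Complex.I := by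
  unfold res
  generalize κ ^ 2 - r ^ 2 = x
  apply Complex.ext
  · simp [Complex.inv_re, Complex.normSq_apply, ← sq, -Complex.ofReal_div]
  · simp [Complex.inv_im, Complex.normSq_apply, ← sq, neg_div, -Complex.ofReal_div]

/-- On an interval symmetric about κ² in the variable r², the real part of the symbol is odd and
cancels. What survives is the mass of an approximate delta, bounded by π/2 for every ε; this is why
shells are cut out in r² and not in r. -/
theorem integral_mul_res {κ d a b : ℝ} (ha : a ^ 2 = κ ^ 2 - d) (hb : b ^ 2 = κ ^ 2 + d)
    {ε : ℝ} (hε : 0 < ε) :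
    ∫ r in a..b, (r : ℂ) * res κ ε r = -(Complex.I * (Real.arctan (d / ε) : ℂ)) := by
  set F : ℝ → ℂ := fun r ↦ ((-(1 / 4) * Real.log ((κ ^ 2 - r ^ 2) ^ 2 + ε ^ 2) : ℝ) : ℂ) -
    ((1 / 2 * Real.arctan ((r ^ 2 - κ ^ 2) / ε) : ℝ) : ℂ) * Complex.I with hF
  have hderiv : ∀ r ∈ Set.uIcc a b, HasDerivAt F ((r : ℂ) * res κ ε r) r := by
    intro r _
    have hpos : (κ ^ 2 - r ^ 2) ^ 2 + ε ^ 2 ≠ 0 := by positivity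
    have h0 : HasDerivAt (fun r : ℝ ↦ κ ^ 2 - r ^ 2) (-(2 * r)) r := by
      simpa using (hasDerivAt_pow 2 r).const_sub (κ ^ 2)
    have h0' : HasDerivAt (fun r : ℝ ↦ (r ^ 2 - κ ^ 2) / ε) (2 * r / ε) r := by
      simpa using ((hasDerivAt_pow 2 r).sub_const (κ ^ 2)).div_const ε
    have h1 := ((((h0.pow 2).add_const (ε ^ 2)).log hpos).const_mul (-(1 / 4))).ofReal_comp
    have h2 := ((h0'.arctan.const_mul (1 / 2)).ofReal_comp).mul_const Complex.I
    have h3 := h1.sub h2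
    convert! h3 using 1
    rw [res_eq]
    have e1 : (-(1 / 4) * (((2 : ℕ) : ℝ) * (κ ^ 2 - r ^ 2) ^ (2 - 1) * -(2 * r) /
        ((κ ^ 2 - r ^ 2) ^ 2 + ε ^ 2)) : ℝ) =
        r * ((κ ^ 2 - r ^ 2) / ((κ ^ 2 - r ^ 2) ^ 2 + ε ^ 2)) := by
      field_simp; ring
    have e2 : (1 / 2 * (1 / (1 + ((r ^ 2 - κ ^ 2) / ε) ^ 2) * (2 * r / ε)) : ℝ) =
        r * (ε / ((κ ^ 2 - r ^ 2) ^ 2 + ε ^ 2)) := by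
      have : 1 + ((r ^ 2 - κ ^ 2) / ε) ^ 2 = ((κ ^ 2 - r ^ 2) ^ 2 + ε ^ 2) / ε ^ 2 := by
        field_simp; ring
      rw [this]; field_simp
    rw [e2]
    simp only [Pi.pow_apply] at *
    rw [e1]
    push_cast
    ring
  rw [intervalIntegral.integral_eq_sub_of_hasDerivAt hderiv
    (Continuous.intervalIntegrable (by fun_prop (disch := exact hε)) _ _)]
  simp only [hF, ha, hb]
  rw [show κ ^ 2 + d - κ ^ 2 = d by ring, show κ ^ 2 - d - κ ^ 2 = -d by ring,
    show κ ^ 2 - (κ ^ 2 + d) = -d by ring, show κ ^ 2 - (κ ^ 2 - d) = d by ring, neg_div,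
    Real.arctan_neg, neg_sq]
  push_cast
  ring

/-! ### One-dimensional estimate across the singularity -/

/-- The factor r − κ gained from the difference cancels the simple zero of κ² − r² = (κ−r)(κ+r), and
the factor r of the Jacobian is absorbed by κ + r. The bound does not see ε, so it also serves for
dominated convergence. -/
theorem norm_sub_mul_res_le {G G' : ℝ → ℂ} {κ d a b M : ℝ} (hκ : 0 < κ) (hd : 0 < d)
    (ha0 : 0 ≤ a) (hb0 : 0 ≤ b) (ha : a ^ 2 = κ ^ 2 - d) (hb : b ^ 2 = κ ^ 2 + d)
    (hG : ∀ r ∈ Set.Icc a b, HasDerivAt G (G' r) r) (hM : ∀ r ∈ Set.Icc a b, ‖G' r‖ ≤ M)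
    (ε : ℝ) {r : ℝ} (hr : r ∈ Set.Icc a b) :
    ‖(G r - G κ) * (r * res κ ε r)‖ ≤ M := by
  have hκm : κ ∈ Set.Icc a b :=
    ⟨by nlinarith, by nlinarith⟩
  have hM0 : 0 ≤ M := (norm_nonneg _).trans (hM r hr)
  by_cases h : r = κ
  · simp [h, hM0]
  have hr0 : 0 ≤ r := ha0.trans hr.1
  have hne : κ ^ 2 ≠ r ^ 2 := fun h' ↦ h ((pow_left_inj₀ hr0 hκ.le two_ne_zero).1 h'.symm)
  have h1 : ‖G r - G κ‖ ≤ M * ‖r - κ‖ :=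
    (convex_Icc a b).norm_image_sub_le_of_norm_hasDerivWithin_le
      (fun x hx ↦ (hG x hx).hasDerivWithinAt) hM hκm hr
  have h2 := norm_res_le κ ε r hne
  rw [norm_mul, norm_mul, Complex.norm_real, Real.norm_of_nonneg hr0]
  have h3 : |κ ^ 2 - r ^ 2| = ‖r - κ‖ * (κ + r) := by
    rw [show κ ^ 2 - r ^ 2 = -((r - κ) * (κ + r)) by ring, abs_neg, abs_mul,
      abs_of_nonneg (by positivity : 0 ≤ κ + r), Real.norm_eq_abs]
  have hp : 0 < ‖r - κ‖ := norm_pos_iff.2 (sub_ne_zero.2 h)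
  calc ‖G r - G κ‖ * (r * ‖res κ ε r‖) ≤ M * ‖r - κ‖ * (r * |κ ^ 2 - r ^ 2|⁻¹) := by gcongr
    _ = M * (r / (κ + r)) := by
      rw [h3]; field_simp
    _ ≤ M * 1 := by
      gcongr
      rw [div_le_one (by positivity)]; linarith
    _ = M := mul_one M

/-- The principal-value decomposition: freeze the amplitude at the singular radius, integrate the
frozen part explicitly, and keep a remainder that is regular as ε → 0. -/
theorem integral_res_split {G G' : ℝ → ℂ} {κ d a b : ℝ}
    (hab : a ≤ b) (ha : a ^ 2 = κ ^ 2 - d) (hb : b ^ 2 = κ ^ 2 + d)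
    (hG : ∀ r ∈ Set.Icc a b, HasDerivAt G (G' r) r) {ε : ℝ} (hε : 0 < ε) :
    ∫ r in a..b, G r * (r * res κ ε r) =
      (∫ r in a..b, (G r - G κ) * (r * res κ ε r)) -
        G κ * (Complex.I * (Real.arctan (d / ε) : ℂ)) := by
  have hc : ContinuousOn G (Set.uIcc a b) := by
    rw [Set.uIcc_of_le hab]
    exact fun x hx ↦ (hG x hx).continuousAt.continuousWithinAt
  have hcr : Continuous fun r : ℝ ↦ (r : ℂ) * res κ ε r := by fun_prop (disch := exact hε)
  have i1 : IntervalIntegrable (fun r ↦ (G r - G κ) * (r * res κ ε r)) volume a b :=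
    ((hc.sub continuousOn_const).mul hcr.continuousOn).intervalIntegrable
  have i2 : IntervalIntegrable (fun r ↦ G κ * (r * res κ ε r)) volume a b :=
    (continuous_const.mul hcr).intervalIntegrable _ _
  have := intervalIntegral.integral_add i1 i2
  simp only [sub_mul, sub_add_cancel] at this
  rw [this, intervalIntegral.integral_const_mul, integral_mul_res ha hb hε]
  simp only [sub_mul]
  ring

theorem norm_integral_res_le {G G' : ℝ → ℂ} {κ d a b M : ℝ} (hκ : 0 < κ) (hd : 0 < d)
    (ha0 : 0 ≤ a) (hb0 : 0 ≤ b) (ha : a ^ 2 = κ ^ 2 - d) (hb : b ^ 2 = κ ^ 2 + d)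
    (hG : ∀ r ∈ Set.Icc a b, HasDerivAt G (G' r) r) (hM : ∀ r ∈ Set.Icc a b, ‖G' r‖ ≤ M)
    {ε : ℝ} (hε : 0 < ε) :
    ‖∫ r in a..b, G r * (r * res κ ε r)‖ ≤ M * (b - a) + 2 * ‖G κ‖ := by
  have hab : a ≤ b := by nlinarith
  rw [integral_res_split hab ha hb hG hε]
  refine (norm_sub_le _ _).trans (add_le_add ?_ ?_)
  · have := intervalIntegral.norm_integral_le_of_norm_le_const (a := a) (b := b) (C := M)
      (f := fun r ↦ (G r - G κ) * (r * res κ ε r)) fun r hr ↦ by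
        rw [Set.uIoc_of_le hab] at hr
        exact norm_sub_mul_res_le hκ hd ha0 hb0 ha hb hG hM ε ⟨hr.1.le, hr.2⟩
    rwa [abs_of_nonneg (sub_nonneg.2 hab)] at this
  · rw [norm_mul, norm_mul, Complex.norm_I, one_mul, Complex.norm_real, mul_comm]
    gcongr
    rw [Real.norm_eq_abs, abs_le]
    have := Real.arctan_lt_pi_div_two (d / ε)
    have := Real.neg_pi_div_two_lt_arctan (d / ε)
    have := Real.pi_le_four
    constructor <;> linarith

/-- The remainder converges by dominated convergence to a principal-value integral, while the
arctangent tends to π/2 and produces the delta contribution of the outgoing resolvent. -/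
theorem tendsto_integral_res {G G' : ℝ → ℂ} {κ d a b M : ℝ} (hκ : 0 < κ) (hd : 0 < d)
    (ha0 : 0 ≤ a) (hb0 : 0 ≤ b) (ha : a ^ 2 = κ ^ 2 - d) (hb : b ^ 2 = κ ^ 2 + d)
    (hG : ∀ r ∈ Set.Icc a b, HasDerivAt G (G' r) r) (hM : ∀ r ∈ Set.Icc a b, ‖G' r‖ ≤ M) :
    ∃ L, Tendsto (fun ε ↦ ∫ r in a..b, G r * (r * res κ ε r)) (𝓝[>] 0) (𝓝 L) := by
  have hab : a ≤ b := by nlinarith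
  have hc : ContinuousOn G (Set.uIcc a b) := by
    rw [Set.uIcc_of_le hab]
    exact fun x hx ↦ (hG x hx).continuousAt.continuousWithinAt
  have h1 : Tendsto (fun ε ↦ ∫ r in a..b, (G r - G κ) * (r * res κ ε r)) (𝓝[>] 0)
      (𝓝 (∫ r in a..b, (G r - G κ) * (r * ((κ ^ 2 - r ^ 2 : ℝ) : ℂ)⁻¹))) := by
    refine intervalIntegral.tendsto_integral_filter_of_dominated_convergence (fun _ ↦ M) ?_ ?_ ?_ ?_
    · filter_upwards [self_mem_nhdsWithin] with ε hε
      refine ContinuousOn.aestronglyMeasurable ?_ measurableSet_uIoc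
      have hcr : Continuous fun r : ℝ ↦ (r : ℂ) * res κ ε r := by fun_prop (disch := exact hε)
      exact ((hc.sub continuousOn_const).mul hcr.continuousOn).mono Set.uIoc_subset_uIcc
    · refine Eventually.of_forall fun ε ↦ ae_of_all _ fun r hr ↦ ?_
      rw [Set.uIoc_of_le hab] at hr
      exact norm_sub_mul_res_le hκ hd ha0 hb0 ha hb hG hM ε ⟨hr.1.le, hr.2⟩
    · simp
    · refine ae_of_all _ fun r hr ↦ ?_
      rw [Set.uIoc_of_le hab] at hr
      by_cases h : r = κ
      · simp [h]
      have hr0 : 0 ≤ r := ha0.trans hr.1.le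
      have hne : κ ^ 2 ≠ r ^ 2 := fun h' ↦ h ((pow_left_inj₀ hr0 hκ.le two_ne_zero).1 h'.symm)
      exact ((tendsto_res κ r hne).const_mul _).const_mul _
  have h2 : Tendsto (fun ε : ℝ ↦ G κ * (Complex.I * (Real.arctan (d / ε) : ℂ))) (𝓝[>] 0)
      (𝓝 (G κ * (Complex.I * ((Real.pi / 2 : ℝ) : ℂ)))) := by
    refine Tendsto.const_mul _ (Tendsto.const_mul _ ?_)
    refine (Complex.continuous_ofReal.tendsto _).comp ?_
    have h3 : Tendsto (fun ε : ℝ ↦ d / ε) (𝓝[>] 0) atTop := by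
      simpa [div_eq_mul_inv] using tendsto_inv_nhdsGT_zero.const_mul_atTop hd
    exact (Real.tendsto_arctan_atTop.mono_right nhdsWithin_le_nhds).comp h3
  refine ⟨_, (h1.sub h2).congr' ?_⟩
  filter_upwards [self_mem_nhdsWithin] with ε hε
  exact (integral_res_split hab ha hb hG hε).symm

/-- Sup bound of a function on an interval by the integrals of it and its derivative. -/
theorem norm_le_of_integral {G G' : ℝ → ℂ} {a b : ℝ} (hab : a < b)
    (hG : ∀ r ∈ Set.Icc a b, HasDerivAt G (G' r) r) (hc : ContinuousOn G' (Set.Icc a b))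
    {x : ℝ} (hx : x ∈ Set.Icc a b) :
    ‖G x‖ ≤ (b - a)⁻¹ * (∫ r in a..b, ‖G r‖) + ∫ r in a..b, ‖G' r‖ := by
  have hcG : ContinuousOn G (Set.uIcc a b) := by
    rw [Set.uIcc_of_le hab.le]
    exact fun x hx ↦ (hG x hx).continuousAt.continuousWithinAt
  have hc' : ContinuousOn G' (Set.uIcc a b) := by rwa [Set.uIcc_of_le hab.le]
  have key : ∀ y ∈ Set.Icc a b, ‖G x‖ ≤ ‖G y‖ + ∫ r in a..b, ‖G' r‖ := by
    intro y hy
    have hsub : Set.uIcc y x ⊆ Set.Icc a b := Set.uIcc_subset_Icc hy hx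
    have h1 : ∫ r in y..x, G' r = G x - G y :=
      intervalIntegral.integral_eq_sub_of_hasDerivAt (fun r hr ↦ hG r (hsub hr))
        (hc.mono hsub).intervalIntegrable
    have h2 : ‖∫ r in y..x, G' r‖ ≤ ∫ r in a..b, ‖G' r‖ := by
      refine intervalIntegral.norm_integral_le_integral_norm_uIoc.trans ?_
      rw [intervalIntegral.integral_of_le hab.le]
      refine setIntegral_mono_set ?_ (ae_of_all _ fun _ ↦ norm_nonneg _) ?_
      · exact (hc.norm.integrableOn_Icc).mono_set Set.Ioc_subset_Icc_self
      · exact (Set.Ioc_subset_Ioc (le_min hy.1 hx.1) (max_le hy.2 hx.2)).eventuallyLE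
    calc ‖G x‖ = ‖G y + (G x - G y)‖ := by rw [add_sub_cancel]
      _ ≤ ‖G y‖ + ‖G x - G y‖ := norm_add_le _ _
      _ ≤ _ := by rw [← h1]; gcongr
  -- The base point is averaged over the interval, which turns its value into the mean of the norm.
  have h3 : ∫ _ in a..b, ‖G x‖ ≤ ∫ y in a..b, (‖G y‖ + ∫ r in a..b, ‖G' r‖) :=
    intervalIntegral.integral_mono_on hab.le (by simp)
      (hcG.norm.intervalIntegrable.add (by simp)) key
  rw [intervalIntegral.integral_add hcG.norm.intervalIntegrable (by simp),
    intervalIntegral.integral_const, intervalIntegral.integral_const, smul_eq_mul, smul_eq_mul] at h3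
  have hp : 0 < b - a := sub_pos.2 hab
  calc ‖G x‖ = (b - a)⁻¹ * ((b - a) * ‖G x‖) := by field_simp
    _ ≤ (b - a)⁻¹ * ((∫ r in a..b, ‖G r‖) + (b - a) * ∫ r in a..b, ‖G' r‖) := by gcongr
    _ = _ := by field_simp

/-! ### Polar coordinates -/

/-- Surface measure on the unit sphere of `ℝⁿ`. -/
abbrev sphereMeasure (n : ℕ) : Measure (Metric.sphere (0 : Rn n) 1) :=
  (volume : Measure (Rn n)).toSphere

theorem integral_volumeIoiPow {V : Type*} [NormedAddCommGroup V] [NormedSpace ℝ V] (m : ℕ)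
    (f : ℝ → V) :
    ∫ x : Set.Ioi (0 : ℝ), f x ∂.volumeIoiPow m = ∫ r in Set.Ioi (0 : ℝ), r ^ m • f r := by
  simp only [Measure.volumeIoiPow, ENNReal.ofReal]
  rw [integral_withDensity_eq_integral_smul,
    integral_subtype_comap measurableSet_Ioi fun a ↦ Real.toNNReal (a ^ m) • f a,
    setIntegral_congr_fun measurableSet_Ioi fun x hx ↦ ?_]
  · rw [NNReal.smul_def, Real.coe_toNNReal _ (pow_nonneg hx.out.le _)]
  · exact (measurable_subtype_coe.pow_const _).real_toNNReal

theorem integrable_prod_polar {V : Type*} [NormedAddCommGroup V] [NormedSpace ℝ V]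
    {F : Rn n → V} (hF : Integrable F) :
    Integrable (fun p : Metric.sphere (0 : Rn n) 1 × Set.Ioi (0 : ℝ) ↦ F ((p.2 : ℝ) • (p.1 : Rn n)))
      ((sphereMeasure n).prod (.volumeIoiPow (n - 1))) := by
  have h := (volume : Measure (Rn n)).measurePreserving_homeomorphUnitSphereProd
  rw [finrank_euclideanSpace_fin] at h
  rw [← h.integrable_comp_emb (Homeomorph.measurableEmbedding _)]
  have h2 : Integrable (fun x : ({(0 : Rn n)}ᶜ : Set (Rn n)) ↦ F x)
      (Measure.comap (↑) (volume : Measure (Rn n))) := by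
    have := (integrableOn_iff_comap_subtypeVal (μ := volume) (f := F)
      (measurableSet_singleton (0 : Rn n)).compl).1 hF.integrableOn
    exact this
  convert! h2 using 2 with x
  simp only [Function.comp_apply]
  congr 1
  exact congrArg Subtype.val ((homeomorphUnitSphereProd (Rn n)).symm_apply_apply x)

theorem integral_polar {V : Type*} [NormedAddCommGroup V] [NormedSpace ℝ V] (hn : 0 < n)
    {F : Rn n → V} (hF : Integrable F) :
    ∫ x, F x = ∫ e, (∫ r in Set.Ioi (0 : ℝ), r ^ (n - 1) • F (r • (e : Rn n))) ∂sphereMeasure n := by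
  have : Nonempty (Fin n) := ⟨⟨0, hn⟩⟩
  have h := (volume : Measure (Rn n)).measurePreserving_homeomorphUnitSphereProd
  rw [finrank_euclideanSpace_fin] at h
  have h1 := h.integral_comp (Homeomorph.measurableEmbedding _)
    (fun p : Metric.sphere (0 : Rn n) 1 × Set.Ioi (0 : ℝ) ↦ F ((p.2 : ℝ) • (p.1 : Rn n)))
  rw [integral_prod _ (integrable_prod_polar hF)] at h1
  have key (e : Metric.sphere (0 : Rn n) 1) := integral_volumeIoiPow (n - 1) (fun r ↦ F (r • (e : Rn n)))
  simp only [key] at h1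
  rw [← h1]
  have h3 : ∀ x : ({(0 : Rn n)}ᶜ : Set (Rn n)),
      (((homeomorphUnitSphereProd (Rn n)) x).2 : ℝ) • (((homeomorphUnitSphereProd (Rn n)) x).1 : Rn n)
        = x := fun x ↦
    congrArg Subtype.val ((homeomorphUnitSphereProd (Rn n)).symm_apply_apply x)
  simp only [h3]
  rw [integral_subtype_comap (measurableSet_singleton _).compl, restrict_compl_singleton]

theorem integrable_polar {V : Type*} [NormedAddCommGroup V] [NormedSpace ℝ V]
    {F : Rn n → V} (hF : Integrable F) :
    Integrable (fun e : Metric.sphere (0 : Rn n) 1 ↦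
      ∫ r in Set.Ioi (0 : ℝ), r ^ (n - 1) • F (r • (e : Rn n))) (sphereMeasure n) := by
  have h := (integrable_prod_polar hF).integral_prod_left
  have key (e : Metric.sphere (0 : Rn n) 1) := integral_volumeIoiPow (n - 1) (fun r ↦ F (r • (e : Rn n)))
  simpa only [key] using h

/-- The closed annulus `a ≤ |x| ≤ b`. -/
def annulus (n : ℕ) (a b : ℝ) : Set (Rn n) := (fun x ↦ ‖x‖) ⁻¹' Set.Icc a b

theorem measurableSet_annulus (a b : ℝ) : MeasurableSet (annulus n a b) :=
  measurable_norm measurableSet_Icc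

theorem isCompact_annulus (a b : ℝ) : IsCompact (annulus n a b) := by
  refine (isCompact_closedBall (0 : Rn n) b).of_isClosed_subset
    (isClosed_Icc.preimage continuous_norm) fun x hx ↦ ?_
  simpa using hx.2

theorem inner_annulus {V : Type*} [NormedAddCommGroup V] [NormedSpace ℝ V]
    {a b : ℝ} (ha : 0 < a) (hab : a ≤ b) (F : Rn n → V) (e : Metric.sphere (0 : Rn n) 1) :
    ∫ r in Set.Ioi (0 : ℝ), r ^ (n - 1) • (annulus n a b).indicator F (r • (e : Rn n)) =
      ∫ r in a..b, r ^ (n - 1) • F (r • (e : Rn n)) := by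
  have he : ‖(e : Rn n)‖ = 1 := by simp
  rw [intervalIntegral.integral_of_le hab, ← integral_Icc_eq_integral_Ioc,
    ← integral_indicator measurableSet_Ioi, ← integral_indicator measurableSet_Icc]
  congr 1
  ext r
  by_cases hr : r ∈ Set.Icc a b
  · have h0 : r ∈ Set.Ioi (0 : ℝ) := ha.trans_le hr.1
    have h1 : r • (e : Rn n) ∈ annulus n a b := by
      simpa [annulus, norm_smul, he, abs_of_pos (show 0 < r from h0)] using hr
    simp [hr, h0, h1]
  · rw [Set.indicator_of_notMem hr]
    by_cases h0 : r ∈ Set.Ioi (0 : ℝ)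
    · have h1 : r • (e : Rn n) ∉ annulus n a b := by
        simpa [annulus, norm_smul, he, abs_of_pos (show 0 < r from h0)] using hr
      simp [h1]
    · simp [Set.indicator_of_notMem h0]

theorem integral_annulus {V : Type*} [NormedAddCommGroup V] [NormedSpace ℝ V] (hn : 0 < n)
    {a b : ℝ} (ha : 0 < a) (hab : a ≤ b) {F : Rn n → V} (hF : IntegrableOn F (annulus n a b)) :
    ∫ x in annulus n a b, F x =
      ∫ e, (∫ r in a..b, r ^ (n - 1) • F (r • (e : Rn n))) ∂sphereMeasure n := by
  rw [← integral_indicator (measurableSet_annulus a b), integral_polar hn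
    (hF.integrable_indicator (measurableSet_annulus a b))]
  simp only [inner_annulus ha hab]

theorem integrable_annulus {V : Type*} [NormedAddCommGroup V] [NormedSpace ℝ V]
    {a b : ℝ} (ha : 0 < a) (hab : a ≤ b) {F : Rn n → V} (hF : IntegrableOn F (annulus n a b)) :
    Integrable (fun e : Metric.sphere (0 : Rn n) 1 ↦
      ∫ r in a..b, r ^ (n - 1) • F (r • (e : Rn n))) (sphereMeasure n) := by
  have := integrable_polar (hF.integrable_indicator (measurableSet_annulus a b))
  simpa only [inner_annulus ha hab] using this

/-! ### Jets and restrictions to rays -/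

/-- The sum of the norms of the derivatives of order at most two. -/
def jet {E : Type*} [NormedAddCommGroup E] [NormedSpace ℝ E] (f : E → ℂ) (x : E) : ℝ :=
  ‖f x‖ + ‖fderiv ℝ f x‖ + ‖fderiv ℝ (fderiv ℝ f) x‖

theorem jet_nonneg {E : Type*} [NormedAddCommGroup E] [NormedSpace ℝ E] (f : E → ℂ) (x : E) :
    0 ≤ jet f x := by unfold jet; positivity

theorem norm_le_jet {E : Type*} [NormedAddCommGroup E] [NormedSpace ℝ E] (f : E → ℂ) (x : E) :
    ‖f x‖ ≤ jet f x := by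
  have := norm_nonneg (fderiv ℝ f x)
  have := norm_nonneg (fderiv ℝ (fderiv ℝ f) x)
  unfold jet; linarith

theorem norm_fderiv_fderiv {E : Type*} [NormedAddCommGroup E] [NormedSpace ℝ E] (f : E → ℂ)
    (x : E) : ‖fderiv ℝ (fderiv ℝ f) x‖ = ‖iteratedFDeriv ℝ 2 f x‖ := by
  rw [← norm_iteratedFDeriv_one, norm_iteratedFDeriv_fderiv]

theorem continuous_norm_fderiv_fderiv {E : Type*} [NormedAddCommGroup E] [NormedSpace ℝ E]
    {f : E → ℂ} (hf : ContDiff ℝ 2 f) : Continuous fun x ↦ ‖fderiv ℝ (fderiv ℝ f) x‖ := by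
  simp only [norm_fderiv_fderiv]
  exact (hf.continuous_iteratedFDeriv (m := 2) le_rfl).norm

theorem continuous_jet {E : Type*} [NormedAddCommGroup E] [NormedSpace ℝ E] {f : E → ℂ}
    (hf : ContDiff ℝ 2 f) : Continuous (jet f) := by
  have h1 := hf.continuous.norm
  have h2 := (hf.continuous_fderiv (by norm_num)).norm
  have h3 := continuous_norm_fderiv_fderiv hf
  exact (h1.add h2).add h3

/-- `r ↦ r^m f(r e)`. -/
def ray (m : ℕ) (f : Rn n → ℂ) (e : Rn n) (r : ℝ) : ℂ := (r : ℂ) ^ m * f (r • e)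

/-- The derivative of `ray`. -/
def ray' (m : ℕ) (f : Rn n → ℂ) (e : Rn n) (r : ℝ) : ℂ :=
  (m * (r : ℂ) ^ (m - 1)) * f (r • e) + (r : ℂ) ^ m * fderiv ℝ f (r • e) e

/-- The second derivative of `ray`. -/
def ray'' (m : ℕ) (f : Rn n → ℂ) (e : Rn n) (r : ℝ) : ℂ :=
  (m * (((m - 1 : ℕ) : ℂ) * (r : ℂ) ^ (m - 1 - 1)) * f (r • e) +
    (m * (r : ℂ) ^ (m - 1)) * fderiv ℝ f (r • e) e) +
  ((m * (r : ℂ) ^ (m - 1)) * fderiv ℝ f (r • e) e +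
    (r : ℂ) ^ m * fderiv ℝ (fderiv ℝ f) (r • e) e e)

theorem hasDerivAt_ofReal_pow (m : ℕ) (r : ℝ) :
    HasDerivAt (fun r : ℝ ↦ (r : ℂ) ^ m) (m * (r : ℂ) ^ (m - 1)) r := by
  simpa using (hasDerivAt_pow m (r : ℂ)).comp_ofReal

theorem hasDerivAt_smul_const (e : Rn n) (r : ℝ) : HasDerivAt (fun r : ℝ ↦ r • e) e r := by
  simpa using (hasDerivAt_id r).smul_const e

theorem hasDerivAt_ray (m : ℕ) {f : Rn n → ℂ} (hf : ContDiff ℝ 1 f) (e : Rn n) (r : ℝ) :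
    HasDerivAt (ray m f e) (ray' m f e r) r := by
  have h := ((hf.differentiable (by norm_num)) (r • e)).hasFDerivAt.comp_hasDerivAt r
    (hasDerivAt_smul_const e r)
  exact (hasDerivAt_ofReal_pow m r).mul h

theorem hasDerivAt_ray' (m : ℕ) {f : Rn n → ℂ} (hf : ContDiff ℝ 2 f) (e : Rn n) (r : ℝ) :
    HasDerivAt (ray' m f e) (ray'' m f e r) r := by
  have h := ((hf.differentiable (by norm_num)) (r • e)).hasFDerivAt.comp_hasDerivAt r
    (hasDerivAt_smul_const e r)
  have h' := (((hf.fderiv_right (m := 1) (by norm_num)).differentiable (by norm_num))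
    (r • e)).hasFDerivAt.comp_hasDerivAt r (hasDerivAt_smul_const e r)
  have h'' := h'.clm_apply (hasDerivAt_const r e)
  simp only [map_zero, add_zero] at h''
  exact (((hasDerivAt_ofReal_pow (m - 1) r).const_mul (m : ℂ)).mul h).add
    ((hasDerivAt_ofReal_pow m r).mul h'')

/-- A derivative that falls on the Jacobian power costs only a constant when the radius is bounded
below, so the bounds on rays keep the full power r^m and stay uniform for large radii. -/
theorem mul_pow_pred_le (m : ℕ) {c r : ℝ} (hc : 0 < c) (hr : c ≤ r) :
    (m : ℝ) * r ^ (m - 1) ≤ m / c * r ^ m := by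
  have hr0 : 0 < r := hc.trans_le hr
  rcases m with _ | m
  · simp
  · rw [Nat.add_sub_cancel, pow_succ, div_mul_eq_mul_div, le_div_iff₀ hc]
    calc ((m + 1 : ℕ) : ℝ) * r ^ m * c ≤ ((m + 1 : ℕ) : ℝ) * r ^ m * r := by gcongr
      _ = _ := by ring

theorem norm_ray_le (m : ℕ) (f : Rn n → ℂ) {e : Rn n} {r : ℝ} (hr : 0 ≤ r) :
    ‖ray m f e r‖ = r ^ m * ‖f (r • e)‖ := by
  unfold ray
  rw [norm_mul, norm_pow, Complex.norm_real, Real.norm_of_nonneg hr]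

theorem norm_ray'_le (m : ℕ) (f : Rn n → ℂ) {e : Rn n} (he : ‖e‖ = 1) {c r : ℝ} (hc : 0 < c)
    (hr : c ≤ r) :
    ‖ray' m f e r‖ ≤ (m / c + 1) * (r ^ m * (‖f (r • e)‖ + ‖fderiv ℝ f (r • e)‖)) := by
  have hr0 : 0 < r := hc.trans_le hr
  have h1 := mul_pow_pred_le m hc hr
  have h2 : ‖fderiv ℝ f (r • e) e‖ ≤ ‖fderiv ℝ f (r • e)‖ := by
    simpa [he] using (fderiv ℝ f (r • e)).le_opNorm e
  unfold ray'
  refine (norm_add_le _ _).trans ?_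
  simp only [norm_mul, norm_pow, Complex.norm_real, Real.norm_of_nonneg hr0.le, Complex.norm_natCast]
  calc (m : ℝ) * r ^ (m - 1) * ‖f (r • e)‖ + r ^ m * ‖fderiv ℝ f (r • e) e‖
      ≤ m / c * r ^ m * ‖f (r • e)‖ + r ^ m * ‖fderiv ℝ f (r • e)‖ := by gcongr
    _ ≤ m / c * r ^ m * ‖f (r • e)‖ + r ^ m * ‖fderiv ℝ f (r • e)‖ +
        (m / c * r ^ m * ‖fderiv ℝ f (r • e)‖ + r ^ m * ‖f (r • e)‖) :=
      le_add_of_nonneg_right (by positivity)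
    _ = _ := by ring

theorem norm_ray''_le (m : ℕ) (f : Rn n → ℂ) {e : Rn n} (he : ‖e‖ = 1) {c r : ℝ} (hc : 0 < c)
    (hr : c ≤ r) :
    ‖ray'' m f e r‖ ≤ (m / c + 1) ^ 2 * (r ^ m * jet f (r • e)) := by
  have hr0 : 0 < r := hc.trans_le hr
  have h1 := mul_pow_pred_le m hc hr
  have h2 : ‖fderiv ℝ f (r • e) e‖ ≤ ‖fderiv ℝ f (r • e)‖ := by
    simpa [he] using (fderiv ℝ f (r • e)).le_opNorm e
  have h3 : ‖fderiv ℝ (fderiv ℝ f) (r • e) e e‖ ≤ ‖fderiv ℝ (fderiv ℝ f) (r • e)‖ := by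
    simpa [he] using (fderiv ℝ (fderiv ℝ f) (r • e)).le_opNorm₂ e e
  have h4 : (m : ℝ) * (((m - 1 : ℕ) : ℝ) * r ^ (m - 1 - 1)) ≤ (m / c) ^ 2 * r ^ m := by
    calc (m : ℝ) * (((m - 1 : ℕ) : ℝ) * r ^ (m - 1 - 1))
        ≤ m * (((m - 1 : ℕ) : ℝ) / c * r ^ (m - 1)) := by
          exact mul_le_mul_of_nonneg_left (mul_pow_pred_le (m - 1) hc hr) m.cast_nonneg
      _ ≤ m * ((m : ℝ) / c * r ^ (m - 1)) := by
          gcongr; exact Nat.sub_le m 1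
      _ = m / c * (m * r ^ (m - 1)) := by ring
      _ ≤ m / c * (m / c * r ^ m) := by gcongr
      _ = _ := by ring
  unfold ray''
  refine (norm_add_le _ _).trans ((add_le_add (norm_add_le _ _) (norm_add_le _ _)).trans ?_)
  simp only [norm_mul, norm_pow, Complex.norm_real, Real.norm_of_nonneg hr0.le, Complex.norm_natCast]
  unfold jet
  set A : ℝ := m / c
  have hA : 0 ≤ A := by positivity
  set x := ‖f (r • e)‖
  set y := ‖fderiv ℝ f (r • e)‖
  set z := ‖fderiv ℝ (fderiv ℝ f) (r • e)‖
  have hx : 0 ≤ x := norm_nonneg _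
  have hy : 0 ≤ y := norm_nonneg _
  have hz : 0 ≤ z := norm_nonneg (fderiv ℝ (fderiv ℝ f) (r • e))
  have hrm : 0 ≤ r ^ m := by positivity
  calc _ ≤ (A ^ 2 * r ^ m * x + A * r ^ m * y) + (A * r ^ m * y + r ^ m * z) := by gcongr
    _ ≤ (A ^ 2 * r ^ m * x + A * r ^ m * y) + (A * r ^ m * y + r ^ m * z) +
        (r ^ m * ((2 * A + 1) * x + (A ^ 2 + 1) * y + (A ^ 2 + 2 * A) * z)) :=
      le_add_of_nonneg_right (by positivity)
    _ = _ := by ring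

/-- In dimension m + 2 the Jacobian is r^m · r. The power r^m joins the amplitude, and the last
factor r stays with the symbol, where `integral_mul_res` needs it. This is the use of n ≥ 2. -/
theorem inner_annulus_res (m : ℕ) (f : Rn (m + 2) → ℂ) (κ ε a b : ℝ) (ha : 0 ≤ a) (hab : a ≤ b)
    (e : Metric.sphere (0 : Rn (m + 2)) 1) :
    ∫ r in a..b, r ^ (m + 2 - 1) • (f (r • (e : Rn (m + 2))) * res κ ε ‖r • (e : Rn (m + 2))‖) =
      ∫ r in a..b, ray m f e r * (r * res κ ε r) := by
  refine intervalIntegral.integral_congr fun r hr ↦ ?_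
  rw [Set.uIcc_of_le hab] at hr
  have hr0 : 0 ≤ r := ha.trans hr.1
  have he : ‖(e : Rn (m + 2))‖ = 1 := by simp
  simp only [norm_smul, he, mul_one, Real.norm_of_nonneg hr0, ray, Complex.real_smul]
  push_cast
  ring

theorem integrable_mul_res {f : Rn n → ℂ} (hf : Integrable f) (κ : ℝ) {ε : ℝ} (hε : 0 < ε) :
    Integrable fun ξ ↦ f ξ * res κ ε ‖ξ‖ := by
  refine hf.mul_bdd (c := ε⁻¹) ?_ ?_
  · exact ((continuous_res κ hε).comp continuous_norm).aestronglyMeasurable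
  · exact ae_of_all _ fun x ↦ norm_res_le_inv_eps κ hε _

/-- The integral over an annulus in polar coordinates. -/
theorem integral_annulus_res (m : ℕ) {f : Rn (m + 2) → ℂ} (hf : Integrable f) (κ : ℝ) {ε : ℝ}
    (hε : 0 < ε) {a b : ℝ} (ha : 0 < a) (hab : a ≤ b) :
    ∫ ξ in annulus (m + 2) a b, f ξ * res κ ε ‖ξ‖ =
      ∫ e : Metric.sphere (0 : Rn (m + 2)) 1,
        (∫ r in a..b, ray m f e r * (r * res κ ε r)) ∂sphereMeasure (m + 2) := by
  rw [integral_annulus (by positivity) ha hab (integrable_mul_res hf κ hε).integrableOn]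
  simp only [inner_annulus_res m f κ ε a b ha.le hab]

theorem integrable_annulus_res (m : ℕ) {f : Rn (m + 2) → ℂ} (hf : Integrable f) (κ : ℝ) {ε : ℝ}
    (hε : 0 < ε) {a b : ℝ} (ha : 0 < a) (hab : a ≤ b) :
    Integrable (fun e : Metric.sphere (0 : Rn (m + 2)) 1 ↦
        (∫ r in a..b, ray m f e r * (r * res κ ε r))) (sphereMeasure (m + 2)) := by
  have := integrable_annulus ha hab (integrable_mul_res hf κ hε).integrableOn
  simpa only [inner_annulus_res m f κ ε a b ha.le hab] using this

/-! ### Existence of the limit -/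

theorem sq_mem_compl_annulus {κ d a b : ℝ} (hb0 : 0 ≤ b)
    (ha : a ^ 2 = κ ^ 2 - d) (hb : b ^ 2 = κ ^ 2 + d) {ξ : Rn n} (h : ξ ∉ annulus n a b) :
    d ≤ |κ ^ 2 - ‖ξ‖ ^ 2| := by
  have h' : ¬ (a ≤ ‖ξ‖ ∧ ‖ξ‖ ≤ b) := h
  rw [not_and_or, not_le, not_le] at h'
  rcases h' with h' | h'
  · have : ‖ξ‖ ^ 2 ≤ a ^ 2 := by gcongr
    exact le_trans (by linarith) (le_abs_self _)
  · have : b ^ 2 ≤ ‖ξ‖ ^ 2 := by gcongr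
    exact le_trans (by linarith) (neg_le_abs _)

theorem tendsto_integral_compl_annulus {f : Rn n → ℂ} (hf : Integrable f) {κ d a b : ℝ}
    (hd : 0 < d) (hb0 : 0 ≤ b)
    (ha : a ^ 2 = κ ^ 2 - d) (hb : b ^ 2 = κ ^ 2 + d) :
    Tendsto (fun ε ↦ ∫ ξ in (annulus n a b)ᶜ, f ξ * res κ ε ‖ξ‖) (𝓝[>] 0)
      (𝓝 (∫ ξ in (annulus n a b)ᶜ, f ξ * ((κ ^ 2 - ‖ξ‖ ^ 2 : ℝ) : ℂ)⁻¹)) := by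
  have hms := (measurableSet_annulus (n := n) a b).compl
  have hne : ∀ ξ ∈ (annulus n a b)ᶜ, κ ^ 2 ≠ ‖ξ‖ ^ 2 := fun ξ hξ h ↦ by
    have := sq_mem_compl_annulus hb0 ha hb hξ
    rw [h, sub_self, abs_zero] at this
    linarith
  refine tendsto_integral_filter_of_dominated_convergence (fun ξ ↦ ‖f ξ‖ * d⁻¹) ?_ ?_ ?_ ?_
  · filter_upwards [self_mem_nhdsWithin] with ε hε
    exact (integrable_mul_res hf κ hε).aestronglyMeasurable.restrict
  · refine Eventually.of_forall fun ε ↦ (ae_restrict_iff' hms).2 (ae_of_all _ fun ξ hξ ↦ ?_)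
    rw [norm_mul]
    gcongr
    exact (norm_res_le κ ε _ (hne ξ hξ)).trans
      (inv_anti₀ hd (sq_mem_compl_annulus hb0 ha hb hξ))
  · exact (hf.norm.mul_const _).integrableOn
  · exact (ae_restrict_iff' hms).2 (ae_of_all _ fun ξ hξ ↦ (tendsto_res κ _ (hne ξ hξ)).const_mul _)

theorem exists_bound_ray (m : ℕ) {f : Rn n → ℂ} (hf : ContDiff ℝ 1 f) {a : ℝ} (ha : 0 < a) (b : ℝ) :
    ∃ M, ∀ e : Rn n, ‖e‖ = 1 → ∀ r ∈ Set.Icc a b, ‖ray m f e r‖ ≤ M ∧ ‖ray' m f e r‖ ≤ M := by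
  obtain ⟨M₀, hM₀⟩ := (isCompact_annulus (n := n) a b).exists_bound_of_continuousOn
    hf.continuous.continuousOn
  obtain ⟨M₁, hM₁⟩ := (isCompact_annulus (n := n) a b).exists_bound_of_continuousOn
    (hf.continuous_fderiv (by norm_num)).continuousOn
  refine ⟨(m / a + 1) * (b ^ m * (|M₀| + |M₁|)), fun e he r hr ↦ ?_⟩
  have hr0 : 0 < r := ha.trans_le hr.1
  have hmem : r • e ∈ annulus n a b := by
    simpa [annulus, norm_smul, he, abs_of_pos hr0] using hr
  have hb0 : 0 < b := hr0.trans_le hr.2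
  have h0 := (hM₀ _ hmem).trans (le_abs_self _)
  have h1 := (hM₁ _ hmem).trans (le_abs_self _)
  have hrb := hr.2
  constructor
  · rw [norm_ray_le m f hr0.le]
    calc r ^ m * ‖f (r • e)‖ ≤ b ^ m * (|M₀| + |M₁|) := by
          gcongr; exact h0.trans (le_add_of_nonneg_right (abs_nonneg _))
      _ ≤ _ := le_mul_of_one_le_left (by positivity) (le_add_of_nonneg_left (by positivity))
  · refine (norm_ray'_le m f he ha hr.1).trans ?_
    gcongr

/-- The limit `ε → 0+` of `∫ f(ξ) (κ² - |ξ|² + iε)⁻¹ dξ` exists. -/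
theorem exists_tendsto_integral_res (hn : 2 ≤ n) {f : Rn n → ℂ} (hf : ContDiff ℝ 1 f)
    (hfi : Integrable f) {κ : ℝ} (hκ : 0 < κ) :
    ∃ L, Tendsto (fun ε ↦ ∫ ξ, f ξ * res κ ε ‖ξ‖) (𝓝[>] 0) (𝓝 L) := by
  obtain ⟨m, rfl⟩ : ∃ m, n = m + 2 := ⟨n - 2, by omega⟩
  -- Only the existence of the limit is at stake, so any d with 0 < d < κ² would do.
  set d := κ ^ 2 / 2 with hd'
  have hd : 0 < d := by positivity
  set a := Real.sqrt (κ ^ 2 - d)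
  set b := Real.sqrt (κ ^ 2 + d)
  have ha : a ^ 2 = κ ^ 2 - d := Real.sq_sqrt (by rw [hd']; nlinarith)
  have hb : b ^ 2 = κ ^ 2 + d := Real.sq_sqrt (by positivity)
  have ha0 : 0 < a := Real.sqrt_pos.2 (by rw [hd']; nlinarith)
  have hb0 : 0 ≤ b := Real.sqrt_nonneg _
  have hab : a ≤ b := Real.sqrt_le_sqrt (by linarith)
  have hκm : κ ∈ Set.Icc a b := ⟨by nlinarith, by nlinarith⟩
  obtain ⟨M, hM⟩ := exists_bound_ray m hf ha0 b
  have hlim : ∀ e : Metric.sphere (0 : Rn (m + 2)) 1,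
      ∃ L, Tendsto (fun ε ↦ ∫ r in a..b, ray m f e r * (r * res κ ε r)) (𝓝[>] 0) (𝓝 L) := fun e ↦
    tendsto_integral_res (G' := ray' m f e) hκ hd ha0.le hb0 ha hb (fun r _ ↦ hasDerivAt_ray m hf e r)
      fun r hr ↦ (hM e (by simp) r hr).2
  choose L hL using hlim
  have h1 : Tendsto (fun ε ↦ ∫ ξ in annulus (m + 2) a b, f ξ * res κ ε ‖ξ‖) (𝓝[>] 0)
      (𝓝 (∫ e, L e ∂sphereMeasure (m + 2))) := by
    have : Tendsto (fun ε ↦ ∫ e : Metric.sphere (0 : Rn (m + 2)) 1,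
        (∫ r in a..b, ray m f e r * (r * res κ ε r)) ∂sphereMeasure (m + 2)) (𝓝[>] 0)
      (𝓝 (∫ e, L e ∂sphereMeasure (m + 2))) := by
      refine tendsto_integral_filter_of_dominated_convergence (fun _ ↦ M * (b - a) + 2 * M)
        ?_ ?_ (integrable_const _) (ae_of_all _ hL)
      · filter_upwards [self_mem_nhdsWithin] with ε hε
        exact (integrable_annulus_res m hfi κ hε ha0 hab).aestronglyMeasurable
      · filter_upwards [self_mem_nhdsWithin] with ε hε
        refine ae_of_all _ fun e ↦ ?_
        have := norm_integral_res_le (G' := ray' m f e) hκ hd ha0.le hb0 ha hb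
          (fun r _ ↦ hasDerivAt_ray m hf e r) (fun r hr ↦ (hM e (by simp) r hr).2) hε
        have h2 := (hM e (by simp) κ hκm).1
        linarith
    refine this.congr' ?_
    filter_upwards [self_mem_nhdsWithin] with ε hε
    exact (integral_annulus_res m hfi κ hε ha0 hab).symm
  have h2 := tendsto_integral_compl_annulus hfi hd hb0 ha hb
  refine ⟨_, (h1.add h2).congr' ?_⟩
  filter_upwards [self_mem_nhdsWithin] with ε hε
  exact integral_add_compl (measurableSet_annulus a b) (integrable_mul_res hfi κ hε)

/-! ### Uniform bounds -/

/-- The estimate by suprema of G and G' is converted into an L¹ bound: the supremum of each is at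
most its mean plus the integral of its derivative. Hence the second derivative appears, and after
integration over directions the bound is a volume integral rather than an integral over the sphere.
-/
theorem norm_integral_res_le_integral {G G' G'' : ℝ → ℂ} {h : ℝ → ℝ} {κ d a b : ℝ} (hκ : 0 < κ)
    (hd : 0 < d) (ha0 : 0 ≤ a) (hb0 : 0 ≤ b) (ha : a ^ 2 = κ ^ 2 - d) (hb : b ^ 2 = κ ^ 2 + d)
    (hG : ∀ r ∈ Set.Icc a b, HasDerivAt G (G' r) r)
    (hG' : ∀ r ∈ Set.Icc a b, HasDerivAt G' (G'' r) r) (hc : ContinuousOn G'' (Set.Icc a b))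
    (hh : ContinuousOn h (Set.Icc a b)) (h0 : ∀ r ∈ Set.Icc a b, ‖G r‖ ≤ h r)
    (h1 : ∀ r ∈ Set.Icc a b, ‖G' r‖ ≤ h r) (h2 : ∀ r ∈ Set.Icc a b, ‖G'' r‖ ≤ h r)
    {ε : ℝ} (hε : 0 < ε) :
    ‖∫ r in a..b, G r * (r * res κ ε r)‖ ≤
      (b - a + 2) * ((b - a)⁻¹ + 1) * ∫ r in a..b, h r := by
  have hab : a < b := by nlinarith
  have hκm : κ ∈ Set.Icc a b := ⟨by nlinarith, by nlinarith⟩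
  have hcG : ContinuousOn G (Set.Icc a b) := fun x hx ↦ (hG x hx).continuousAt.continuousWithinAt
  have hcG' : ContinuousOn G' (Set.Icc a b) := fun x hx ↦ (hG' x hx).continuousAt.continuousWithinAt
  have hp : 0 < b - a := sub_pos.2 hab
  set H := ∫ r in a..b, h r
  have mono : ∀ {g : ℝ → ℂ}, ContinuousOn g (Set.Icc a b) → (∀ r ∈ Set.Icc a b, ‖g r‖ ≤ h r) →
      ∫ r in a..b, ‖g r‖ ≤ H := fun {g} hg hgh ↦
    intervalIntegral.integral_mono_on hab.le
      (by rw [← Set.uIcc_of_le hab.le] at hg; exact hg.norm.intervalIntegrable)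
      (by rw [← Set.uIcc_of_le hab.le] at hh; exact hh.intervalIntegrable) hgh
  have hM : ∀ r ∈ Set.Icc a b, ‖G' r‖ ≤ ((b - a)⁻¹ + 1) * H := fun r hr ↦ by
    refine (norm_le_of_integral hab hG' hc hr).trans ?_
    have e1 := mono hcG' h1
    have e2 := mono hc h2
    calc _ ≤ (b - a)⁻¹ * H + H := by gcongr
      _ = _ := by ring
  have hGκ : ‖G κ‖ ≤ ((b - a)⁻¹ + 1) * H := by
    refine (norm_le_of_integral hab hG hcG' hκm).trans ?_
    have e1 := mono hcG h0
    have e2 := mono hcG' h1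
    calc _ ≤ (b - a)⁻¹ * H + H := by gcongr
      _ = _ := by ring
  refine (norm_integral_res_le hκ hd ha0 hb0 ha hb hG hM hε).trans ?_
  calc _ ≤ ((b - a)⁻¹ + 1) * H * (b - a) + 2 * (((b - a)⁻¹ + 1) * H) := by gcongr
    _ = _ := by ring

theorem continuous_ray'' (m : ℕ) {f : Rn n → ℂ} (hf : ContDiff ℝ 2 f) (e : Rn n) :
    Continuous (ray'' m f e) := by
  have h0 : Continuous fun r : ℝ ↦ r • e := by fun_prop
  have h1 : Continuous fun r : ℝ ↦ f (r • e) := hf.continuous.comp h0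
  have h2 : Continuous fun r : ℝ ↦ fderiv ℝ f (r • e) e :=
    ((hf.continuous_fderiv (by norm_num)).comp h0).clm_apply continuous_const
  have h3 : Continuous fun r : ℝ ↦ fderiv ℝ (fderiv ℝ f) (r • e) e e :=
    ((((hf.fderiv_right (m := 1) (by norm_num)).continuous_fderiv (by norm_num)).comp
      h0).clm_apply continuous_const).clm_apply continuous_const
  unfold ray''
  fun_prop

/-- The kernel `((κ + r) (1 + |κ - r|))⁻¹` that dominates the resolvent after averaging. -/
def kerK (κ r : ℝ) : ℝ := ((κ + r) * (1 + |κ - r|))⁻¹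

theorem kerK_nonneg {κ r : ℝ} (hκ : 0 < κ) (hr : 0 ≤ r) : 0 ≤ kerK κ r := by
  unfold kerK; positivity

theorem kerK_le {κ r : ℝ} (hκ : 0 < κ) (hr : 0 ≤ r) : kerK κ r ≤ κ⁻¹ := by
  unfold kerK
  apply inv_anti₀ hκ
  have := abs_nonneg (κ - r)
  nlinarith [mul_nonneg (add_nonneg hκ.le hr) this]

theorem continuous_kerK {κ : ℝ} (hκ : 0 < κ) : Continuous fun ξ : Rn n ↦ kerK κ ‖ξ‖ := by
  unfold kerK
  refine Continuous.inv₀ (by fun_prop) fun ξ ↦ ?_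
  positivity

theorem integrable_mul_kerK {h : Rn n → ℝ} (hh : Integrable h) {κ : ℝ} (hκ : 0 < κ) :
    Integrable fun ξ ↦ h ξ * kerK κ ‖ξ‖ := by
  refine hh.mul_bdd (c := κ⁻¹) (continuous_kerK hκ).aestronglyMeasurable (ae_of_all _ fun ξ ↦ ?_)
  rw [Real.norm_of_nonneg (kerK_nonneg hκ (norm_nonneg _))]
  exact kerK_le hκ (norm_nonneg _)

/-- The choice d = κ₀κ/2 makes the shell of width comparable to κ₀ for every κ ≥ κ₀: wide enough to
average over, thin enough to stay where r is comparable to κ, and such that |κ − r| ≥ κ₀/6 outside.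
-/
theorem exists_radii {κ₀ κ : ℝ} (hκ₀ : 0 < κ₀) (hκ : κ₀ ≤ κ) :
    ∃ a b : ℝ, a ^ 2 = κ ^ 2 - κ₀ * κ / 2 ∧ b ^ 2 = κ ^ 2 + κ₀ * κ / 2 ∧ κ / 2 ≤ a ∧ a ≤ κ ∧
      κ ≤ b ∧ b ≤ 2 * κ ∧ κ₀ / 4 ≤ b - a ∧ b - a ≤ κ₀ ∧ κ₀ / 6 ≤ κ - a ∧ κ₀ / 6 ≤ b - κ := by
  have hκ0 : 0 < κ := hκ₀.trans_le hκ
  set d := κ₀ * κ / 2 with hd'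
  have hd : 0 < d := by positivity
  have hdκ : d ≤ κ ^ 2 / 2 := by rw [hd']; nlinarith
  set a := Real.sqrt (κ ^ 2 - d)
  set b := Real.sqrt (κ ^ 2 + d)
  have ha : a ^ 2 = κ ^ 2 - d := Real.sq_sqrt (by nlinarith)
  have hb : b ^ 2 = κ ^ 2 + d := Real.sq_sqrt (by positivity)
  have hb0 : 0 ≤ b := Real.sqrt_nonneg _
  have ha0 : 0 ≤ a := Real.sqrt_nonneg _
  have haκ : κ / 2 ≤ a := by nlinarith
  have haκ' : a ≤ κ := by nlinarith
  have hbκ : b ≤ 2 * κ := by nlinarith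
  have hbκ' : κ ≤ b := by nlinarith
  have h1 : (b - a) * (b + a) = κ₀ * κ := by
    have : (b - a) * (b + a) = b ^ 2 - a ^ 2 := by ring
    rw [this, ha, hb, hd']; ring
  have h2 : (κ - a) * (κ + a) = κ₀ * κ / 2 := by
    have : (κ - a) * (κ + a) = κ ^ 2 - a ^ 2 := by ring
    rw [this, ha]; ring
  have h3 : (b - κ) * (b + κ) = κ₀ * κ / 2 := by
    have : (b - κ) * (b + κ) = b ^ 2 - κ ^ 2 := by ring
    rw [this, hb]; ring
  have low : ∀ x y M : ℝ, 0 ≤ x → y ≤ M * κ → x * y ≤ x * M * κ := fun x y M hx hy ↦ by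
    calc x * y ≤ x * (M * κ) := by gcongr
      _ = _ := by ring
  refine ⟨a, b, ha, hb, haκ, haκ', hbκ', hbκ, ?_, ?_, ?_, ?_⟩
  · have := low (b - a) (b + a) 4 (by linarith) (by linarith)
    rw [h1] at this
    have := le_of_mul_le_mul_right this hκ0
    linarith
  · have : (b - a) * κ ≤ κ₀ * κ := by
      rw [← h1]
      exact mul_le_mul_of_nonneg_left (by linarith) (by linarith)
    exact le_of_mul_le_mul_right this hκ0
  · have := low (κ - a) (κ + a) 2 (by linarith) (by linarith)
    rw [h2, mul_div_right_comm] at this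
    have := le_of_mul_le_mul_right this hκ0
    linarith
  · have := low (b - κ) (b + κ) 3 (by linarith) (by linarith)
    rw [h3, mul_div_right_comm] at this
    have := le_of_mul_le_mul_right this hκ0
    linarith

set_option maxHeartbeats 1000000 in
/-- Uniform bound of the regularized integral, for wave numbers bounded below. -/
theorem exists_norm_integral_res_le (hn : 2 ≤ n) {κ₀ : ℝ} (hκ₀ : 0 < κ₀) :
    ∃ C : ℝ, 0 ≤ C ∧ ∀ κ, κ₀ ≤ κ → ∀ f : Rn n → ℂ, ContDiff ℝ 2 f → Integrable (jet f) →
      ∀ ε, 0 < ε → ‖∫ ξ, f ξ * res κ ε ‖ξ‖‖ ≤ C * ∫ ξ, jet f ξ * kerK κ ‖ξ‖ := by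
  obtain ⟨m, rfl⟩ : ∃ m, n = m + 2 := ⟨n - 2, by omega⟩
  -- The constant of `norm_ray''_le` for radii at least κ₀/2, which holds throughout the shell.
  set A : ℝ := (m / (κ₀ / 2) + 1) ^ 2 with hA
  set B : ℝ := (κ₀ + 2) * (4 / κ₀ + 1) * (2 * A) with hB
  have hA1 : 1 ≤ (m / (κ₀ / 2) + 1 : ℝ) := le_add_of_nonneg_left (by positivity)
  have hA1' : 1 ≤ A := one_le_pow₀ hA1
  refine ⟨B * (3 * (1 + κ₀)) + (6 / κ₀ + 1), by positivity, fun κ hκ f hf hfj ε hε ↦ ?_⟩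
  have hκ0 : 0 < κ := hκ₀.trans_le hκ
  have hfi : Integrable f := hfj.mono' hf.continuous.aestronglyMeasurable
    (ae_of_all _ (norm_le_jet f))
  have hf1 : ContDiff ℝ 1 f := hf.of_le (by norm_num)
  obtain ⟨a, b, ha, hb, haκ, haκ', hbκ', hbκ, hba_low, hba_up, haκ₀, hbκ₀⟩ := exists_radii hκ₀ hκ
  set d := κ₀ * κ / 2
  have hd : 0 < d := by positivity
  have hapos : 0 < a := (half_pos hκ0).trans_le haκ
  have ha0 : 0 ≤ a := hapos.le
  have hb0 : 0 ≤ b := by linarith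
  have hab : a < b := by linarith
  have hjc := continuous_jet hf
  have hray : ∀ e : Metric.sphere (0 : Rn (m + 2)) 1,
      ‖∫ r in a..b, ray m f e r * (r * res κ ε r)‖ ≤
        B / κ * ∫ r in a..b, r ^ (m + 2 - 1) • jet f (r • (e : Rn (m + 2))) := by
    intro e
    have he : ‖(e : Rn (m + 2))‖ = 1 := by simp
    have hcont : Continuous fun r : ℝ ↦ jet f (r • (e : Rn (m + 2))) := hjc.comp (by fun_prop)
    have hh : ContinuousOn (fun r : ℝ ↦ A * (r ^ m * jet f (r • (e : Rn (m + 2))))) (Set.Icc a b) :=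
      Continuous.continuousOn (by fun_prop)
    have hbd : ∀ r ∈ Set.Icc a b, κ₀ / 2 ≤ r := fun r hr ↦ by linarith [hr.1]
    have key := norm_integral_res_le_integral hκ0 hd ha0 hb0 ha hb
      (fun r _ ↦ hasDerivAt_ray m hf1 e r) (fun r _ ↦ hasDerivAt_ray' m hf e r)
      (continuous_ray'' m hf e).continuousOn hh
      (fun r hr ↦ by
        have hr0 : 0 ≤ r := ha0.trans hr.1
        rw [norm_ray_le m f hr0]
        refine le_trans ?_ (le_mul_of_one_le_left (by have := jet_nonneg f (r • (e : Rn (m + 2))); positivity) hA1')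
        gcongr
        exact norm_le_jet _ _)
      (fun r hr ↦ by
        have hr0 : 0 ≤ r := ha0.trans hr.1
        refine (norm_ray'_le m f he (half_pos hκ₀) (hbd r hr)).trans ?_
        have h1 : (m / (κ₀ / 2) + 1 : ℝ) ≤ A := by
          rw [hA, sq]; exact le_mul_of_one_le_left (by positivity) hA1
        have h2 : ‖f (r • (e : Rn (m + 2)))‖ + ‖fderiv ℝ f (r • (e : Rn (m + 2)))‖ ≤
            jet f (r • (e : Rn (m + 2))) := by
          have := norm_nonneg (fderiv ℝ (fderiv ℝ f) (r • (e : Rn (m + 2))))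
          unfold jet; linarith
        gcongr)
      (fun r hr ↦ norm_ray''_le m f he (half_pos hκ₀) (hbd r hr)) hε
    refine key.trans ?_
    have h3 : (b - a)⁻¹ ≤ 4 / κ₀ := by
      rw [← inv_div]; exact inv_anti₀ (by positivity) hba_low
    -- The integrand lacks one factor r of the full Jacobian. As r ≥ κ/2, inserting it costs 2/κ,
    -- and this is the gain κ⁻¹ over the shell.
    have h4 : ∫ r in a..b, A * (r ^ m * jet f (r • (e : Rn (m + 2)))) ≤
        (2 * A / κ) * ∫ r in a..b, r ^ (m + 2 - 1) • jet f (r • (e : Rn (m + 2))) := by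
      rw [← intervalIntegral.integral_const_mul]
      refine intervalIntegral.integral_mono_on hab.le
        (Continuous.intervalIntegrable (by fun_prop) _ _)
        (Continuous.intervalIntegrable (by fun_prop) _ _) fun r hr ↦ ?_
      have hr0 : 0 ≤ r := ha0.trans hr.1
      have hj := jet_nonneg f (r • (e : Rn (m + 2)))
      have h5 : 1 ≤ 2 / κ * r := by
        rw [div_mul_eq_mul_div, one_le_div hκ0]; linarith [hr.1]
      calc A * (r ^ m * jet f (r • (e : Rn (m + 2))))
          ≤ A * (r ^ m * jet f (r • (e : Rn (m + 2)))) * (2 / κ * r) :=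
            le_mul_of_one_le_right (by positivity) h5
        _ = 2 * A / κ * (r ^ (m + 1) * jet f (r • (e : Rn (m + 2)))) := by ring
        _ = _ := rfl
    have h6 : 0 ≤ ∫ r in a..b, A * (r ^ m * jet f (r • (e : Rn (m + 2)))) :=
      intervalIntegral.integral_nonneg hab.le fun r hr ↦ by
        have hr0 : 0 ≤ r := ha0.trans hr.1
        have hj := jet_nonneg f (r • (e : Rn (m + 2)))
        positivity
    calc _ ≤ (κ₀ + 2) * (4 / κ₀ + 1) *
          ((2 * A / κ) * ∫ r in a..b, r ^ (m + 2 - 1) • jet f (r • (e : Rn (m + 2)))) := by gcongr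
      _ = _ := by rw [hB]; ring
  have hnear : ‖∫ ξ in annulus (m + 2) a b, f ξ * res κ ε ‖ξ‖‖ ≤
      B * (3 * (1 + κ₀)) * ∫ ξ in annulus (m + 2) a b, jet f ξ * kerK κ ‖ξ‖ := by
    rw [integral_annulus_res m hfi κ hε hapos hab.le]
    refine (norm_integral_le_integral_norm _).trans ?_
    refine (integral_mono (integrable_annulus_res m hfi κ hε hapos hab.le).norm
      ((integrable_annulus hapos hab.le hfj.integrableOn).const_mul (B / κ)) hray).trans ?_
    rw [integral_const_mul, ← integral_annulus (by positivity) hapos hab.le hfj.integrableOn,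
      ← integral_const_mul, ← integral_const_mul]
    refine setIntegral_mono_on (hfj.integrableOn.const_mul _)
      ((integrable_mul_kerK hfj hκ0).integrableOn.const_mul _) (measurableSet_annulus a b)
      fun ξ hξ ↦ ?_
    have hr : a ≤ ‖ξ‖ ∧ ‖ξ‖ ≤ b := hξ
    have hj := jet_nonneg f ξ
    -- On the shell |κ − r| is at most κ₀ and r at most 2κ, so the kernel is comparable to κ⁻¹.
    have h7 : κ⁻¹ ≤ 3 * (1 + κ₀) * kerK κ ‖ξ‖ := by
      unfold kerK
      rw [← div_eq_mul_inv, inv_eq_one_div, div_le_div_iff₀ hκ0 (by positivity), one_mul]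
      have h8 : |κ - ‖ξ‖| ≤ κ₀ := by
        rw [abs_le]; constructor <;> linarith [hr.1, hr.2]
      calc (κ + ‖ξ‖) * (1 + |κ - ‖ξ‖|) ≤ (κ + 2 * κ) * (1 + κ₀) := by
            gcongr; exact hr.2.trans hbκ
        _ = _ := by ring
    calc B / κ * jet f ξ = B * jet f ξ * κ⁻¹ := by ring
      _ ≤ B * jet f ξ * (3 * (1 + κ₀) * kerK κ ‖ξ‖) := by gcongr
      _ = _ := by ring
  have hfar : ‖∫ ξ in (annulus (m + 2) a b)ᶜ, f ξ * res κ ε ‖ξ‖‖ ≤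
      (6 / κ₀ + 1) * ∫ ξ in (annulus (m + 2) a b)ᶜ, jet f ξ * kerK κ ‖ξ‖ := by
    rw [← integral_const_mul]
    have hms := (measurableSet_annulus (n := m + 2) a b).compl
    refine norm_integral_le_of_norm_le
      ((integrable_mul_kerK hfj hκ0).integrableOn.const_mul _)
      ((ae_restrict_iff' hms).2 (ae_of_all _ fun ξ hξ ↦ ?_))
    have hdξ := sq_mem_compl_annulus hb0 ha hb hξ
    have hne : κ ^ 2 ≠ ‖ξ‖ ^ 2 := fun h ↦ by
      rw [h, sub_self, abs_zero] at hdξ; linarith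
    have hξ0 := norm_nonneg ξ
    -- Away from the sphere |κ − r| is bounded below, so it may be replaced by 1 + |κ − r| up to a
    -- constant and the symbol is dominated by the kernel pointwise.
    have h9 : κ₀ / 6 ≤ |κ - ‖ξ‖| := by
      have h' : ¬ (a ≤ ‖ξ‖ ∧ ‖ξ‖ ≤ b) := hξ
      rw [not_and_or, not_le, not_le] at h'
      rcases h' with h' | h'
      · exact le_trans (by linarith) (le_abs_self _)
      · exact le_trans (by linarith) (neg_le_abs _)
    have h10 : ‖res κ ε ‖ξ‖‖ ≤ (6 / κ₀ + 1) * kerK κ ‖ξ‖ := by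
      refine (norm_res_le κ ε _ hne).trans ?_
      have h11 : |κ ^ 2 - ‖ξ‖ ^ 2| = (κ + ‖ξ‖) * |κ - ‖ξ‖| := by
        rw [show κ ^ 2 - ‖ξ‖ ^ 2 = (κ + ‖ξ‖) * (κ - ‖ξ‖) by ring, abs_mul,
          abs_of_nonneg (by positivity)]
      have h12 : 0 < |κ - ‖ξ‖| := lt_of_lt_of_le (by positivity) h9
      unfold kerK
      rw [h11, ← div_eq_mul_inv, inv_eq_one_div, div_le_div_iff₀ (by positivity) (by positivity),
        one_mul]
      have h13 : 1 ≤ 6 / κ₀ * |κ - ‖ξ‖| := by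
        rw [div_mul_eq_mul_div, one_le_div hκ₀]; linarith
      calc (κ + ‖ξ‖) * (1 + |κ - ‖ξ‖|)
          ≤ (κ + ‖ξ‖) * (6 / κ₀ * |κ - ‖ξ‖| + |κ - ‖ξ‖|) := by gcongr
        _ = _ := by ring
    rw [norm_mul]
    calc ‖f ξ‖ * ‖res κ ε ‖ξ‖‖ ≤ jet f ξ * ((6 / κ₀ + 1) * kerK κ ‖ξ‖) := by
          gcongr
          · exact jet_nonneg f ξ
          · exact norm_le_jet f ξ
      _ = _ := by ring
  rw [← integral_add_compl (measurableSet_annulus a b) (integrable_mul_res hfi κ hε),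
    ← integral_add_compl (measurableSet_annulus a b) (integrable_mul_kerK hfj hκ0)]
  refine (norm_add_le _ _).trans ((add_le_add hnear hfar).trans ?_)
  have p1 : 0 ≤ ∫ ξ in annulus (m + 2) a b, jet f ξ * kerK κ ‖ξ‖ := integral_nonneg fun ξ ↦
    mul_nonneg (jet_nonneg f ξ) (kerK_nonneg hκ0 (norm_nonneg _))
  have p2 : 0 ≤ ∫ ξ in (annulus (m + 2) a b)ᶜ, jet f ξ * kerK κ ‖ξ‖ := integral_nonneg fun ξ ↦
    mul_nonneg (jet_nonneg f ξ) (kerK_nonneg hκ0 (norm_nonneg _))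
  refine (add_le_add (mul_le_mul_of_nonneg_right ?_ p1) (mul_le_mul_of_nonneg_right ?_ p2)).trans
    (mul_add _ _ _).ge
  · exact le_add_of_nonneg_right (by positivity)
  · exact le_add_of_nonneg_left (by positivity)

/-! ### Small wave numbers -/

/-- For small κ the symbol away from the sphere is dominated by κ^(-1/2) |ξ|^(-3/2). The exponent
3/2 is below 2 ≤ n, hence locally integrable, and only a mild singularity in κ is left. -/
theorem integrable_indicator_norm_rpow (hn : 2 ≤ n) :
    Integrable ((Metric.ball (0 : Rn n) 1).indicator fun ξ ↦ ‖ξ‖ ^ (-(3 / 2) : ℝ)) := by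
  have : Nonempty (Fin n) := ⟨⟨0, by omega⟩⟩
  rw [integrable_indicator_iff measurableSet_ball,
    integrableOn_fun_norm_addHaar volume (f := fun r ↦ r ^ (-(3 / 2) : ℝ)),
    finrank_euclideanSpace_fin]
  have h : IntegrableOn (fun y : ℝ ↦ y ^ (-(1 / 2) : ℝ)) (Set.Ioo 0 1) :=
    (intervalIntegral.integrableOn_Ioo_rpow_iff one_pos).2 (by norm_num)
  refine Integrable.mono' h (Measurable.aestronglyMeasurable (by fun_prop)) ?_
  refine (ae_restrict_iff' measurableSet_Ioo).2 (ae_of_all _ fun y hy ↦ ?_)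
  have hy0 := hy.1
  rw [smul_eq_mul, norm_mul, Real.norm_of_nonneg (by positivity), Real.norm_of_nonneg (by positivity)]
  calc y ^ (n - 1) * y ^ (-(3 / 2) : ℝ) ≤ y ^ 1 * y ^ (-(3 / 2) : ℝ) := by
        exact mul_le_mul_of_nonneg_right (pow_le_pow_of_le_one hy0.le hy.2.le (by omega))
          (by positivity)
    _ = y ^ (-(1 / 2) : ℝ) := by
        rw [← Real.rpow_natCast, ← Real.rpow_add hy0]; norm_num

/-- Bound of the regularized integral for small wave numbers. -/
theorem exists_norm_integral_res_le_rpow (hn : 2 ≤ n) {κ₀ : ℝ} (hκ₀ : 0 < κ₀) :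
    ∃ C : ℝ, 0 ≤ C ∧ ∀ κ, 0 < κ → κ ≤ κ₀ → ∀ f : Rn n → ℂ, ContDiff ℝ 1 f → Integrable f →
      ∀ M, (∀ ξ, ‖f ξ‖ ≤ M) → (∀ ξ, ‖fderiv ℝ f ξ‖ ≤ M) → ∫ ξ, ‖f ξ‖ ≤ M →
      ∀ ε, 0 < ε → ‖∫ ξ, f ξ * res κ ε ‖ξ‖‖ ≤ C * M * κ ^ (-(1 / 2) : ℝ) := by
  have hI := integrable_indicator_norm_rpow hn
  obtain ⟨m, rfl⟩ : ∃ m, n = m + 2 := ⟨n - 2, by omega⟩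
  set I₀ := ∫ ξ, (Metric.ball (0 : Rn (m + 2)) 1).indicator (fun ξ ↦ ‖ξ‖ ^ (-(3 / 2) : ℝ)) ξ with hI₀
  have hI₀0 : 0 ≤ I₀ := integral_nonneg fun ξ ↦ Set.indicator_nonneg (fun _ _ ↦ by positivity) _
  set S := (sphereMeasure (m + 2)).real Set.univ
  set B : ℝ := (2 * m + κ₀) * ((2 * κ₀) ^ m * 2) + 2 * κ₀ ^ m with hB
  refine ⟨S * B * κ₀ ^ (1 / 2 : ℝ) + 3 * (I₀ + 1), by positivity,
    fun κ hκ0 hκ f hf hfi M hM hM' hMi ε hε ↦ ?_⟩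
  have hM0 : 0 ≤ M := (norm_nonneg _).trans (hM 0)
  -- Here the shell scales with κ: the lower bound on wave numbers is taken to be κ itself, so d =
  -- κ²/2.
  obtain ⟨a, b, ha, hb, haκ, haκ', hbκ', hbκ, -, hba_up, -, -⟩ := exists_radii hκ0 le_rfl
  set d := κ * κ / 2 with hd'
  have hd : 0 < d := by positivity
  have hapos : 0 < a := (half_pos hκ0).trans_le haκ
  have hb0 : 0 ≤ b := by linarith
  have hab : a ≤ b := by linarith
  have hnear : ‖∫ ξ in annulus (m + 2) a b, f ξ * res κ ε ‖ξ‖‖ ≤ S * B * M := by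
    rw [integral_annulus_res m hfi κ hε hapos hab]
    refine (norm_integral_le_of_norm_le_const (C := B * M) (ae_of_all _ fun e ↦ ?_)).trans
      (le_of_eq (by ring))
    have he : ‖(e : Rn (m + 2))‖ = 1 := by simp
    refine (norm_integral_res_le (M := (m / a + 1) * ((2 * κ₀) ^ m * (M + M))) hκ0 hd hapos.le hb0
      ha hb (fun r _ ↦ hasDerivAt_ray m hf e r) (fun r hr ↦ ?_) hε).trans ?_
    · refine (norm_ray'_le m f he hapos hr.1).trans ?_
      have h1 : r ≤ 2 * κ₀ := hr.2.trans (by linarith)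
      have h2 : 0 ≤ r := hapos.le.trans hr.1
      gcongr
      · exact hM _
      · exact hM' _
    · rw [norm_ray_le m f hκ0.le]
      have h3 : (m / a + 1) * (b - a) ≤ 2 * m + κ₀ := by
        calc (m / a + 1) * (b - a) ≤ (m / (κ / 2) + 1) * κ := by
              gcongr
          _ = 2 * m + κ := by field_simp
          _ ≤ _ := by linarith
      calc _ = (m / a + 1) * (b - a) * ((2 * κ₀) ^ m * (M + M)) + 2 * (κ ^ m * ‖f (κ • (e : Rn (m + 2)))‖) := by
              ring
        _ ≤ (2 * m + κ₀) * ((2 * κ₀) ^ m * (M + M)) + 2 * (κ₀ ^ m * M) := by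
              gcongr
              exact hM _
        _ = _ := by rw [hB]; ring
  have hfar : ‖∫ ξ in (annulus (m + 2) a b)ᶜ, f ξ * res κ ε ‖ξ‖‖ ≤
      3 * κ ^ (-(1 / 2) : ℝ) * ((I₀ + 1) * M) := by
    -- A majorant of ‖f ξ‖ |ξ|^(-3/2): inside the unit ball f is bounded by M, outside it the power
    -- is at most one.
    set g : Rn (m + 2) → ℝ := fun ξ ↦
      M * (Metric.ball (0 : Rn (m + 2)) 1).indicator (fun ξ ↦ ‖ξ‖ ^ (-(3 / 2) : ℝ)) ξ + ‖f ξ‖ with hg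
    have hgi : Integrable g := (hI.const_mul M).add hfi.norm
    have hg0 : ∀ ξ, 0 ≤ g ξ := fun ξ ↦ by
      have : 0 ≤ (Metric.ball (0 : Rn (m + 2)) 1).indicator (fun ξ ↦ ‖ξ‖ ^ (-(3 / 2) : ℝ)) ξ :=
        Set.indicator_nonneg (fun _ _ ↦ by positivity) _
      simp only [hg]; positivity
    have hgI : ∫ ξ, g ξ ≤ (I₀ + 1) * M := by
      simp only [hg]
      rw [integral_add (hI.const_mul M) hfi.norm, integral_const_mul, ← hI₀]
      linarith
    have hms := (measurableSet_annulus (n := m + 2) a b).compl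
    have hbound : ‖∫ ξ in (annulus (m + 2) a b)ᶜ, f ξ * res κ ε ‖ξ‖‖ ≤
        ∫ ξ in (annulus (m + 2) a b)ᶜ, 3 * κ ^ (-(1 / 2) : ℝ) * g ξ := by
      have hne0 : ∀ᵐ ξ : Rn (m + 2), ξ ≠ 0 := by
        simp [ae_iff]
      refine norm_integral_le_of_norm_le (hgi.const_mul _).integrableOn
        ((ae_restrict_iff' hms).2 ?_)
      filter_upwards [hne0] with ξ hξ0 hξ
      have hr : 0 < ‖ξ‖ := norm_pos_iff.2 hξ0
      have hdξ := sq_mem_compl_annulus hb0 ha hb hξ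
      have hne : κ ^ 2 ≠ ‖ξ‖ ^ 2 := fun h ↦ by
        rw [h, sub_self, abs_zero] at hdξ; linarith
      -- Off the shell |κ² − r²| dominates a multiple of max(κ, r)², hence of every product of
      -- powers of κ and r of total degree two.
      have h1 : κ ^ (1 / 2 : ℝ) * ‖ξ‖ ^ (3 / 2 : ℝ) ≤ 3 * |κ ^ 2 - ‖ξ‖ ^ 2| := by
        have h' : ¬ (a ≤ ‖ξ‖ ∧ ‖ξ‖ ≤ b) := hξ
        rw [not_and_or, not_le, not_le] at h'
        rcases h' with h' | h'
        · calc κ ^ (1 / 2 : ℝ) * ‖ξ‖ ^ (3 / 2 : ℝ) ≤ κ ^ (1 / 2 : ℝ) * κ ^ (3 / 2 : ℝ) := by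
                gcongr; linarith
            _ = κ ^ 2 := by
                rw [← Real.rpow_add hκ0, ← Real.rpow_natCast]; norm_num
            _ ≤ 3 * |κ ^ 2 - ‖ξ‖ ^ 2| := by
                rw [hd'] at hdξ; nlinarith
        · calc κ ^ (1 / 2 : ℝ) * ‖ξ‖ ^ (3 / 2 : ℝ) ≤ ‖ξ‖ ^ (1 / 2 : ℝ) * ‖ξ‖ ^ (3 / 2 : ℝ) := by
                gcongr; linarith
            _ = ‖ξ‖ ^ 2 := by
                rw [← Real.rpow_add hr, ← Real.rpow_natCast]; norm_num
            _ ≤ 3 * |κ ^ 2 - ‖ξ‖ ^ 2| := by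
                have h2 := neg_le_abs (κ ^ 2 - ‖ξ‖ ^ 2)
                have h3 : b ^ 2 ≤ ‖ξ‖ ^ 2 := by gcongr
                rw [hb, hd'] at h3
                nlinarith
      have h2 : ‖res κ ε ‖ξ‖‖ ≤ 3 * κ ^ (-(1 / 2) : ℝ) * ‖ξ‖ ^ (-(3 / 2) : ℝ) := by
        refine (norm_res_le κ ε _ hne).trans ?_
        have hdξ' := hd.trans_le hdξ
        rw [Real.rpow_neg hκ0.le, Real.rpow_neg hr.le, inv_le_iff_one_le_mul₀ hdξ']
        have hp1 : 0 < κ ^ (1 / 2 : ℝ) := by positivity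
        have hp2 : 0 < ‖ξ‖ ^ (3 / 2 : ℝ) := by positivity
        rw [mul_comm, mul_assoc, ← mul_inv, ← mul_assoc, mul_comm _ (3 : ℝ), ← div_eq_mul_inv,
          one_le_div (by positivity)]
        exact h1
      have h3 : ‖f ξ‖ * ‖ξ‖ ^ (-(3 / 2) : ℝ) ≤ g ξ := by
        simp only [hg]
        by_cases h4 : ξ ∈ Metric.ball (0 : Rn (m + 2)) 1
        · rw [Set.indicator_of_mem h4]
          refine le_trans ?_ (le_add_of_nonneg_right (norm_nonneg _))
          gcongr
          exact hM ξ
        · rw [Set.indicator_of_notMem h4, mul_zero, zero_add]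
          refine mul_le_of_le_one_right (norm_nonneg _) ?_
          exact Real.rpow_le_one_of_one_le_of_nonpos (by simpa using h4) (by norm_num)
      rw [norm_mul]
      calc ‖f ξ‖ * ‖res κ ε ‖ξ‖‖ ≤ ‖f ξ‖ * (3 * κ ^ (-(1 / 2) : ℝ) * ‖ξ‖ ^ (-(3 / 2) : ℝ)) := by gcongr
        _ = 3 * κ ^ (-(1 / 2) : ℝ) * (‖f ξ‖ * ‖ξ‖ ^ (-(3 / 2) : ℝ)) := by ring
        _ ≤ _ := by gcongr
    refine hbound.trans ?_
    rw [integral_const_mul]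
    gcongr
    exact (setIntegral_le_integral hgi (ae_of_all _ hg0)).trans hgI
  rw [← integral_add_compl (measurableSet_annulus a b) (integrable_mul_res hfi κ hε)]
  refine (norm_add_le _ _).trans ((add_le_add hnear hfar).trans ?_)
  have h5 : 1 ≤ κ₀ ^ (1 / 2 : ℝ) * κ ^ (-(1 / 2) : ℝ) := by
    rw [Real.rpow_neg hκ0.le, ← div_eq_mul_inv, one_le_div (by positivity)]
    gcongr
  have hS : 0 ≤ S := measureReal_nonneg
  calc _ ≤ S * B * M * (κ₀ ^ (1 / 2 : ℝ) * κ ^ (-(1 / 2) : ℝ)) +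
        3 * κ ^ (-(1 / 2) : ℝ) * ((I₀ + 1) * M) := by
        exact add_le_add_left (le_mul_of_one_le_right (by positivity) h5) _
    _ = _ := by ring

/-! ### The Japanese bracket -/

/-- `⟨x⟩ = (1 + |x|²)^(1/2)`. -/
def jap {E : Type*} [NormedAddCommGroup E] (x : E) : ℝ := Real.sqrt (1 + ‖x‖ ^ 2)

section jap

variable {E : Type*} [NormedAddCommGroup E]

theorem jap_sq (x : E) : jap x ^ 2 = 1 + ‖x‖ ^ 2 := Real.sq_sqrt (by positivity)

theorem one_le_jap (x : E) : 1 ≤ jap x :=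
  Real.one_le_sqrt.2 (le_add_of_nonneg_right (by positivity))

theorem jap_pos (x : E) : 0 < jap x := one_pos.trans_le (one_le_jap x)

theorem norm_le_jap (x : E) : ‖x‖ ≤ jap x := Real.le_sqrt_of_sq_le (by linarith)

theorem jap_le (x : E) : jap x ≤ 1 + ‖x‖ := by
  unfold jap
  rw [Real.sqrt_le_left (by positivity)]
  nlinarith [norm_nonneg x]

theorem jap_le_add_norm (x y : E) : jap (x + y) ≤ jap x + ‖y‖ := by
  have h1 := norm_le_jap x
  have h2 := jap_pos x
  rw [jap, Real.sqrt_le_left (by positivity), add_sq, jap_sq]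
  have h3 : ‖x + y‖ ^ 2 ≤ (‖x‖ + ‖y‖) ^ 2 := by gcongr; exact norm_add_le x y
  nlinarith [norm_nonneg y, norm_nonneg x]

theorem jap_add_le (x y : E) : jap (x + y) ≤ jap x + jap y :=
  (jap_le_add_norm x y).trans (by linarith [norm_le_jap y])

@[simp] theorem jap_neg (x : E) : jap (-x) = jap x := by simp [jap]

theorem jap_sub_comm (x y : E) : jap (x - y) = jap (y - x) := by rw [← jap_neg, neg_sub]

theorem jap_add_le_mul (x y : E) : jap (x + y) ≤ 2 * jap x * jap y := by
  have h1 := one_le_jap x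
  have h2 := one_le_jap y
  have := jap_add_le x y
  nlinarith

theorem jap_rpow (x : E) (s : ℝ) : jap x ^ s = (1 + ‖x‖ ^ 2) ^ (s / 2) := by
  rw [jap, Real.sqrt_eq_rpow, ← Real.rpow_mul (by positivity)]
  congr 1; ring

@[fun_prop]
theorem continuous_jap : Continuous (jap : E → ℝ) := by
  unfold jap; fun_prop

theorem continuous_jap_rpow (s : ℝ) : Continuous fun x : E ↦ jap x ^ s :=
  continuous_jap.rpow_const fun x ↦ Or.inl (jap_pos x).ne'

end jap

theorem lintegral_jap_rpow_lt_top {s : ℝ} (hs : (n : ℝ) < s) :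
    ∫⁻ x : Rn n, ENNReal.ofReal (jap x ^ (-s)) < ⊤ := by
  have h := integrable_rpow_neg_one_add_norm_sq (E := Rn n) (μ := volume) (r := s)
    (by simpa using hs)
  have h2 : Integrable fun x : Rn n ↦ jap x ^ (-s) := by
    refine h.congr (ae_of_all _ fun x ↦ ?_)
    simp only [jap_rpow]
  simpa using h2.lintegral_lt_top

/-! ### Integrals along thin spherical shells -/

/-- Where x²+c² ≤ N²x², the function √(x²+c²) has slope at least 1/N in absolute value on each half
line. So |ξ| can serve as a coordinate along an axis on which the component of ξ is large. -/
theorem shell_antilipschitz {N c x y : ℝ} (hN : 0 < N) (hx : x ^ 2 + c ^ 2 ≤ N ^ 2 * x ^ 2)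
    (hy : y ^ 2 + c ^ 2 ≤ N ^ 2 * y ^ 2) (hxy : 0 ≤ x * y) :
    |x - y| ≤ N * |Real.sqrt (x ^ 2 + c ^ 2) - Real.sqrt (y ^ 2 + c ^ 2)| := by
  set X := Real.sqrt (x ^ 2 + c ^ 2)
  set Y := Real.sqrt (y ^ 2 + c ^ 2)
  have hX : X ^ 2 = x ^ 2 + c ^ 2 := Real.sq_sqrt (by positivity)
  have hY : Y ^ 2 = y ^ 2 + c ^ 2 := Real.sq_sqrt (by positivity)
  have hX0 : 0 ≤ X := Real.sqrt_nonneg _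
  have hY0 : 0 ≤ Y := Real.sqrt_nonneg _
  have hX1 : X ≤ N * |x| := by
    rw [← abs_of_nonneg hX0, ← abs_of_pos hN, ← abs_mul, ← sq_le_sq, mul_pow, hX]; exact hx
  have hY1 : Y ≤ N * |y| := by
    rw [← abs_of_nonneg hY0, ← abs_of_pos hN, ← abs_mul, ← sq_le_sq, mul_pow, hY]; exact hy
  have hsum : |x + y| = |x| + |y| := by
    rcases mul_nonneg_iff.1 hxy with ⟨h1, h2⟩ | ⟨h1, h2⟩
    · rw [abs_of_nonneg h1, abs_of_nonneg h2, abs_of_nonneg (add_nonneg h1 h2)]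
    · rw [abs_of_nonpos h1, abs_of_nonpos h2, abs_of_nonpos (add_nonpos h1 h2)]; ring
  by_cases h0 : |x| + |y| = 0
  · have hx0 : |x| = 0 := by linarith [abs_nonneg x, abs_nonneg y]
    have hy0 : |y| = 0 := by linarith [abs_nonneg x, abs_nonneg y]
    rw [abs_eq_zero.1 hx0, abs_eq_zero.1 hy0, sub_self, abs_zero]
    positivity
  have hpos : 0 < |x| + |y| := lt_of_le_of_ne (by positivity) (Ne.symm h0)
  refine le_of_mul_le_mul_right ?_ hpos
  calc |x - y| * (|x| + |y|) = |X - Y| * (X + Y) := by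
        rw [← hsum, ← abs_mul, ← abs_of_nonneg (add_nonneg hX0 hY0), ← abs_mul]
        congr 1
        nlinarith
    _ ≤ |X - Y| * (N * |x| + N * |y|) := by gcongr
    _ = _ := by ring

theorem lintegral_shell_half_le {N : ℝ} (hN : 1 ≤ N) (κ c : ℝ) {S : Set ℝ}
    (hSN : ∀ x ∈ S, x ^ 2 + c ^ 2 ≤ N ^ 2 * x ^ 2) (hS : ∀ x ∈ S, ∀ y ∈ S, 0 ≤ x * y)
    (hSm : MeasurableSet S) :
    ∫⁻ x in S, ENNReal.ofReal ((1 + |κ - Real.sqrt (x ^ 2 + c ^ 2)|) ^ (-2 : ℝ)) ≤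
      ENNReal.ofReal ((2 * N) ^ 2) * ∫⁻ x : ℝ, ENNReal.ofReal ((1 + ‖x‖) ^ (-2 : ℝ)) := by
  rcases S.eq_empty_or_nonempty with rfl | hne
  · simp
  set φ : ℝ → ℝ := fun x ↦ Real.sqrt (x ^ 2 + c ^ 2)
  -- The radius κ need not be attained on S, so a nearest point is used instead; the minimum may not
  -- be attained either, hence the slack 1. The integrand is then dominated by a translate of
  -- (1+|x|)^(-2).
  obtain ⟨x₀, hx₀, hmin⟩ : ∃ x₀ ∈ S, ∀ x ∈ S, |κ - φ x₀| ≤ |κ - φ x| + 1 := by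
    have hbdd : BddBelow ((fun x ↦ |κ - φ x|) '' S) := ⟨0, by rintro _ ⟨x, -, rfl⟩; positivity⟩
    obtain ⟨_, ⟨x₀, hx₀, rfl⟩, hlt⟩ := exists_lt_of_csInf_lt (hne.image fun x ↦ |κ - φ x|)
      (lt_add_one (sInf ((fun x ↦ |κ - φ x|) '' S)))
    refine ⟨x₀, hx₀, fun x hx ↦ hlt.le.trans ?_⟩
    gcongr
    exact csInf_le hbdd ⟨x, hx, rfl⟩
  have hpt : ∀ x ∈ S, (1 + |κ - φ x|) ^ (-2 : ℝ) ≤ (2 * N) ^ 2 * (1 + ‖x - x₀‖) ^ (-2 : ℝ) := by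
    intro x hx
    have h1 := shell_antilipschitz (c := c) (by linarith) (hSN x hx) (hSN x₀ hx₀) (hS x hx x₀ hx₀)
    have h2 : |φ x - φ x₀| ≤ 2 * |κ - φ x| + 1 := by
      have : |φ x - φ x₀| ≤ |κ - φ x₀| + |κ - φ x| := by
        rw [show φ x - φ x₀ = (κ - φ x₀) - (κ - φ x) by ring]; exact abs_sub _ _
      linarith [hmin x hx]
    have h3 : 1 + |x - x₀| ≤ 2 * N * (1 + |κ - φ x|) := by
      have : |x - x₀| ≤ N * (2 * |κ - φ x| + 1) := h1.trans (by gcongr)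
      nlinarith [abs_nonneg (κ - φ x)]
    rw [Real.rpow_neg (by positivity), Real.rpow_neg (by positivity), Real.norm_eq_abs]
    rw [← div_eq_mul_inv, inv_eq_one_div, div_le_div_iff₀ (by positivity) (by positivity), one_mul]
    have e : ∀ t : ℝ, t ^ (2 : ℝ) = t ^ 2 := fun t ↦ by norm_cast
    rw [e, e, ← mul_pow]
    gcongr
  calc ∫⁻ x in S, ENNReal.ofReal ((1 + |κ - φ x|) ^ (-2 : ℝ))
      ≤ ∫⁻ x in S, ENNReal.ofReal ((2 * N) ^ 2) * ENNReal.ofReal ((1 + ‖x - x₀‖) ^ (-2 : ℝ)) := by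
        refine setLIntegral_mono' hSm fun x hx ↦ ?_
        rw [← ENNReal.ofReal_mul (by positivity)]
        exact ENNReal.ofReal_le_ofReal (hpt x hx)
    _ ≤ ∫⁻ x, ENNReal.ofReal ((2 * N) ^ 2) * ENNReal.ofReal ((1 + ‖x - x₀‖) ^ (-2 : ℝ)) :=
        setLIntegral_le_lintegral _ _
    _ = _ := by
        rw [lintegral_const_mul' _ _ ENNReal.ofReal_ne_top,
          lintegral_sub_right_eq_self (fun x : ℝ ↦ ENNReal.ofReal ((1 + ‖x‖) ^ (-2 : ℝ))) x₀]

theorem lintegral_shell_line_le {N : ℝ} (hN : 1 ≤ N) (κ c : ℝ) :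
    ∫⁻ x in {x : ℝ | x ^ 2 + c ^ 2 ≤ N ^ 2 * x ^ 2},
        ENNReal.ofReal ((1 + |κ - Real.sqrt (x ^ 2 + c ^ 2)|) ^ (-2 : ℝ)) ≤
      2 * (ENNReal.ofReal ((2 * N) ^ 2) * ∫⁻ x : ℝ, ENNReal.ofReal ((1 + ‖x‖) ^ (-2 : ℝ))) := by
  set S := {x : ℝ | x ^ 2 + c ^ 2 ≤ N ^ 2 * x ^ 2}
  have hS : MeasurableSet S := measurableSet_le (by fun_prop) (by fun_prop)
  have hsub : S ⊆ (S ∩ Set.Ici 0) ∪ (S ∩ Set.Iic 0) := fun x hx ↦ by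
    rcases le_total 0 x with h | h
    · exact Or.inl ⟨hx, h⟩
    · exact Or.inr ⟨hx, h⟩
  refine (lintegral_mono_set hsub).trans ((lintegral_union_le _ _ _).trans ?_)
  rw [two_mul]
  exact add_le_add
    (lintegral_shell_half_le hN κ c (fun x hx ↦ hx.1)
      (fun x hx y hy ↦ mul_nonneg hx.2 hy.2) (hS.inter measurableSet_Ici))
    (lintegral_shell_half_le hN κ c (fun x hx ↦ hx.1)
      (fun x hx y hy ↦ mul_nonneg_of_nonpos_of_nonpos hx.2 hy.2) (hS.inter measurableSet_Iic))

/-- Splitting off the `j`-th coordinate. -/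
theorem lintegral_split_coord {m : ℕ} (j : Fin (m + 1)) {F : Rn (m + 1) → ℝ≥0∞}
    {G : ℝ → Rn m → ℝ≥0∞} (hG : Measurable (Function.uncurry G))
    (hFG : ∀ (x : ℝ) (y : Fin m → ℝ), F (WithLp.toLp 2 (j.insertNth x y)) ≤ G x (WithLp.toLp 2 y)) :
    ∫⁻ ξ, F ξ ≤ ∫⁻ y, ∫⁻ x, G x y := by
  have h1 := (EuclideanSpace.volume_preserving_symm_measurableEquiv_toLp (Fin (m + 1))).symm
  have h2 := (volume_preserving_piFinSuccAbove (fun _ : Fin (m + 1) ↦ ℝ) j).symm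
  rw [← h1.lintegral_comp_emb (MeasurableEquiv.measurableEmbedding _),
    ← h2.lintegral_comp_emb (MeasurableEquiv.measurableEmbedding _)]
  have h3 := (EuclideanSpace.volume_preserving_symm_measurableEquiv_toLp (Fin m)).symm
  have hmeas : Measurable fun p : ℝ × (Fin m → ℝ) ↦ G p.1 (WithLp.toLp 2 p.2) :=
    hG.comp (measurable_fst.prodMk ((WithLp.measurable_toLp 2 _).comp measurable_snd))
  calc _ ≤ ∫⁻ p : ℝ × (Fin m → ℝ), G p.1 (WithLp.toLp 2 p.2) := lintegral_mono fun p ↦ hFG p.1 p.2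
    _ = ∫⁻ y : Fin m → ℝ, ∫⁻ x : ℝ, G x (WithLp.toLp 2 y) := by
        rw [Measure.volume_eq_prod, lintegral_prod_symm' _ hmeas]
    _ = _ := by
        exact h3.lintegral_comp_emb (MeasurableEquiv.measurableEmbedding _)
          (fun y ↦ ∫⁻ x : ℝ, G x y)

theorem norm_sq_insertNth {m : ℕ} (j : Fin (m + 1)) (x : ℝ) (y : Fin m → ℝ) :
    ‖(WithLp.toLp 2 (j.insertNth x y) : Rn (m + 1))‖ ^ 2 =
      x ^ 2 + ‖(WithLp.toLp 2 y : Rn m)‖ ^ 2 := by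
  rw [EuclideanSpace.real_norm_sq_eq, EuclideanSpace.real_norm_sq_eq, Fin.sum_univ_succAbove _ j]
  simp

/-- The weight `⟨ξ - a⟩^(-s)`, `s > n - 1`, has uniformly bounded integrals against thin shells. -/
theorem exists_lintegral_shell_le {s : ℝ} (hs : (n : ℝ) - 1 < s) (hn : 1 ≤ n) :
    ∃ C : ℝ≥0∞, C < ⊤ ∧ ∀ (κ : ℝ) (a : Rn n),
      ∫⁻ ξ, ENNReal.ofReal ((1 + |κ - ‖ξ‖|) ^ (-2 : ℝ) * jap (ξ - a) ^ (-s)) ≤ C := by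
  obtain ⟨m, rfl⟩ : ∃ m, n = m + 1 := ⟨n - 1, by omega⟩
  have hs' : (m : ℝ) < s := by push_cast at hs; linarith
  have hs0 : 0 < s := lt_of_le_of_lt (by positivity) hs'
  set N : ℝ := Real.sqrt (m + 1) with hNdef
  have hN : 1 ≤ N := Real.one_le_sqrt.2 (by linarith [(Nat.cast_nonneg m : (0:ℝ) ≤ m)])
  have hNsq : N ^ 2 = m + 1 := Real.sq_sqrt (by positivity)
  set C₁ : ℝ≥0∞ := 2 * (ENNReal.ofReal ((2 * N) ^ 2) *
    ∫⁻ x : ℝ, ENNReal.ofReal ((1 + ‖x‖) ^ (-2 : ℝ))) with hC₁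
  have hC₁' : C₁ < ⊤ := by
    have h := integrable_one_add_norm (E := ℝ) (μ := volume) (r := 2) (by simp)
    exact ENNReal.mul_lt_top (by simp) (ENNReal.mul_lt_top ENNReal.ofReal_lt_top h.lintegral_lt_top)
  set C₂ : ℝ≥0∞ := ∫⁻ y : Rn m, ENNReal.ofReal (jap y ^ (-s))
  have hC₂' : C₂ < ⊤ := lintegral_jap_rpow_lt_top hs'
  refine ⟨(m + 1 : ℕ) * (C₂ * C₁), ENNReal.mul_lt_top (ENNReal.natCast_lt_top _)
    (ENNReal.mul_lt_top hC₂' hC₁'), fun κ a ↦ ?_⟩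
  set F : Rn (m + 1) → ℝ≥0∞ := fun ξ ↦
    ENNReal.ofReal ((1 + |κ - ‖ξ‖|) ^ (-2 : ℝ) * jap (ξ - a) ^ (-s)) with hF
  -- Some coordinate always carries at least the fraction 1/n of |ξ|². On this piece the spheres are
  -- uniformly transversal to that axis, so the thin shell is integrated out along it.
  set U : Fin (m + 1) → Set (Rn (m + 1)) := fun j ↦ {ξ | ‖ξ‖ ^ 2 ≤ N ^ 2 * ξ j ^ 2} with hU
  have hUm : ∀ j, MeasurableSet (U j) := fun j ↦ measurableSet_le (by fun_prop) (by fun_prop)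
  have hcover : ⋃ j, U j = Set.univ := by
    refine Set.eq_univ_of_forall fun ξ ↦ ?_
    by_contra hcon
    simp only [Set.mem_iUnion, not_exists, hU, Set.mem_ofPred_eq, not_le] at hcon
    have h1 : ∑ j, N ^ 2 * ξ j ^ 2 < ∑ _j : Fin (m + 1), ‖ξ‖ ^ 2 :=
      Finset.sum_lt_sum_of_nonempty Finset.univ_nonempty fun j _ ↦ hcon j
    rw [← Finset.mul_sum, ← EuclideanSpace.real_norm_sq_eq, hNsq, Finset.sum_const] at h1
    simp at h1
  have hj : ∀ j, ∫⁻ ξ in U j, F ξ ≤ C₂ * C₁ := by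
    intro j
    rw [← lintegral_indicator (hUm j)]
    set a' : Rn m := WithLp.toLp 2 (fun i ↦ a (j.succAbove i)) with ha'
    set G : ℝ → Rn m → ℝ≥0∞ := fun x y ↦
      ENNReal.ofReal (jap (y - a') ^ (-s)) * {x : ℝ | x ^ 2 + ‖y‖ ^ 2 ≤ N ^ 2 * x ^ 2}.indicator
        (fun x ↦ ENNReal.ofReal ((1 + |κ - Real.sqrt (x ^ 2 + ‖y‖ ^ 2)|) ^ (-2 : ℝ))) x with hG
    have hGm : Measurable (Function.uncurry G) := by
      have h1 : Measurable fun p : ℝ × Rn m ↦ ENNReal.ofReal (jap (p.2 - a') ^ (-s)) :=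
        (((continuous_jap_rpow (E := Rn m) (-s)).measurable.comp
          (measurable_snd.sub_const a'))).ennreal_ofReal
      have h2 : Measurable ({p : ℝ × Rn m | p.1 ^ 2 + ‖p.2‖ ^ 2 ≤ N ^ 2 * p.1 ^ 2}.indicator
          fun p ↦ ENNReal.ofReal ((1 + |κ - Real.sqrt (p.1 ^ 2 + ‖p.2‖ ^ 2)|) ^ (-2 : ℝ))) := by
        refine Measurable.indicator ?_ (measurableSet_le (by fun_prop) (by fun_prop))
        exact Measurable.ennreal_ofReal (Measurable.pow_const
          (Continuous.measurable (by fun_prop)) _)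
      exact h1.mul h2
    refine (lintegral_split_coord (G := G) j hGm fun x y ↦ ?_).trans ?_
    · by_cases hmem : (WithLp.toLp 2 (j.insertNth x y) : Rn (m + 1)) ∈ U j
      · rw [Set.indicator_of_mem hmem]
        have hsq := norm_sq_insertNth j x y
        have hmem' : x ∈ {x : ℝ | x ^ 2 + ‖(WithLp.toLp 2 y : Rn m)‖ ^ 2 ≤ N ^ 2 * x ^ 2} := by
          simp only [hU, Set.mem_ofPred_eq, hsq] at hmem
          simpa using hmem
        simp only [hF, hG, Set.indicator_of_mem hmem']
        rw [← ENNReal.ofReal_mul (by have := jap_pos ((WithLp.toLp 2 y : Rn m) - a'); positivity),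
          mul_comm]
        have hnorm : ‖(WithLp.toLp 2 (j.insertNth x y) : Rn (m + 1))‖ =
            Real.sqrt (x ^ 2 + ‖(WithLp.toLp 2 y : Rn m)‖ ^ 2) := by
          rw [← hsq, Real.sqrt_sq (norm_nonneg _)]
        rw [hnorm]
        apply ENNReal.ofReal_le_ofReal
        -- Dropping the j-th coordinate only increases the weight, which then depends on the other n
        -- − 1 variables alone and is integrable because s > n − 1.
        have hle : jap ((WithLp.toLp 2 y : Rn m) - a') ≤
            jap ((WithLp.toLp 2 (j.insertNth x y) : Rn (m + 1)) - a) := by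
          have : (WithLp.toLp 2 (j.insertNth x y) : Rn (m + 1)) - a =
              WithLp.toLp 2 (j.insertNth (x - a j) (fun i ↦ y i - a (j.succAbove i))) := by
            ext i
            refine Fin.succAboveCases j ?_ (fun i ↦ ?_) i <;> simp
          rw [this]
          unfold jap
          rw [norm_sq_insertNth]
          apply Real.sqrt_le_sqrt
          have h0 : (WithLp.toLp 2 y : Rn m) - a' =
              WithLp.toLp 2 (fun i ↦ y i - a (j.succAbove i)) := by
            ext i; simp [ha']
          rw [h0]
          nlinarith [sq_nonneg (x - a j)]
        have hp := jap_pos ((WithLp.toLp 2 y : Rn m) - a')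
        refine mul_le_mul_of_nonneg_right ?_ (by positivity)
        exact Real.rpow_le_rpow_of_nonpos hp hle (by linarith)
      · rw [Set.indicator_of_notMem hmem]; exact zero_le
    · calc ∫⁻ y, ∫⁻ x, G x y ≤ ∫⁻ y : Rn m, ENNReal.ofReal (jap (y - a') ^ (-s)) * C₁ := by
            refine lintegral_mono fun y ↦ ?_
            simp only [hG]
            rw [lintegral_const_mul' _ _ ENNReal.ofReal_ne_top, lintegral_indicator
              (measurableSet_le (by fun_prop) (by fun_prop))]
            gcongr
            exact lintegral_shell_line_le hN κ ‖y‖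
        _ = C₂ * C₁ := by
            rw [lintegral_mul_const' _ _ hC₁'.ne,
              lintegral_sub_right_eq_self (fun y : Rn m ↦ ENNReal.ofReal (jap y ^ (-s))) a']
  calc ∫⁻ ξ, F ξ = ∫⁻ ξ in ⋃ j, U j, F ξ := by rw [hcover, Measure.restrict_univ]
    _ ≤ ∑' j, ∫⁻ ξ in U j, F ξ := lintegral_iUnion_le _ _
    _ ≤ ∑' _j : Fin (m + 1), C₂ * C₁ := ENNReal.tsum_le_tsum hj
    _ = _ := by rw [tsum_fintype, Finset.sum_const, Finset.card_univ, Fintype.card_fin, nsmul_eq_mul]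

/-! ### The weighted bound for the kernel -/

/-- Distribution of exponents, with Y the larger of the two brackets. The kernel yields R⁻² ≲ Y⁻².
The power Y^(s−2β) is spent to improve Z^(-2β) to Z^(-s), which is integrable over shells. The
remaining Y^(-(4β+2-s)) is converted into decay in T ≤ 2Y. -/
theorem kerK_weight_aux {α β s C₀ T Y Z R : ℝ} (hs : 2 * β ≤ s) (hp : 0 ≤ 4 * β + 2 - s)
    (hα : 2 * α ≤ 4 * β + 2 - s) (hT : 1 ≤ T) (hZ : 1 ≤ Z) (hZY : Z ≤ Y)
    (hTY : T ≤ 2 * Y) (hR : 0 < R) (hYR : Y ≤ C₀ * R) :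
    (R ^ 2)⁻¹ * (Y ^ (-(2 * β)) * Z ^ (-(2 * β))) ≤
      C₀ ^ 2 * 2 ^ (4 * β + 2 - s) * (T ^ (-(2 * α)) * Z ^ (-s)) := by
  have hZ0 : 0 < Z := by linarith
  have hY0 : 0 < Y := by linarith
  have hT0 : 0 < T := by linarith
  have h1 : (R ^ 2)⁻¹ ≤ C₀ ^ 2 * Y ^ (-2 : ℝ) := by
    rw [Real.rpow_neg hY0.le, ← div_eq_mul_inv, inv_eq_one_div,
      div_le_div_iff₀ (by positivity) (by positivity), one_mul, ← mul_pow]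
    have e : Y ^ (2 : ℝ) = Y ^ 2 := by norm_cast
    rw [e]
    gcongr
  have h2 : Z ^ (-(2 * β)) ≤ Y ^ (s - 2 * β) * Z ^ (-s) := by
    calc Z ^ (-(2 * β)) = Z ^ (s - 2 * β) * Z ^ (-s) := by
          rw [← Real.rpow_add hZ0]; congr 1; ring
      _ ≤ _ := by
          gcongr
  have h3 : Y ^ (-(4 * β + 2 - s)) ≤ 2 ^ (4 * β + 2 - s) * T ^ (-(2 * α)) := by
    calc Y ^ (-(4 * β + 2 - s)) ≤ (T / 2) ^ (-(4 * β + 2 - s)) :=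
          Real.rpow_le_rpow_of_nonpos (by positivity) (by linarith) (by linarith)
      _ = 2 ^ (4 * β + 2 - s) * T ^ (-(4 * β + 2 - s)) := by
          rw [Real.div_rpow hT0.le (by norm_num), Real.rpow_neg (by norm_num : (0:ℝ) ≤ 2),
            div_inv_eq_mul, mul_comm]
      _ ≤ _ := by
          gcongr
  calc (R ^ 2)⁻¹ * (Y ^ (-(2 * β)) * Z ^ (-(2 * β)))
      ≤ (C₀ ^ 2 * Y ^ (-2 : ℝ)) * (Y ^ (-(2 * β)) * (Y ^ (s - 2 * β) * Z ^ (-s))) := by gcongr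
    _ = C₀ ^ 2 * (Y ^ (-2 : ℝ) * Y ^ (-(2 * β)) * Y ^ (s - 2 * β)) * Z ^ (-s) := by ring
    _ = C₀ ^ 2 * Y ^ (-(4 * β + 2 - s)) * Z ^ (-s) := by
        rw [← Real.rpow_add hY0, ← Real.rpow_add hY0]; congr 3; ring
    _ ≤ C₀ ^ 2 * (2 ^ (4 * β + 2 - s) * T ^ (-(2 * α))) * Z ^ (-s) := by gcongr
    _ = _ := by ring

/-- This is the source of the ranges of α: s must exceed n − 1 and be at least 2β, and the decay
obtained is 4β+2−s ≥ 2α. Pushing s towards n − 1 gives 2β − (n−3)/2, pushing it towards 2β gives β +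
1. -/
theorem exists_weight_exponent {α β : ℝ} (hβ : 0 ≤ β)
    (h : ((n : ℝ) - 3) / 2 < β ∧ β < ((n : ℝ) - 1) / 2 ∧ α < 2 * β - ((n : ℝ) - 3) / 2 ∨
        ((n : ℝ) - 1) / 2 ≤ β ∧ α < β + 1) :
    ∃ s : ℝ, (n : ℝ) - 1 < s ∧ 2 * β ≤ s ∧ 0 ≤ 4 * β + 2 - s ∧ 2 * α ≤ 4 * β + 2 - s := by
  rcases h with ⟨h1, h2, h3⟩ | ⟨h1, h2⟩
  · refine ⟨(n : ℝ) - 1 + min (4 * β + 2 - (n - 1)) (4 * β + 2 - (n - 1) - 2 * α), ?_, ?_, ?_, ?_⟩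
    · have : 0 < min (4 * β + 2 - ((n : ℝ) - 1)) (4 * β + 2 - (n - 1) - 2 * α) :=
        lt_min (by linarith) (by linarith)
      linarith
    · have : 0 < min (4 * β + 2 - ((n : ℝ) - 1)) (4 * β + 2 - (n - 1) - 2 * α) :=
        lt_min (by linarith) (by linarith)
      linarith
    · linarith [min_le_left (4 * β + 2 - ((n : ℝ) - 1)) (4 * β + 2 - (n - 1) - 2 * α)]
    · linarith [min_le_right (4 * β + 2 - ((n : ℝ) - 1)) (4 * β + 2 - (n - 1) - 2 * α)]
  · refine ⟨2 * β + min 1 (2 * β + 2 - 2 * α), ?_, ?_, ?_, ?_⟩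
    · have : 0 < min 1 (2 * β + 2 - 2 * α) := lt_min (by linarith) (by linarith)
      linarith
    · have : 0 < min 1 (2 * β + 2 - 2 * α) := lt_min (by linarith) (by linarith)
      linarith
    · linarith [min_le_left 1 (2 * β + 2 - 2 * α)]
    · linarith [min_le_right 1 (2 * β + 2 - 2 * α)]

/-- The weighted `L²` bound of the resolvent kernel. -/
theorem exists_lintegral_kerK_le (hn : 1 ≤ n) {α β : ℝ} (hβ : 0 ≤ β)
    (h : ((n : ℝ) - 3) / 2 < β ∧ β < ((n : ℝ) - 1) / 2 ∧ α < 2 * β - ((n : ℝ) - 3) / 2 ∨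
        ((n : ℝ) - 1) / 2 ≤ β ∧ α < β + 1) {κ₀ : ℝ} (hκ₀ : 0 < κ₀) :
    ∃ C : ℝ≥0∞, C < ⊤ ∧ ∀ (κ : ℝ) (v w : Rn n), κ₀ ≤ κ → ‖v‖ = κ → ‖w - v‖ ≤ κ →
      ∫⁻ ξ, ENNReal.ofReal (kerK κ ‖ξ‖ ^ 2 *
        (jap (w - ξ) ^ (-(2 * β)) * jap (ξ - v) ^ (-(2 * β)))) ≤
      C * ENNReal.ofReal (jap (w - v) ^ (-(2 * α))) := by
  obtain ⟨s, hs1, hs2, hs3, hs4⟩ := exists_weight_exponent hβ h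
  obtain ⟨C, hC, hCb⟩ := exists_lintegral_shell_le hs1 hn
  set C₀ : ℝ := 1 / κ₀ + 2
  set D : ℝ := C₀ ^ 2 * 2 ^ (4 * β + 2 - s)
  refine ⟨ENNReal.ofReal D * (C + C), ENNReal.mul_lt_top ENNReal.ofReal_lt_top
    (ENNReal.add_lt_top.2 ⟨hC, hC⟩), fun κ v w hκ hv hwv ↦ ?_⟩
  have hκ0 : 0 < κ := hκ₀.trans_le hκ
  have hone : 1 ≤ 1 / κ₀ * κ := by rw [div_mul_eq_mul_div, one_mul, one_le_div hκ₀]; exact hκ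
  set T := jap (w - v)
  have hT := one_le_jap (w - v)
  have hpt : ∀ ξ, kerK κ ‖ξ‖ ^ 2 * (jap (w - ξ) ^ (-(2 * β)) * jap (ξ - v) ^ (-(2 * β))) ≤
      D * T ^ (-(2 * α)) * ((1 + |κ - ‖ξ‖|) ^ (-2 : ℝ) * jap (ξ - v) ^ (-s) +
        (1 + |κ - ‖ξ‖|) ^ (-2 : ℝ) * jap (ξ - w) ^ (-s)) := by
    intro ξ
    set Y := jap (w - ξ) with hYdef
    set Z := jap (ξ - v) with hZdef
    have hY := one_le_jap (w - ξ)
    have hZ := one_le_jap (ξ - v)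
    have hR : 0 < κ + ‖ξ‖ := by positivity
    have hr := norm_nonneg ξ
    have hextra : 0 ≤ 1 / κ₀ * ‖ξ‖ := by positivity
    have hZR : Z ≤ C₀ * (κ + ‖ξ‖) := by
      have h1 : ‖ξ - v‖ ≤ ‖ξ‖ + κ := (norm_sub_le _ _).trans (by rw [hv])
      have h2 := jap_le (ξ - v)
      calc Z ≤ 1 + (‖ξ‖ + κ) := by linarith
        _ ≤ C₀ * (κ + ‖ξ‖) := by simp only [C₀]; nlinarith
    have hYR : Y ≤ C₀ * (κ + ‖ξ‖) := by
      have h1 : ‖w - ξ‖ ≤ κ + (‖ξ‖ + κ) := by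
        rw [show w - ξ = (w - v) - (ξ - v) by abel]
        exact (norm_sub_le _ _).trans (add_le_add hwv ((norm_sub_le _ _).trans (by rw [hv])))
      have h2 := jap_le (w - ξ)
      calc Y ≤ 1 + (κ + (‖ξ‖ + κ)) := by linarith
        _ ≤ C₀ * (κ + ‖ξ‖) := by simp only [C₀]; nlinarith
    have hTYZ : T ≤ Y + Z := by
      have := jap_add_le (w - ξ) (ξ - v)
      rwa [sub_add_sub_cancel] at this
    have hK : kerK κ ‖ξ‖ ^ 2 = ((κ + ‖ξ‖) ^ 2)⁻¹ * (1 + |κ - ‖ξ‖|) ^ (-2 : ℝ) := by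
      have e : (1 + |κ - ‖ξ‖|) ^ (2 : ℝ) = (1 + |κ - ‖ξ‖|) ^ 2 := by norm_cast
      rw [Real.rpow_neg (by positivity), e, kerK, ← inv_pow, mul_inv, mul_pow, inv_pow, inv_pow]
    have hw' : jap (ξ - w) = Y := jap_sub_comm _ _
    rw [hK, hw']
    set L := (1 + |κ - ‖ξ‖|) ^ (-2 : ℝ)
    have hL : 0 ≤ L := by positivity
    have hY0 : 0 < Y := by linarith
    have hZ0 : 0 < Z := by linarith
    have hT0 : 0 < T := by linarith
    have hD : 0 ≤ D := by positivity
    -- The shell weight is centred at whichever of v and w is nearer to ξ; summing both centres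
    -- covers the two cases.
    rcases le_total Z Y with hZY | hYZ
    · have := kerK_weight_aux (R := κ + ‖ξ‖) hs2 hs3 hs4 hT hZ hZY (by linarith)
        hR hYR
      calc _ = L * (((κ + ‖ξ‖) ^ 2)⁻¹ * (Y ^ (-(2 * β)) * Z ^ (-(2 * β)))) := by ring
        _ ≤ L * (D * (T ^ (-(2 * α)) * Z ^ (-s))) := by gcongr
        _ = D * T ^ (-(2 * α)) * (L * Z ^ (-s)) := by ring
        _ ≤ _ := by
          gcongr
          exact le_add_of_nonneg_right (by positivity)
    · have := kerK_weight_aux (R := κ + ‖ξ‖) hs2 hs3 hs4 hT hY hYZ (by linarith)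
        hR hZR
      calc _ = L * (((κ + ‖ξ‖) ^ 2)⁻¹ * (Z ^ (-(2 * β)) * Y ^ (-(2 * β)))) := by ring
        _ ≤ L * (D * (T ^ (-(2 * α)) * Y ^ (-s))) := by gcongr
        _ = D * T ^ (-(2 * α)) * (L * Y ^ (-s)) := by ring
        _ ≤ _ := by
          gcongr
          exact le_add_of_nonneg_left (by positivity)
  have hm : ∀ u : Rn n, Measurable fun ξ : Rn n ↦
      ENNReal.ofReal ((1 + |κ - ‖ξ‖|) ^ (-2 : ℝ) * jap (ξ - u) ^ (-s)) := fun u ↦ by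
    have h2 : Measurable fun ξ : Rn n ↦ jap (ξ - u) ^ (-s) :=
      (continuous_jap_rpow (E := Rn n) (-s)).measurable.comp (measurable_id.sub_const u)
    exact (Measurable.mul (by fun_prop) h2).ennreal_ofReal
  have hT0 : 0 < T := by linarith
  calc _ ≤ ∫⁻ ξ, ENNReal.ofReal (D * T ^ (-(2 * α))) *
        (ENNReal.ofReal ((1 + |κ - ‖ξ‖|) ^ (-2 : ℝ) * jap (ξ - v) ^ (-s)) +
          ENNReal.ofReal ((1 + |κ - ‖ξ‖|) ^ (-2 : ℝ) * jap (ξ - w) ^ (-s))) := by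
        refine lintegral_mono fun ξ ↦ ?_
        have h1 := jap_pos (ξ - v)
        have h2 := jap_pos (ξ - w)
        rw [← ENNReal.ofReal_add (by positivity) (by positivity),
          ← ENNReal.ofReal_mul (by positivity)]
        exact ENNReal.ofReal_le_ofReal (hpt ξ)
    _ ≤ ENNReal.ofReal (D * T ^ (-(2 * α))) * (C + C) := by
        rw [lintegral_const_mul' _ _ ENNReal.ofReal_ne_top, lintegral_add_left (hm v)]
        gcongr
        · exact hCb κ v
        · exact hCb κ w
    _ = _ := by
        rw [ENNReal.ofReal_mul (by positivity)]; ring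

/-! ### The Fourier transform on `L²` -/

theorem L2.ext_schwartz {f g : L2 n} (h : ∀ φ : 𝓢(Rn n, ℂ), ∫ x, φ x * f x = ∫ x, φ x * g x) :
    f = g := by
  have hk := Lp.ker_toTemperedDistributionCLM_eq_bot (F := ℂ) (μ := (volume : Measure (Rn n)))
    (p := 2)
  refine LinearMap.ker_eq_bot.1 hk ?_
  ext φ
  simpa using h φ

theorem integral_mul_fourier (f : L2 n) (φ : 𝓢(Rn n, ℂ)) :
    ∫ x, φ x * (𝓕 f : L2 n) x = ∫ x, (𝓕 φ) x * f x := by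
  have h := congrArg (fun u : 𝓢'(Rn n, ℂ) ↦ u φ) (Lp.fourier_toTemperedDistribution_eq f)
  simpa [TemperedDistribution.fourier_apply] using h.symm

theorem integral_mul_fourierInv (f : L2 n) (φ : 𝓢(Rn n, ℂ)) :
    ∫ x, φ x * (𝓕⁻ f : L2 n) x = ∫ x, (𝓕⁻ φ) x * f x := by
  have h := congrArg (fun u : 𝓢'(Rn n, ℂ) ↦ u φ) (Lp.fourierInv_toTemperedDistribution_eq f)
  simpa [TemperedDistribution.fourierInv_apply] using h.symm

theorem L2.integrable_mul (f g : L2 n) : Integrable fun x ↦ f x * g x :=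
  (Lp.memLp f).integrable_mul (Lp.memLp g)

/-- The multiplication formula without conjugation. It holds for Schwartz f by duality with tempered
distributions, and both sides are continuous in f. -/
theorem L2.integral_mul_fourierInv (f g : L2 n) :
    ∫ x, f x * (𝓕⁻ g : L2 n) x = ∫ x, (𝓕⁻ f : L2 n) x * g x := by
  have hpair : ∀ a b : L2 n, (ContinuousLinearMap.mul ℂ ℂ).lpPairing volume 2 2 a b =
      ∫ x, a x * b x := fun a b ↦ by
    simp [ContinuousLinearMap.lpPairing_eq_integral]
  rw [← hpair, ← hpair]
  have hc : Continuous fun f : L2 n ↦ (𝓕⁻ f : L2 n) := continuous_fourierInv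
  refine DenseRange.induction_on (SchwartzMap.denseRange_toLpCLM (p := 2) ENNReal.ofNat_ne_top)
    (p := fun f : L2 n ↦ (ContinuousLinearMap.mul ℂ ℂ).lpPairing volume 2 2 f (𝓕⁻ g : L2 n) =
      (ContinuousLinearMap.mul ℂ ℂ).lpPairing volume 2 2 (𝓕⁻ f : L2 n) g) f ?_ ?_
  · apply isClosed_eq
    · exact ((ContinuousLinearMap.mul ℂ ℂ).lpPairing volume 2 2).continuous.clm_apply
        continuous_const
    · exact (((ContinuousLinearMap.mul ℂ ℂ).lpPairing volume 2 2).continuous.comp hc).clm_apply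
        continuous_const
  · intro φ
    rw [hpair, hpair, SchwartzMap.toLpCLM_apply, SchwartzMap.toLp_fourierInv_eq]
    have h := FixedAngle.integral_mul_fourierInv g φ
    refine Eq.trans ?_ (h.trans ?_)
    · refine integral_congr_ae ?_
      filter_upwards [φ.coeFn_toLp 2 volume] with x hx using by rw [hx]
    · refine integral_congr_ae ?_
      filter_upwards [(𝓕⁻ φ).coeFn_toLp 2 volume] with x hx using by rw [hx]

theorem L2.comp_sub_left_ae (f : L2 n) (c : Rn n) :
    MemLp (fun x ↦ f (c - x)) 2 (volume : Measure (Rn n)) :=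
  (Lp.memLp f).comp_measurePreserving (Measure.measurePreserving_sub_left volume c)

theorem L2.comp_sub_right_ae (f : L2 n) (c : Rn n) :
    MemLp (fun x ↦ f (x - c)) 2 (volume : Measure (Rn n)) :=
  (Lp.memLp f).comp_measurePreserving (measurePreserving_sub_right volume c)

theorem fourier_comp_add_apply (φ : 𝓢(Rn n, ℂ)) (u y : Rn n) :
    (𝓕 (φ.compSubConstCLM ℂ (-((2 * Real.pi)⁻¹ • u)))) y =
      Complex.exp (Complex.I * ((inner ℝ u y : ℝ) : ℂ)) * (𝓕 φ) y := by
  rw [SchwartzMap.fourier_coe, SchwartzMap.fourier_coe, Real.fourier_eq', Real.fourier_eq',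
    ← integral_const_mul]
  rw [← integral_sub_right_eq_self _ ((2 * Real.pi)⁻¹ • u)]
  congr 1
  ext x
  simp only [SchwartzMap.compSubConstCLM_apply, sub_neg_eq_add, sub_add_cancel, smul_eq_mul]
  rw [← mul_assoc, ← Complex.exp_add]
  congr 2
  rw [inner_sub_left, inner_smul_left]
  simp
  field_simp
  ring

theorem fourier_comp_sub_left_apply (φ ψ : 𝓢(Rn n, ℂ)) (u y : Rn n)
    (hψ : ∀ x, ψ x = φ ((2 * Real.pi)⁻¹ • u - x)) :
    (𝓕 ψ) y = Complex.exp (Complex.I * ((inner ℝ (-u) y : ℝ) : ℂ)) * (𝓕⁻ φ) y := by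
  rw [SchwartzMap.fourier_coe, SchwartzMap.fourierInv_coe, Real.fourier_eq', Real.fourierInv_eq',
    ← integral_const_mul]
  rw [← integral_sub_left_eq_self _ volume ((2 * Real.pi)⁻¹ • u)]
  congr 1
  ext x
  simp only [hψ, sub_sub_cancel, smul_eq_mul]
  rw [← mul_assoc, ← Complex.exp_add]
  congr 2
  rw [inner_sub_left, inner_smul_left, inner_neg_left]
  simp
  field_simp
  ring

theorem fourier_modulate (u : Rn n) (q : L2 n) :
    (𝓕 (modulate u q) : L2 n) =ᵐ[volume] fun ξ ↦ (𝓕 q : L2 n) (ξ - (2 * Real.pi)⁻¹ • u) := by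
  have hm := L2.comp_sub_right_ae (𝓕 q : L2 n) ((2 * Real.pi)⁻¹ • u)
  suffices h : (𝓕 (modulate u q) : L2 n) = hm.toLp by
    rw [h]; exact hm.coeFn_toLp
  refine L2.ext_schwartz fun φ ↦ ?_
  calc ∫ x, φ x * (𝓕 (modulate u q) : L2 n) x
      = ∫ x, (𝓕 φ) x * modulate u q x := integral_mul_fourier _ _
    _ = ∫ x, (𝓕 (φ.compSubConstCLM ℂ (-((2 * Real.pi)⁻¹ • u)))) x * q x := by
        refine integral_congr_ae ?_
        filter_upwards [(memLp_modulate u q).coeFn_toLp] with x hx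
        rw [modulate, hx, fourier_comp_add_apply]
        ring
    _ = ∫ x, φ (x + (2 * Real.pi)⁻¹ • u) * (𝓕 q : L2 n) x := by
        rw [← integral_mul_fourier]; simp
    _ = ∫ x, φ x * (𝓕 q : L2 n) (x - (2 * Real.pi)⁻¹ • u) := by
        rw [← integral_sub_right_eq_self _ ((2 * Real.pi)⁻¹ • u)]
        simp
    _ = ∫ x, φ x * (MemLp.toLp _ hm : L2 n) x := by
        refine integral_congr_ae ?_
        filter_upwards [hm.coeFn_toLp] with x hx using by rw [hx]

theorem fourierInv_modulate (u : Rn n) (q : L2 n) :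
    (𝓕⁻ (modulate (-u) q) : L2 n) =ᵐ[volume]
      fun ξ ↦ (𝓕 q : L2 n) ((2 * Real.pi)⁻¹ • u - ξ) := by
  have hm := L2.comp_sub_left_ae (𝓕 q : L2 n) ((2 * Real.pi)⁻¹ • u)
  suffices h : (𝓕⁻ (modulate (-u) q) : L2 n) = hm.toLp by
    rw [h]; exact hm.coeFn_toLp
  refine L2.ext_schwartz fun φ ↦ ?_
  set ψ : 𝓢(Rn n, ℂ) := (SchwartzMap.compCLMOfContinuousLinearEquiv ℂ
    (ContinuousLinearEquiv.neg ℝ) φ).compSubConstCLM ℂ ((2 * Real.pi)⁻¹ • u) with hψ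
  have hψ' : ∀ x, ψ x = φ ((2 * Real.pi)⁻¹ • u - x) := fun x ↦ by simp [hψ]
  calc ∫ x, φ x * (𝓕⁻ (modulate (-u) q) : L2 n) x
      = ∫ x, (𝓕⁻ φ) x * modulate (-u) q x := integral_mul_fourierInv _ _
    _ = ∫ x, (𝓕 ψ) x * q x := by
        refine integral_congr_ae ?_
        filter_upwards [(memLp_modulate (-u) q).coeFn_toLp] with x hx
        rw [modulate, hx, fourier_comp_sub_left_apply φ ψ u x hψ']
        ring
    _ = ∫ x, ψ x * (𝓕 q : L2 n) x := by rw [← integral_mul_fourier]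
    _ = ∫ x, φ x * (𝓕 q : L2 n) ((2 * Real.pi)⁻¹ • u - x) := by
        rw [← integral_sub_left_eq_self _ volume ((2 * Real.pi)⁻¹ • u)]
        simp [hψ']
    _ = ∫ x, φ x * (MemLp.toLp _ hm : L2 n) x := by
        refine integral_congr_ae ?_
        filter_upwards [hm.coeFn_toLp] with x hx using by rw [hx]

/-! ### The bilinear form in frequency space -/

/-- `∫ f(w-ξ) g(ξ-v) (κ²-|ξ|²+iε)⁻¹ dξ`. -/
def resForm (κ ε : ℝ) (v w : Rn n) (f g : Rn n → ℂ) : ℂ :=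
  ∫ ξ, f (w - ξ) * g (ξ - v) * res κ ε ‖ξ‖

/-- With η = 2πξ the wave number becomes κ = k/2π and ε is divided by 4π²; the constant (4π²)⁻¹ is
carried through the rest. -/
theorem resolventSymbol_eq (k ε : ℝ) (ξ : Rn n) :
    resolventSymbol k ε ξ = ((4 * Real.pi ^ 2 : ℝ) : ℂ)⁻¹ *
      res (k / (2 * Real.pi)) (ε / (4 * Real.pi ^ 2)) ‖ξ‖ := by
  have hπ := Real.pi_ne_zero
  unfold resolventSymbol res
  rw [← mul_inv]
  congr 1
  rw [norm_smul, Real.norm_of_nonneg (by positivity), mul_add, ← Complex.ofReal_mul, ← mul_assoc,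
    ← Complex.ofReal_mul]
  congr 3 <;> field_simp
  ring

theorem waveNumber_pos {θ η : Rn n} (h : inner ℝ η θ < 0) : 0 < waveNumber θ η := by
  have hη : η ≠ 0 := by rintro rfl; simp at h
  unfold waveNumber
  rw [real_inner_comm]
  rw [← div_neg]
  have := norm_pos_iff.2 hη
  exact div_pos (by positivity) (by linarith)

/-- This is why a high-frequency cut-off suffices: |η| ≥ 1 forces k ≥ 1, so the uniform estimates
for wave numbers bounded below apply. -/
theorem norm_le_waveNumber {θ η : Rn n} (hθ : ‖θ‖ = 1) (h : inner ℝ η θ < 0) :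
    ‖η‖ ≤ waveNumber θ η := by
  have h1 : -inner ℝ η θ ≤ ‖η‖ := by
    have := abs_real_inner_le_norm η θ
    rw [hθ, mul_one] at this
    exact (neg_le_abs _).trans this
  unfold waveNumber
  rw [real_inner_comm, ← div_neg, le_div_iff₀ (by linarith), sq]
  exact mul_le_mul_of_nonneg_left h1 (norm_nonneg _)

theorem smul_outDir {θ η : Rn n} (h : inner ℝ η θ < 0) :
    waveNumber θ η • outDir θ η = η + waveNumber θ η • θ :=
  smul_inv_smul₀ (waveNumber_pos h).ne' _

/-- Since k θ·η = −|η|², expanding the square gives |kθ'|² = k² − |η|². The sequel uses only the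
consequence |kθ'| ≤ k. -/
theorem norm_add_waveNumber {θ η : Rn n} (hθ : ‖θ‖ = 1) (h : inner ℝ η θ < 0) :
    ‖η + waveNumber θ η • θ‖ ^ 2 + ‖η‖ ^ 2 = waveNumber θ η ^ 2 := by
  have hne : inner ℝ η θ ≠ 0 := h.ne
  rw [norm_add_sq_real, norm_smul, inner_smul_right, mul_pow, hθ, Real.norm_eq_abs, sq_abs]
  have : waveNumber θ η * inner ℝ η θ = -‖η‖ ^ 2 := by
    unfold waveNumber; rw [real_inner_comm]; field_simp
  rw [this]; ring

/-- In frequency space `B` is a quadratic form in `𝓕 q`. -/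
theorem regB_eq_resForm {ε : ℝ} (hε : 0 < ε) (q : L2 n) {θ η : Rn n} (h : inner ℝ η θ < 0) :
    regB ε θ q η = ((4 * Real.pi ^ 2 : ℝ) : ℂ)⁻¹ *
      resForm (waveNumber θ η / (2 * Real.pi)) (ε / (4 * Real.pi ^ 2))
        ((2 * Real.pi)⁻¹ • (waveNumber θ η • θ)) ((2 * Real.pi)⁻¹ • (η + waveNumber θ η • θ))
        (𝓕 q : L2 n) (𝓕 q : L2 n) := by
  set k := waveNumber θ η with hk
  set G : L2 n := (memLp_resolventSymbol_mul k hε (𝓕 (modulate (k • θ) q))).toLp with hG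
  have hres : resolvent k ε (modulate (k • θ) q) = 𝓕⁻ G := by rw [resolvent, dif_pos hε]
  rw [regB, if_pos h, hres]
  have h1 : ∫ y, Complex.exp (-(Complex.I * ((k * inner ℝ (outDir θ η) y : ℝ) : ℂ))) *
      (q y * (𝓕⁻ G : L2 n) y) = ∫ y, modulate (-(η + k • θ)) q y * (𝓕⁻ G : L2 n) y := by
    refine integral_congr_ae ?_
    filter_upwards [(memLp_modulate (-(η + k • θ)) q).coeFn_toLp] with y hy
    rw [modulate, hy, ← smul_outDir h, inner_neg_left, inner_smul_left, mul_assoc]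
    simp [hk]
  rw [h1, L2.integral_mul_fourierInv, resForm, ← integral_const_mul]
  refine integral_congr_ae ?_
  filter_upwards [fourierInv_modulate (η + k • θ) q, fourier_modulate (k • θ) q,
    (memLp_resolventSymbol_mul k hε (𝓕 (modulate (k • θ) q))).coeFn_toLp] with ξ h2 h3 h4
  rw [h2, hG, h4, h3, resolventSymbol_eq]
  ring

theorem regB_of_nonneg {ε : ℝ} (q : L2 n) {θ η : Rn n} (h : 0 ≤ inner ℝ η θ) :
    regB ε θ q η = 0 := by
  rw [regB, if_neg h.not_gt]

/-! ### Jets of products and of weights -/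

section jet
variable {E : Type*} [NormedAddCommGroup E] [NormedSpace ℝ E]

theorem jet_eq (f : E → ℂ) (x : E) :
    jet f x = ‖f x‖ + ‖iteratedFDeriv ℝ 1 f x‖ + ‖iteratedFDeriv ℝ 2 f x‖ := by
  rw [jet, norm_fderiv_fderiv, norm_iteratedFDeriv_one]

theorem jet_mul_le {f g : E → ℂ} (hf : ContDiff ℝ 2 f) (hg : ContDiff ℝ 2 g) (x : E) :
    jet (fun y ↦ f y * g y) x ≤ 2 * jet f x * jet g x := by
  have h1 := norm_iteratedFDeriv_mul_le hf hg x (n := 1) (by norm_num)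
  have h2 := norm_iteratedFDeriv_mul_le hf hg x (n := 2) (by norm_num)
  simp only [Finset.sum_range_succ, Finset.sum_range_zero, Nat.choose_zero_right, Nat.choose_self,
    norm_iteratedFDeriv_zero, Nat.cast_one, one_mul, zero_add, Nat.sub_zero,
    Nat.choose_one_right, Nat.cast_ofNat, Nat.reduceSub] at h1 h2
  rw [jet_eq, jet_eq, jet_eq, norm_mul]
  have a0 := norm_nonneg (f x)
  have a1 := norm_nonneg (iteratedFDeriv ℝ 1 f x)
  have a2 := norm_nonneg (iteratedFDeriv ℝ 2 f x)
  have b0 := norm_nonneg (g x)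
  have b1 := norm_nonneg (iteratedFDeriv ℝ 1 g x)
  have b2 := norm_nonneg (iteratedFDeriv ℝ 2 g x)
  have := mul_nonneg a0 b0
  have := mul_nonneg a0 b1
  have := mul_nonneg a0 b2
  have := mul_nonneg a1 b0
  have := mul_nonneg a1 b1
  have := mul_nonneg a1 b2
  have := mul_nonneg a2 b0
  have := mul_nonneg a2 b1
  have := mul_nonneg a2 b2
  nlinarith

theorem jet_comp_sub (f : E → ℂ) (a x : E) : jet (fun y ↦ f (y - a)) x = jet f (x - a) := by
  simp only [jet_eq, iteratedFDeriv_comp_sub']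

theorem jet_comp_sub_left (f : E → ℂ) (a x : E) : jet (fun y ↦ f (a - y)) x = jet f (a - x) := by
  have h1 : (fun y ↦ f (a - y)) = fun y ↦ (f ∘ (LinearIsometryEquiv.neg ℝ : E ≃ₗᵢ[ℝ] E)) (y - a) := by
    ext y; simp
  rw [h1, jet_comp_sub, jet_eq, jet_eq, LinearIsometryEquiv.norm_iteratedFDeriv_comp_right,
    LinearIsometryEquiv.norm_iteratedFDeriv_comp_right]
  simp

/-- The jet of `ξ ↦ f(w-ξ) g(ξ-v)`. -/
theorem jet_mul_sub_le {f g : E → ℂ} (hf : ContDiff ℝ 2 f) (hg : ContDiff ℝ 2 g) (v w x : E) :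
    jet (fun y ↦ f (w - y) * g (y - v)) x ≤ 2 * jet f (w - x) * jet g (x - v) := by
  have := jet_mul_le (f := fun y ↦ f (w - y)) (g := fun y ↦ g (y - v)) (by fun_prop)
    (by fun_prop) x
  rwa [jet_comp_sub, jet_comp_sub_left] at this

end jet

/-- `(1 + |2πξ|²)^s`. -/
def dualWeight (s : ℝ) (ξ : Rn n) : ℝ := (1 + ‖(2 * Real.pi) • ξ‖ ^ 2) ^ s

theorem dualWeight_pos (s : ℝ) (ξ : Rn n) : 0 < dualWeight s ξ :=
  Real.rpow_pos_of_pos (by positivity) _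

theorem dualWeight_mul (s t : ℝ) (ξ : Rn n) :
    dualWeight s ξ * dualWeight t ξ = dualWeight (s + t) ξ := by
  unfold dualWeight
  rw [← Real.rpow_add (by positivity)]

theorem dualWeight_zero (ξ : Rn n) : dualWeight 0 ξ = 1 := Real.rpow_zero _

theorem hasTemperateGrowth_dualWeight (s : ℝ) :
    (fun ξ : Rn n ↦ (dualWeight s ξ : ℂ)).HasTemperateGrowth := by
  have h1 := Function.hasTemperateGrowth_one_add_norm_sq_rpow (Rn n) s
  have h2 : (fun ξ : Rn n ↦ dualWeight s ξ).HasTemperateGrowth :=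
    h1.comp (((2 * Real.pi) • ContinuousLinearMap.id ℝ (Rn n)).hasTemperateGrowth)
  exact Function.HasTemperateGrowth.comp Function.Complex.hasTemperateGrowth_ofReal h2

theorem hasTemperateGrowth_jap_rpow (δ : ℝ) :
    (fun x : Rn n ↦ (((1 + ‖x‖ ^ 2) ^ (δ / 2) : ℝ) : ℂ)).HasTemperateGrowth :=
  Function.HasTemperateGrowth.comp Function.Complex.hasTemperateGrowth_ofReal
    (Function.hasTemperateGrowth_one_add_norm_sq_rpow (Rn n) (δ / 2))

theorem contDiff_dualWeight (s : ℝ) : ContDiff ℝ ∞ (dualWeight s : Rn n → ℝ) := by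
  unfold dualWeight
  have h : ContDiff ℝ ∞ fun ξ : Rn n ↦ (2 * Real.pi) • ξ := by fun_prop
  exact ContDiff.rpow_const_of_ne (contDiff_const.add (h.norm_sq ℝ)) fun x ↦ by positivity

theorem contDiff_ofReal_dualWeight (s : ℝ) :
    ContDiff ℝ ∞ (fun ξ : Rn n ↦ (dualWeight s ξ : ℂ)) :=
  Complex.ofRealCLM.contDiff.comp (contDiff_dualWeight s)

theorem fderiv_dualWeight (s : ℝ) (ξ : Rn n) :
    fderiv ℝ (dualWeight s) ξ =
      (2 * (2 * Real.pi) ^ 2 * s * dualWeight (s - 1) ξ) • innerSL ℝ ξ := by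
  have h0 : (dualWeight s : Rn n → ℝ) = fun ξ ↦ (1 + (2 * Real.pi) ^ 2 * ‖ξ‖ ^ 2) ^ s := by
    ext ξ
    rw [dualWeight, norm_smul, mul_pow, Real.norm_eq_abs, sq_abs]
  have h1 : HasFDerivAt (fun ξ : Rn n ↦ 1 + (2 * Real.pi) ^ 2 * ‖ξ‖ ^ 2)
      ((2 * Real.pi) ^ 2 • (2 • innerSL ℝ ξ)) ξ :=
    ((hasStrictFDerivAt_norm_sq ξ).hasFDerivAt.const_mul _).const_add 1
  have h2 := h1.rpow_const (p := s) (Or.inl (by positivity))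
  rw [h0, h2.fderiv]
  have h3 : dualWeight (s - 1) ξ = (1 + (2 * Real.pi) ^ 2 * ‖ξ‖ ^ 2) ^ (s - 1) := by
    rw [dualWeight, norm_smul, mul_pow, Real.norm_eq_abs, sq_abs]
  rw [h3]
  ext x
  simp
  ring

theorem dualWeight_sub_one_mul_norm_le (s : ℝ) (ξ : Rn n) :
    dualWeight (s - 1) ξ * ‖ξ‖ ≤ dualWeight s ξ := by
  have h := dualWeight_mul (s - 1) 1 ξ
  rw [sub_add_cancel] at h
  rw [← h]
  gcongr
  · exact (dualWeight_pos _ _).le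
  · rw [dualWeight, Real.rpow_one, norm_smul, mul_pow, Real.norm_eq_abs, sq_abs]
    have : 1 ≤ 2 * Real.pi := by linarith [Real.pi_gt_three]
    nlinarith [sq_nonneg (‖ξ‖ - 1), sq_nonneg ‖ξ‖, norm_nonneg ξ, mul_le_mul this this zero_le_one
      (by positivity)]

theorem dualWeight_mono {s t : ℝ} (h : s ≤ t) (ξ : Rn n) : dualWeight s ξ ≤ dualWeight t ξ :=
  Real.rpow_le_rpow_of_exponent_le (le_add_of_nonneg_right (by positivity)) h

theorem norm_fderiv_dualWeight_le (s : ℝ) (ξ : Rn n) :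
    ‖fderiv ℝ (dualWeight s) ξ‖ ≤ 2 * (2 * Real.pi) ^ 2 * |s| * dualWeight s ξ := by
  rw [fderiv_dualWeight, norm_smul, innerSL_apply_norm, norm_mul, norm_mul, Real.norm_eq_abs s,
    Real.norm_of_nonneg (dualWeight_pos _ _).le, Real.norm_of_nonneg (by positivity), mul_assoc]
  gcongr
  exact dualWeight_sub_one_mul_norm_le s ξ

/-- The inner product as a real-linear map into the dual space. -/
def innerL : Rn n →L[ℝ] Rn n →L[ℝ] ℝ :=
  LinearMap.mkContinuous
    { toFun := fun x ↦ innerSL ℝ x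
      map_add' := fun x y ↦ by simp
      map_smul' := fun c x ↦ by simp } 1 fun x ↦ by simp

theorem innerL_apply (x : Rn n) : innerL x = innerSL ℝ x := rfl

theorem fderiv_fderiv_dualWeight_apply (s : ℝ) (ξ x : Rn n) :
    fderiv ℝ (fderiv ℝ (dualWeight s)) ξ x = (2 * (2 * Real.pi) ^ 2 * s) •
      (dualWeight (s - 1) ξ • innerSL ℝ x + fderiv ℝ (dualWeight (s - 1)) ξ x • innerSL ℝ ξ) := by
  have h0 : fderiv ℝ (dualWeight s : Rn n → ℝ) = fun ξ ↦ (2 * (2 * Real.pi) ^ 2 * s) •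
      (dualWeight (s - 1) ξ • innerL ξ) := by
    ext1 ξ; rw [fderiv_dualWeight, smul_smul, innerL_apply]
  have h1 : HasFDerivAt (dualWeight (s - 1)) (fderiv ℝ (dualWeight (s - 1)) ξ) ξ :=
    ((contDiff_dualWeight (s - 1)).differentiable (by norm_num) ξ).hasFDerivAt
  have h2 := ((h1.smul (innerL (n := n)).hasFDerivAt).const_smul (2 * (2 * Real.pi) ^ 2 * s))
  rw [h0]
  exact congrArg (fun T ↦ T x) h2.fderiv

theorem norm_fderiv_fderiv_dualWeight_le (s : ℝ) (ξ : Rn n) :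
    ‖fderiv ℝ (fderiv ℝ (dualWeight s)) ξ‖ ≤
      2 * (2 * Real.pi) ^ 2 * |s| * (2 * (2 * Real.pi) ^ 2 * |s - 1| + 1) * dualWeight s ξ := by
  have hW := dualWeight_pos s ξ
  have hW' := dualWeight_pos (s - 1) ξ
  refine ContinuousLinearMap.opNorm_le_bound _ (by positivity) fun x ↦ ?_
  have hf := norm_fderiv_dualWeight_le (s - 1) ξ
  have hm := dualWeight_sub_one_mul_norm_le s ξ
  have hmono := dualWeight_mono (by linarith : s - 1 ≤ s) ξ
  rw [fderiv_fderiv_dualWeight_apply]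
  have hc : (0 : ℝ) ≤ 2 * (2 * Real.pi) ^ 2 := by positivity
  generalize (2 * (2 * Real.pi) ^ 2 : ℝ) = c at hc hf ⊢
  generalize fderiv ℝ (dualWeight (s - 1)) ξ = T at hf ⊢
  generalize dualWeight (s - 1) ξ = V at *
  generalize dualWeight s ξ = W at *
  have hx := norm_nonneg x
  have h3 : ‖V • innerSL ℝ x‖ ≤ W * ‖x‖ := by
    rw [norm_smul, Real.norm_of_nonneg hW'.le, innerSL_apply_norm]
    exact mul_le_mul_of_nonneg_right hmono hx
  have h4 : ‖T x • innerSL ℝ ξ‖ ≤ c * |s - 1| * W * ‖x‖ := by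
    rw [norm_smul, innerSL_apply_norm]
    calc ‖T x‖ * ‖ξ‖ ≤ (c * |s - 1| * V * ‖x‖) * ‖ξ‖ :=
          mul_le_mul_of_nonneg_right ((ContinuousLinearMap.le_opNorm _ _).trans
            (mul_le_mul_of_nonneg_right hf hx)) (norm_nonneg _)
      _ = c * |s - 1| * (V * ‖ξ‖) * ‖x‖ := by ring
      _ ≤ _ := mul_le_mul_of_nonneg_right (mul_le_mul_of_nonneg_left hm (by positivity)) hx
  rw [norm_smul, norm_mul, Real.norm_eq_abs s, Real.norm_of_nonneg hc]
  calc _ ≤ c * |s| * (W * ‖x‖ + c * |s - 1| * W * ‖x‖) :=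
        mul_le_mul_of_nonneg_left ((norm_add_le _ _).trans (add_le_add h3 h4)) (by positivity)
    _ = _ := by ring

/-- The symbol estimate that allows the Bessel weight to be pulled out of a 2-jet: its derivatives
are bounded by the weight itself. -/
theorem exists_jet_dualWeight_le (s : ℝ) : ∃ C : ℝ, 0 ≤ C ∧ ∀ ξ : Rn n,
    jet (fun ξ ↦ (dualWeight s ξ : ℂ)) ξ ≤ C * dualWeight s ξ := by
  refine ⟨1 + 2 * (2 * Real.pi) ^ 2 * |s| +
    2 * (2 * Real.pi) ^ 2 * |s| * (2 * (2 * Real.pi) ^ 2 * |s - 1| + 1), by positivity,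
    fun ξ ↦ ?_⟩
  have h1 : ∀ k : ℕ, ‖iteratedFDeriv ℝ k (fun ξ : Rn n ↦ (dualWeight s ξ : ℂ)) ξ‖ =
      ‖iteratedFDeriv ℝ k (dualWeight s) ξ‖ := fun k ↦
    Complex.ofRealLI.norm_iteratedFDeriv_comp_left (i := k)
      (((contDiff_dualWeight s).of_le (by exact_mod_cast le_top)).contDiffAt) le_rfl
  have h2 := norm_fderiv_dualWeight_le s ξ
  have h3 := norm_fderiv_fderiv_dualWeight_le s ξ
  have h4 : ‖iteratedFDeriv ℝ 2 (dualWeight s) ξ‖ = ‖fderiv ℝ (fderiv ℝ (dualWeight s)) ξ‖ := by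
    rw [← norm_iteratedFDeriv_fderiv, norm_iteratedFDeriv_one]
  rw [jet_eq, h1, h1, norm_iteratedFDeriv_one, h4, Complex.norm_real,
    Real.norm_of_nonneg (dualWeight_pos _ _).le]
  linarith

theorem dualWeight_le_jap {β : ℝ} (hβ : 0 ≤ β) (ξ : Rn n) :
    dualWeight (-(β / 2)) ξ ≤ jap ξ ^ (-β) := by
  rw [jap_rpow, dualWeight, neg_div]
  refine Real.rpow_le_rpow_of_nonpos (by positivity) ?_ (by linarith)
  rw [norm_smul, Real.norm_of_nonneg (by positivity)]
  have : 1 ≤ 2 * Real.pi := by linarith [Real.pi_gt_three]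
  have h2 : ‖ξ‖ ≤ 2 * Real.pi * ‖ξ‖ := le_mul_of_one_le_left (norm_nonneg _) this
  gcongr

/-! ### Multiplication operators on `L²` -/

/-- Multiplication by a bounded function. -/
def mulL {m : Rn n → ℂ} (hm : MemLp m ∞ (volume : Measure (Rn n))) : L2 n →L[ℂ] L2 n :=
  (ContinuousLinearMap.lsmul ℂ ℂ).holderL volume ∞ 2 2 hm.toLp

theorem mulL_ae {m : Rn n → ℂ} (hm : MemLp m ∞ (volume : Measure (Rn n))) (f : L2 n) :
    mulL hm f =ᵐ[volume] fun x ↦ m x * f x := by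
  have h := (ContinuousLinearMap.lsmul ℂ ℂ).coeFn_holder (r := 2) (hm.toLp) f
  filter_upwards [h, hm.coeFn_toLp] with x h1 h2
  refine h1.trans ?_
  simp [h2]

theorem coe_mulL {m : Rn n → ℂ} (hm : MemLp m ∞ (volume : Measure (Rn n)))
    (hg : m.HasTemperateGrowth) (f : L2 n) :
    (mulL hm f : 𝓢'(Rn n, ℂ)) = TemperedDistribution.smulLeftCLM ℂ m f :=
  Lp.toTemperedDistribution_smul_eq hg hm f

theorem memLp_top_dualWeight {s : ℝ} (hs : s ≤ 0) :
    MemLp (fun ξ : Rn n ↦ (dualWeight s ξ : ℂ)) ∞ volume := by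
  refine memLp_top_of_bound (contDiff_ofReal_dualWeight s).continuous.aestronglyMeasurable 1
    (ae_of_all _ fun ξ ↦ ?_)
  rw [Complex.norm_real, Real.norm_of_nonneg (dualWeight_pos _ _).le, ← dualWeight_zero ξ]
  exact dualWeight_mono hs ξ

theorem memLp_top_jap {δ : ℝ} (hδ : δ ≤ 0) :
    MemLp (fun x : Rn n ↦ (((1 + ‖x‖ ^ 2) ^ (δ / 2) : ℝ) : ℂ)) ∞ volume := by
  have hc : Continuous fun x : Rn n ↦ (((1 + ‖x‖ ^ 2) ^ (δ / 2) : ℝ) : ℂ) := by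
    refine Complex.continuous_ofReal.comp (Continuous.rpow_const (by fun_prop) fun x ↦ ?_)
    exact Or.inl (by positivity)
  refine memLp_top_of_bound hc.aestronglyMeasurable 1 (ae_of_all _ fun x ↦ ?_)
  rw [Complex.norm_real, Real.norm_of_nonneg (by positivity)]
  exact Real.rpow_le_one_of_one_le_of_nonpos (le_add_of_nonneg_right (by positivity)) (by linarith)

theorem toTemperedDistribution_injective :
    Function.Injective fun f : L2 n ↦ (f : 𝓢'(Rn n, ℂ)) :=
  LinearMap.ker_eq_bot.1 (Lp.ker_toTemperedDistributionCLM_eq_bot (F := ℂ)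
    (μ := (volume : Measure (Rn n))) (p := 2))

/-- The Fourier transform of `⟨D⟩^(-β) ⟨x⟩^(-2) g`. -/
def weightedFourier {β : ℝ} (hβ : 0 ≤ β) : L2 n →L[ℂ] L2 n :=
  (mulL (memLp_top_dualWeight (s := -(β / 2)) (by linarith))).comp
    ((Lp.fourierTransformₗᵢ (Rn n) ℂ).toContinuousLinearEquiv.toContinuousLinearMap.comp
      (mulL (memLp_top_jap (δ := -2) (by norm_num))))

theorem weightedFourier_apply {β : ℝ} (hβ : 0 ≤ β) (g : L2 n) :
    weightedFourier hβ g = mulL (memLp_top_dualWeight (s := -(β / 2)) (by linarith))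
      (𝓕 (mulL (memLp_top_jap (δ := -2) (by norm_num)) g) : L2 n) := rfl

/-! ### Sobolev norms on the Fourier side -/

theorem japX_neg_apply (δ : ℝ) (f : 𝓢'(Rn n, ℂ)) : japX (-δ) (japX δ f) = f := by
  unfold japX
  rw [TemperedDistribution.smulLeftCLM_smulLeftCLM_apply (hasTemperateGrowth_jap_rpow _)
    (hasTemperateGrowth_jap_rpow _)]
  have : ((fun x : Rn n ↦ (((1 + ‖x‖ ^ 2) ^ (δ / 2) : ℝ) : ℂ)) *
      fun x ↦ (((1 + ‖x‖ ^ 2) ^ (-δ / 2) : ℝ) : ℂ)) = fun _ ↦ 1 := by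
    ext x
    rw [Pi.mul_apply, ← Complex.ofReal_mul, ← Real.rpow_add (by positivity)]
    simp [neg_div]
  rw [this, TemperedDistribution.smulLeftCLM_const, one_smul]

theorem japX_zero (f : 𝓢'(Rn n, ℂ)) : japX 0 f = f := by
  simp [japX]

theorem fourier_japD (α : ℝ) (f : 𝓢'(Rn n, ℂ)) : 𝓕 (japD α f) =
    TemperedDistribution.smulLeftCLM ℂ (fun ξ : Rn n ↦ (dualWeight (α / 2) ξ : ℂ)) (𝓕 f) := by
  unfold japD
  rw [TemperedDistribution.fourierMultiplierCLM_apply, fourier_fourierInv_eq]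
  rfl

theorem smulLeft_dualWeight_comp (s t : ℝ) (f : 𝓢'(Rn n, ℂ)) :
    TemperedDistribution.smulLeftCLM ℂ (fun ξ : Rn n ↦ (dualWeight s ξ : ℂ))
      (TemperedDistribution.smulLeftCLM ℂ (fun ξ : Rn n ↦ (dualWeight t ξ : ℂ)) f) =
    TemperedDistribution.smulLeftCLM ℂ (fun ξ : Rn n ↦ (dualWeight (s + t) ξ : ℂ)) f := by
  rw [TemperedDistribution.smulLeftCLM_smulLeftCLM_apply (hasTemperateGrowth_dualWeight _)
    (hasTemperateGrowth_dualWeight _)]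
  congr 2
  ext ξ
  rw [Pi.mul_apply, ← Complex.ofReal_mul, dualWeight_mul, add_comm]

theorem smulLeft_dualWeight_zero (f : 𝓢'(Rn n, ℂ)) :
    TemperedDistribution.smulLeftCLM ℂ (fun ξ : Rn n ↦ (dualWeight 0 ξ : ℂ)) f = f := by
  simp [dualWeight_zero]

/-- Finiteness of the norm is used only in this form: q̂ is the image of an L² function under one
bounded operator, which is continuous on L² and explicit on Schwartz functions. Density arguments
thus run on g and not on q. -/
theorem fourier_eq_weightedFourier {β : ℝ} (hβ : 0 ≤ β) {q g : L2 n}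
    (h : (g : 𝓢'(Rn n, ℂ)) = japX 2 (japD β (q : 𝓢'(Rn n, ℂ)))) :
    (𝓕 q : L2 n) = weightedFourier hβ g := by
  apply toTemperedDistribution_injective
  beta_reduce
  rw [weightedFourier_apply, coe_mulL _ (hasTemperateGrowth_dualWeight _),
    ← Lp.fourier_toTemperedDistribution_eq, ← Lp.fourier_toTemperedDistribution_eq,
    coe_mulL _ (hasTemperateGrowth_jap_rpow _), h]
  have := japX_neg_apply 2 (japD β (q : 𝓢'(Rn n, ℂ)))
  rw [japX] at this
  rw [this, fourier_japD, smulLeft_dualWeight_comp, neg_add_cancel, smulLeft_dualWeight_zero]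

theorem sobolevNorm_eq {α δ : ℝ} {f : 𝓢'(Rn n, ℂ)} {g : L2 n}
    (h : (g : 𝓢'(Rn n, ℂ)) = japX δ (japD α f)) : sobolevNorm α δ f = ‖g‖ₑ := by
  refine le_antisymm (iInf₂_le g h) (le_iInf₂ fun g' h' ↦ ?_)
  rw [toTemperedDistribution_injective (h.trans h'.symm)]

theorem exists_of_sobolevNorm_lt_top {α δ : ℝ} {f : 𝓢'(Rn n, ℂ)} (h : sobolevNorm α δ f < ⊤) :
    ∃ g : L2 n, (g : 𝓢'(Rn n, ℂ)) = japX δ (japD α f) := by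
  by_contra! hne
  rw [sobolevNorm, iInf₂_eq_top.2 fun g hg ↦ absurd hg (hne g)] at h
  exact lt_irrefl _ h

/-- A distribution with a prescribed Fourier transform of finite weighted `L²` norm. -/
theorem exists_fourier_eq (a : ℝ) {m : Rn n → ℂ}
    (hm : MemLp (fun ξ ↦ (dualWeight (a / 2) ξ : ℂ) * m ξ) 2 volume) :
    ∃ u : 𝓢'(Rn n, ℂ), (∀ φ : 𝓢(Rn n, ℂ), Integrable (fun ξ ↦ φ ξ * m ξ) ∧
      𝓕 u φ = ∫ ξ, φ ξ * m ξ) ∧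
      sobolevNorm a 0 u = eLpNorm (fun ξ ↦ (dualWeight (a / 2) ξ : ℂ) * m ξ) 2 volume := by
  set G : L2 n := hm.toLp with hG
  refine ⟨japD (-a) ((𝓕⁻ G : L2 n) : 𝓢'(Rn n, ℂ)), fun φ ↦ ?_, ?_⟩
  · set ψ : 𝓢(Rn n, ℂ) :=
      SchwartzMap.smulLeftCLM ℂ (fun ξ : Rn n ↦ (dualWeight (-a / 2) ξ : ℂ)) φ with hψ
    have h1 : ∀ᵐ ξ, ψ ξ * G ξ = φ ξ * m ξ := by
      filter_upwards [hm.coeFn_toLp] with ξ hξ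
      rw [hG, hξ, hψ, SchwartzMap.smulLeftCLM_apply_apply (hasTemperateGrowth_dualWeight _)]
      have : (dualWeight (-a / 2) ξ : ℂ) * dualWeight (a / 2) ξ = 1 := by
        rw [← Complex.ofReal_mul, dualWeight_mul, neg_div, neg_add_cancel, dualWeight_zero,
          Complex.ofReal_one]
      rw [smul_eq_mul]
      linear_combination (φ ξ * m ξ) * this
    have h2 : Integrable fun ξ ↦ ψ ξ * G ξ := (ψ.memLp 2 volume).integrable_mul (Lp.memLp G)
    refine ⟨h2.congr h1, ?_⟩
    rw [fourier_japD, Lp.fourier_toTemperedDistribution_eq, fourier_fourierInv_eq,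
      TemperedDistribution.smulLeftCLM_apply_apply, ← integral_congr_ae h1]
    simp [hψ]
  · have h : ((𝓕⁻ G : L2 n) : 𝓢'(Rn n, ℂ)) =
        japX 0 (japD a (japD (-a) ((𝓕⁻ G : L2 n) : 𝓢'(Rn n, ℂ)))) := by
      rw [japX_zero]
      apply (FourierTransform.fourierEquiv ℂ 𝓢'(Rn n, ℂ)).injective
      change 𝓕 ((𝓕⁻ G : L2 n) : 𝓢'(Rn n, ℂ)) =
        𝓕 (japD a (japD (-a) ((𝓕⁻ G : L2 n) : 𝓢'(Rn n, ℂ))))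
      rw [fourier_japD, fourier_japD, smulLeft_dualWeight_comp, neg_div, add_neg_cancel,
        smulLeft_dualWeight_zero]
    rw [sobolevNorm_eq h]
    have h3 : ‖(𝓕⁻ G : L2 n)‖ₑ = ‖G‖ₑ := by
      rw [← ofReal_norm, ← ofReal_norm]
      congr 1
      exact (Lp.fourierTransformₗᵢ (Rn n) ℂ).symm.norm_map G
    rw [h3, Lp.enorm_def, hG]
    exact eLpNorm_congr_ae hm.coeFn_toLp

/-! ### Square integrability of jets of Schwartz functions -/

/-- The standard basis vector. -/
def stdVec (i : Fin n) : Rn n := EuclideanSpace.single i 1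

/-- The partial derivative of a Schwartz function. -/
abbrev coordDeriv (i : Fin n) (h : 𝓢(Rn n, ℂ)) : 𝓢(Rn n, ℂ) := ∂_{stdVec i} h

theorem norm_stdVec (i : Fin n) : ‖stdVec i‖ = 1 := by simp [stdVec]

theorem eq_sum_stdVec (x : Rn n) : x = ∑ i, x i • stdVec i := by
  ext j
  simp [stdVec, Finset.sum_apply, Pi.single_apply]

theorem opNorm_le_sum {F : Type*} [NormedAddCommGroup F] [NormedSpace ℝ F] (T : Rn n →L[ℝ] F) :
    ‖T‖ ≤ ∑ i, ‖T (stdVec i)‖ := by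
  refine T.opNorm_le_bound (by positivity) fun x ↦ ?_
  conv_lhs => rw [eq_sum_stdVec x, map_sum]
  rw [Finset.sum_mul]
  refine norm_sum_le_of_le _ fun i _ ↦ ?_
  rw [map_smul, norm_smul, mul_comm]
  exact mul_le_mul_of_nonneg_left (PiLp.norm_apply_le x i) (norm_nonneg _)

theorem jet_le_sum_lineDeriv (h : 𝓢(Rn n, ℂ)) (ξ : Rn n) :
    jet h ξ ≤ ‖h ξ‖ + ∑ i, ‖coordDeriv i h ξ‖ + ∑ i, ∑ j, ‖coordDeriv i (coordDeriv j h) ξ‖ := by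
  unfold jet
  have h1 : ‖fderiv ℝ h ξ‖ ≤ ∑ i, ‖coordDeriv i h ξ‖ := by
    refine (opNorm_le_sum _).trans (Finset.sum_le_sum fun i _ ↦ ?_)
    rw [SchwartzMap.lineDerivOp_apply_eq_fderiv]
  have hd : DifferentiableAt ℝ (fderiv ℝ h) ξ :=
    (((h.smooth 2).fderiv_right (m := 1) (by norm_num)).differentiable (by norm_num)) ξ
  have h2 : ‖fderiv ℝ (fderiv ℝ h) ξ‖ ≤ ∑ i, ∑ j, ‖coordDeriv i (coordDeriv j h) ξ‖ := by
    refine (opNorm_le_sum _).trans (Finset.sum_le_sum fun i _ ↦ ?_)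
    refine (opNorm_le_sum _).trans (Finset.sum_le_sum fun j _ ↦ ?_)
    rw [SchwartzMap.lineDerivOp_apply_eq_fderiv]
    have h3 : (⇑(coordDeriv j h)) = fun y ↦ fderiv ℝ h y (stdVec j) := by
      ext y; rw [SchwartzMap.lineDerivOp_apply_eq_fderiv]
    have h4 := (hd.hasFDerivAt.clm_apply (hasFDerivAt_const (stdVec j) ξ)).fderiv
    rw [h3, h4]
    simp
  linarith

theorem eLpNorm_jet_le {h : 𝓢(Rn n, ℂ)} {M : ℝ≥0∞} (h0 : eLpNorm h 2 volume ≤ M)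
    (h1 : ∀ i, eLpNorm (coordDeriv i h) 2 volume ≤ M)
    (h2 : ∀ i j, eLpNorm (coordDeriv i (coordDeriv j h)) 2 volume ≤ M) :
    eLpNorm (jet h) 2 volume ≤ (1 + n + n * n : ℝ≥0∞) * M := by
  have hae : ∀ p : 𝓢(Rn n, ℂ), AEStronglyMeasurable (fun ξ ↦ ‖p ξ‖) (volume : Measure (Rn n)) :=
    fun p ↦ p.continuous.norm.aestronglyMeasurable
  refine (eLpNorm_mono_real (g := fun ξ ↦ ‖h ξ‖ + ∑ i, ‖coordDeriv i h ξ‖ +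
      ∑ i, ∑ j, ‖coordDeriv i (coordDeriv j h) ξ‖) fun ξ ↦ ?_).trans ?_
  · rw [Real.norm_of_nonneg (jet_nonneg _ _)]
    exact jet_le_sum_lineDeriv h ξ
  have e1 : eLpNorm (fun ξ ↦ ∑ i, ‖(coordDeriv i h) ξ‖) 2 volume ≤ n * M := by
    have := eLpNorm_sum_le (μ := (volume : Measure (Rn n))) (p := 2) (s := Finset.univ)
      (f := fun i : Fin n ↦ fun ξ ↦ ‖(coordDeriv i h) ξ‖) (fun i _ ↦ hae _)
      (by norm_num)
    refine (le_of_eq (by congr 1; ext ξ; simp)).trans (this.trans ?_)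
    calc _ ≤ ∑ _i : Fin n, M := Finset.sum_le_sum fun i _ ↦ by rw [eLpNorm_norm]; exact h1 i
      _ = n * M := by simp
  have e2 : eLpNorm (fun ξ ↦ ∑ i, ∑ j, ‖(coordDeriv i (coordDeriv j h)) ξ‖) 2 volume ≤
      n * n * M := by
    have := eLpNorm_sum_le (μ := (volume : Measure (Rn n))) (p := 2) (s := Finset.univ)
      (f := fun k : Fin n × Fin n ↦ fun ξ ↦
        ‖(coordDeriv k.1 (coordDeriv k.2 h)) ξ‖) (fun i _ ↦ hae _) (by norm_num)
    refine (le_of_eq (by congr 1; ext ξ; simp [Fintype.sum_prod_type])).trans (this.trans ?_)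
    calc _ ≤ ∑ _k : Fin n × Fin n, M :=
          Finset.sum_le_sum fun i _ ↦ by rw [eLpNorm_norm]; exact h2 _ _
      _ = n * n * M := by simp
  have m1 : AEStronglyMeasurable (fun ξ ↦ ∑ i, ‖(coordDeriv i h) ξ‖)
      (volume : Measure (Rn n)) :=
    (continuous_finsetSum _ fun i _ ↦ (SchwartzMap.continuous _).norm).aestronglyMeasurable
  have m2 : AEStronglyMeasurable (fun ξ ↦ ∑ i, ∑ j,
      ‖(coordDeriv i (coordDeriv j h)) ξ‖) (volume : Measure (Rn n)) :=
    (continuous_finsetSum _ fun i _ ↦ continuous_finsetSum _ fun j _ ↦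
      (SchwartzMap.continuous _).norm).aestronglyMeasurable
  calc _ ≤ eLpNorm (fun ξ ↦ ‖h ξ‖) 2 volume +
        eLpNorm (fun ξ ↦ ∑ i, ‖(coordDeriv i h) ξ‖) 2 volume +
        eLpNorm (fun ξ ↦ ∑ i, ∑ j, ‖(coordDeriv i (coordDeriv j h)) ξ‖) 2 volume :=
        (eLpNorm_add_le ((hae h).add m1) m2 (by norm_num)).trans
          (add_le_add (eLpNorm_add_le (hae h) m1 (by norm_num)) le_rfl)
    _ ≤ M + n * M + n * n * M := by
        rw [eLpNorm_norm]
        exact add_le_add (add_le_add h0 e1) e2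
    _ = _ := by ring

theorem memLp_jet (h : 𝓢(Rn n, ℂ)) : MemLp (jet h) 2 (volume : Measure (Rn n)) := by
  refine ⟨(continuous_jet (h.smooth 2)).aestronglyMeasurable, ?_⟩
  set M : ℝ≥0∞ := eLpNorm h 2 volume + ∑ i, eLpNorm (coordDeriv i h) 2 volume +
    ∑ k : Fin n × Fin n, eLpNorm (coordDeriv k.1 (coordDeriv k.2 h)) 2 volume with hM
  have hMt : M < ⊤ := by
    refine ENNReal.add_lt_top.2 ⟨ENNReal.add_lt_top.2 ⟨h.eLpNorm_lt_top 2 volume, ?_⟩, ?_⟩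
    · exact ENNReal.sum_lt_top.2 fun i _ ↦ SchwartzMap.eLpNorm_lt_top _ 2 volume
    · exact ENNReal.sum_lt_top.2 fun i _ ↦ SchwartzMap.eLpNorm_lt_top _ 2 volume
  refine (eLpNorm_jet_le (M := M) ?_ (fun i ↦ ?_) fun i j ↦ ?_).trans_lt (ENNReal.mul_lt_top ?_ hMt)
  · rw [hM, add_assoc]; exact le_self_add
  · refine (Finset.single_le_sum (f := fun i ↦ eLpNorm (coordDeriv i h) 2 volume)
      (fun _ _ ↦ zero_le) (Finset.mem_univ i)).trans ?_
    rw [hM, add_comm (eLpNorm h 2 volume), add_assoc]; exact le_self_add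
  · refine (Finset.single_le_sum (f := fun k : Fin n × Fin n ↦
      eLpNorm (coordDeriv k.1 (coordDeriv k.2 h)) 2 volume)
      (fun _ _ ↦ zero_le) (Finset.mem_univ (i, j))).trans ?_
    rw [hM]; exact le_add_self
  · exact_mod_cast ENNReal.natCast_lt_top (1 + n + n * n)

theorem eLpNorm_fourier (f : 𝓢(Rn n, ℂ)) :
    eLpNorm (𝓕 f : 𝓢(Rn n, ℂ)) 2 volume = eLpNorm f 2 volume := by
  have h := SchwartzMap.norm_fourier_toL2_eq f
  rw [SchwartzMap.norm_toLp, SchwartzMap.norm_toLp] at h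
  exact (ENNReal.toReal_eq_toReal_iff' (SchwartzMap.eLpNorm_lt_top _ 2 volume).ne
    (SchwartzMap.eLpNorm_lt_top _ 2 volume).ne).1 h

/-- The Fourier transform of `⟨x⟩^(-2) g`. -/
def decayFourier (g : 𝓢(Rn n, ℂ)) : 𝓢(Rn n, ℂ) :=
  𝓕 (SchwartzMap.smulLeftCLM ℂ (fun x : Rn n ↦ (((1 + ‖x‖ ^ 2) ^ ((-2 : ℝ) / 2) : ℝ) : ℂ)) g)

theorem norm_decay_apply (g : 𝓢(Rn n, ℂ)) (x : Rn n) :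
    ‖SchwartzMap.smulLeftCLM ℂ (fun x : Rn n ↦ (((1 + ‖x‖ ^ 2) ^ ((-2 : ℝ) / 2) : ℝ) : ℂ)) g x‖ =
      (1 + ‖x‖ ^ 2)⁻¹ * ‖g x‖ := by
  rw [SchwartzMap.smulLeftCLM_apply_apply (hasTemperateGrowth_jap_rpow _), norm_smul,
    Complex.norm_real, Real.norm_of_nonneg (by positivity)]
  norm_num [Real.rpow_neg_one]

theorem norm_mulInner_apply (g : 𝓢(Rn n, ℂ)) (m x : Rn n) :
    ‖(-(2 * Real.pi * Complex.I) • SchwartzMap.smulLeftCLM ℂ (inner ℝ · m) g : 𝓢(Rn n, ℂ)) x‖ =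
      2 * Real.pi * |inner ℝ x m| * ‖g x‖ := by
  rw [smul_apply, SchwartzMap.smulLeftCLM_apply_apply (by fun_prop), norm_smul,
    norm_smul]
  simp [abs_of_pos Real.pi_pos]
  ring

/-- Each derivative of the transform brings down a factor −2πi x_j, and ⟨x⟩^(-2) absorbs two of
them; Plancherel does the rest. This is the role of the weight exponent 2. -/
theorem eLpNorm_jet_decayFourier_le (g : 𝓢(Rn n, ℂ)) :
    eLpNorm (jet (decayFourier g)) 2 volume ≤
      (1 + n + n * n : ℝ≥0∞) * (ENNReal.ofReal ((2 * Real.pi) ^ 2) * eLpNorm g 2 volume) := by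
  have hπ : 1 ≤ 2 * Real.pi := by linarith [Real.pi_gt_three]
  have hπ2 : 2 * Real.pi ≤ (2 * Real.pi) ^ 2 := by nlinarith
  have key : ∀ F : 𝓢(Rn n, ℂ), (∀ x, ‖F x‖ ≤ (2 * Real.pi) ^ 2 * ‖g x‖) →
      eLpNorm (𝓕 F : 𝓢(Rn n, ℂ)) 2 volume ≤
        ENNReal.ofReal ((2 * Real.pi) ^ 2) * eLpNorm g 2 volume := fun F hF ↦ by
    rw [eLpNorm_fourier]
    exact eLpNorm_le_mul_eLpNorm_of_ae_le_mul (ae_of_all _ hF) 2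
  have hin : ∀ (i : Fin n) (x : Rn n), |inner ℝ x (stdVec i)| ≤ ‖x‖ := fun i x ↦ by
    simpa [norm_stdVec] using abs_real_inner_le_norm x (stdVec i)
  refine eLpNorm_jet_le (key _ fun x ↦ ?_) (fun i ↦ ?_) fun i j ↦ ?_
  · rw [norm_decay_apply]
    gcongr
    refine (inv_le_one_of_one_le₀ (by nlinarith [sq_nonneg ‖x‖])).trans (by nlinarith)
  · rw [coordDeriv, decayFourier, SchwartzMap.lineDerivOp_fourier_eq]
    refine key _ fun x ↦ ?_
    rw [norm_mulInner_apply, norm_decay_apply, ← mul_assoc]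
    gcongr
    rw [← div_eq_mul_inv, div_le_iff₀ (by positivity)]
    refine mul_le_mul hπ2 ((hin i x).trans ?_) (abs_nonneg _) (by positivity)
    nlinarith [sq_nonneg (‖x‖ - 1), sq_nonneg ‖x‖]
  · rw [coordDeriv, coordDeriv, decayFourier, SchwartzMap.lineDerivOp_fourier_eq, SchwartzMap.lineDerivOp_fourier_eq]
    refine key _ fun x ↦ ?_
    rw [norm_mulInner_apply, norm_mulInner_apply, norm_decay_apply, ← mul_assoc, ← mul_assoc]
    gcongr
    rw [← div_eq_mul_inv, div_le_iff₀ (by positivity)]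
    have h1 : |inner ℝ x (stdVec i)| * |inner ℝ x (stdVec j)| ≤ 1 + ‖x‖ ^ 2 :=
      (mul_le_mul (hin i x) (hin j x) (abs_nonneg _) (norm_nonneg _)).trans (by nlinarith)
    calc _ = (2 * Real.pi) ^ 2 * (|inner ℝ x (stdVec i)| * |inner ℝ x (stdVec j)|) := by ring
      _ ≤ _ := mul_le_mul_of_nonneg_left h1 (by positivity)

/-! ### The uniform bounds for Schwartz functions -/

/-- The Fourier transform of `⟨D⟩^(-β) ⟨x⟩^(-2) g` for a Schwartz function `g`. -/
def schwartzFourier (β : ℝ) (g : 𝓢(Rn n, ℂ)) : 𝓢(Rn n, ℂ) :=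
  SchwartzMap.smulLeftCLM ℂ (fun ξ : Rn n ↦ (dualWeight (-(β / 2)) ξ : ℂ)) (decayFourier g)

theorem schwartzFourier_apply (β : ℝ) (g : 𝓢(Rn n, ℂ)) (ξ : Rn n) :
    schwartzFourier β g ξ = (dualWeight (-(β / 2)) ξ : ℂ) * decayFourier g ξ := by
  rw [schwartzFourier, SchwartzMap.smulLeftCLM_apply_apply (hasTemperateGrowth_dualWeight _),
    smul_eq_mul]

theorem weightedFourier_toLp {β : ℝ} (hβ : 0 ≤ β) (g : 𝓢(Rn n, ℂ)) :
    weightedFourier hβ (g.toLp 2) =ᵐ[volume] schwartzFourier β g := by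
  have h1 : mulL (memLp_top_jap (δ := -2) (by norm_num)) (g.toLp 2 : L2 n) =
      (SchwartzMap.smulLeftCLM ℂ
        (fun x : Rn n ↦ (((1 + ‖x‖ ^ 2) ^ ((-2 : ℝ) / 2) : ℝ) : ℂ)) g).toLp 2 := by
    refine Lp.ext ?_
    filter_upwards [mulL_ae (memLp_top_jap (n := n) (δ := -2) (by norm_num)) (g.toLp 2),
      g.coeFn_toLp 2 volume, SchwartzMap.coeFn_toLp (SchwartzMap.smulLeftCLM ℂ
        (fun x : Rn n ↦ (((1 + ‖x‖ ^ 2) ^ ((-2 : ℝ) / 2) : ℝ) : ℂ)) g) 2 volume] with x h1 h2 h3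
    rw [h1, h2, h3, SchwartzMap.smulLeftCLM_apply_apply (hasTemperateGrowth_jap_rpow _),
      smul_eq_mul]
  rw [weightedFourier_apply, h1, SchwartzMap.toLp_fourier_eq]
  filter_upwards [mulL_ae (memLp_top_dualWeight (n := n) (s := -(β / 2)) (by linarith))
    ((decayFourier g).toLp 2), (decayFourier g).coeFn_toLp 2 volume] with x h2 h3
  refine h2.trans ?_
  rw [h3, schwartzFourier_apply]

theorem exists_jet_schwartzFourier_le {β : ℝ} (hβ : 0 ≤ β) : ∃ C : ℝ, 0 ≤ C ∧
    ∀ (g : 𝓢(Rn n, ℂ)) (ξ : Rn n),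
      jet (schwartzFourier β g) ξ ≤ C * (jap ξ ^ (-β) * jet (decayFourier g) ξ) := by
  obtain ⟨C, hC, h⟩ := exists_jet_dualWeight_le (n := n) (-(β / 2))
  refine ⟨2 * C, by positivity, fun g ξ ↦ ?_⟩
  have h1 : (⇑(schwartzFourier β g) : Rn n → ℂ) =
      fun ξ ↦ (dualWeight (-(β / 2)) ξ : ℂ) * decayFourier g ξ := by
    ext ξ; rw [schwartzFourier_apply]
  rw [h1]
  refine (jet_mul_le ((contDiff_ofReal_dualWeight _).of_le (by norm_cast))
    ((decayFourier g).smooth 2) ξ).trans ?_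
  have h2 := jet_nonneg (decayFourier g) ξ
  calc _ ≤ 2 * (C * jap ξ ^ (-β)) * jet (decayFourier g) ξ := by
        gcongr
        exact (h ξ).trans (mul_le_mul_of_nonneg_left (dualWeight_le_jap hβ ξ) hC)
    _ = _ := by ring

theorem resForm_congr {κ ε : ℝ} {v w : Rn n} {f f' g g' : Rn n → ℂ} (hf : f =ᵐ[volume] f')
    (hg : g =ᵐ[volume] g') : resForm κ ε v w f g = resForm κ ε v w f' g' := by
  refine integral_congr_ae ?_
  filter_upwards [(Measure.measurePreserving_sub_left volume w).quasiMeasurePreserving.ae_eq_comp hf,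
    (measurePreserving_sub_right volume v).quasiMeasurePreserving.ae_eq_comp hg] with ξ h1 h2
  simp only [Function.comp_apply] at h1 h2
  rw [h1, h2]

theorem integrable_mul_sub {f g : Rn n → ℝ} (hf : MemLp f 2 volume) (hg : MemLp g 2 volume)
    (v w : Rn n) : Integrable fun ξ ↦ f (w - ξ) * g (ξ - v) :=
  (hf.comp_measurePreserving (Measure.measurePreserving_sub_left volume w)).integrable_mul
    (hg.comp_measurePreserving (measurePreserving_sub_right volume v))

/-- The pointwise form of the estimate for Schwartz functions. -/
theorem exists_enorm_resForm_le (hn : 2 ≤ n) {β κ₀ : ℝ} (hβ : 0 ≤ β) (hκ₀ : 0 < κ₀) :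
    ∃ C : ℝ, 0 ≤ C ∧ ∀ (κ ε : ℝ) (v w : Rn n) (g₁ g₂ : 𝓢(Rn n, ℂ)), κ₀ ≤ κ → 0 < ε →
      ‖resForm κ ε v w (schwartzFourier β g₁) (schwartzFourier β g₂)‖ₑ ≤ ENNReal.ofReal C *
        ∫⁻ ξ, ENNReal.ofReal (jet (decayFourier g₁) (w - ξ) * jet (decayFourier g₂) (ξ - v)) *
          ENNReal.ofReal (kerK κ ‖ξ‖ * (jap (w - ξ) ^ (-β) * jap (ξ - v) ^ (-β))) := by
  obtain ⟨C₁, hC₁, h₁⟩ := exists_norm_integral_res_le hn hκ₀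
  obtain ⟨C₂, hC₂, h₂⟩ := exists_jet_schwartzFourier_le (n := n) hβ
  refine ⟨C₁ * (2 * C₂ ^ 2), by positivity, fun κ ε v w g₁ g₂ hκ hε ↦ ?_⟩
  have hκ0 := hκ₀.trans_le hκ
  set p₁ := schwartzFourier β g₁
  set p₂ := schwartzFourier β g₂
  set f : Rn n → ℂ := fun ξ ↦ p₁ (w - ξ) * p₂ (ξ - v) with hf
  have hp₁ : ContDiff ℝ 2 p₁ := p₁.smooth 2
  have hp₂ : ContDiff ℝ 2 p₂ := p₂.smooth 2
  have hfc : ContDiff ℝ 2 f := by rw [hf]; fun_prop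
  have hfj : ∀ ξ, jet f ξ ≤ 2 * jet p₁ (w - ξ) * jet p₂ (ξ - v) :=
    jet_mul_sub_le hp₁ hp₂ v w
  have hfi : Integrable (jet f) := by
    refine ((integrable_mul_sub (memLp_jet p₁) (memLp_jet p₂) v w).const_mul 2).mono'
      (continuous_jet hfc).aestronglyMeasurable (ae_of_all _ fun ξ ↦ ?_)
    rw [Real.norm_of_nonneg (jet_nonneg _ _), ← mul_assoc]
    exact hfj ξ
  have hK : ∀ ξ : Rn n, 0 ≤ kerK κ ‖ξ‖ := fun ξ ↦ kerK_nonneg hκ0 (norm_nonneg _)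
  have hmain := h₁ κ hκ f hfc hfi ε hε
  rw [← ofReal_norm]
  refine (ENNReal.ofReal_le_ofReal hmain).trans ?_
  rw [ENNReal.ofReal_mul hC₁, ENNReal.ofReal_mul hC₁, mul_assoc]
  gcongr
  rw [ofReal_integral_eq_lintegral_ofReal (integrable_mul_kerK hfi hκ0)
    (ae_of_all _ fun ξ ↦ mul_nonneg (jet_nonneg _ _) (hK ξ)), ← lintegral_const_mul']
  · refine lintegral_mono fun ξ ↦ ?_
    have a1 := jet_nonneg (decayFourier g₁) (w - ξ)
    have a2 := jet_nonneg (decayFourier g₂) (ξ - v)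
    have j1 := jap_pos (w - ξ)
    have j2 := jap_pos (ξ - v)
    rw [← ENNReal.ofReal_mul (by positivity), ← ENNReal.ofReal_mul (by positivity)]
    refine ENNReal.ofReal_le_ofReal ?_
    calc jet f ξ * kerK κ ‖ξ‖ ≤ (2 * (C₂ * (jap (w - ξ) ^ (-β) * jet (decayFourier g₁) (w - ξ))) *
          (C₂ * (jap (ξ - v) ^ (-β) * jet (decayFourier g₂) (ξ - v)))) * kerK κ ‖ξ‖ := by
          refine mul_le_mul_of_nonneg_right ((hfj ξ).trans ?_) (hK ξ)
          exact mul_le_mul (mul_le_mul_of_nonneg_left (h₂ _ _) (by norm_num)) (h₂ _ _)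
            (jet_nonneg _ _) (by positivity)
      _ = _ := by ring
  · exact ENNReal.ofReal_ne_top

theorem sq_lintegral_mul_le {α : Type*} [MeasurableSpace α] {μ : Measure α} {f g : α → ℝ≥0∞}
    (hf : AEMeasurable f μ) (hg : AEMeasurable g μ) :
    (∫⁻ x, f x * g x ∂μ) ^ 2 ≤ (∫⁻ x, f x ^ 2 ∂μ) * ∫⁻ x, g x ^ 2 ∂μ := by
  have h := ENNReal.lintegral_mul_le_Lp_mul_Lq μ Real.HolderConjugate.two_two hf hg
  simp only [Pi.mul_apply, ENNReal.rpow_two] at h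
  calc _ ≤ ((∫⁻ x, f x ^ 2 ∂μ) ^ (1 / (2 : ℝ)) * (∫⁻ x, g x ^ 2 ∂μ) ^ (1 / (2 : ℝ))) ^ 2 := by
        gcongr
    _ = _ := by
        rw [mul_pow, ← ENNReal.rpow_natCast, ← ENNReal.rpow_natCast, ← ENNReal.rpow_mul,
          ← ENNReal.rpow_mul]
        norm_num

theorem lintegral_sq_eq {f : Rn n → ℝ} (hf : ∀ x, 0 ≤ f x) :
    ∫⁻ x, ENNReal.ofReal (f x) ^ 2 = eLpNorm f 2 volume ^ 2 := by
  rw [eLpNorm_eq_lintegral_rpow_enorm_toReal (by norm_num) (by norm_num)]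
  rw [← ENNReal.rpow_natCast, ← ENNReal.rpow_mul]
  norm_num
  refine lintegral_congr fun x ↦ ?_
  rw [← ofReal_norm, Real.norm_of_nonneg (hf x)]

/-- A crude companion of the main estimate without decay in w − v: the kernel is at most κ₀⁻¹ and
the jets are handled by Cauchy–Schwarz. It is bilinear and uniform in ε, which is what density
arguments need. -/
theorem exists_enorm_resForm_le_mul (hn : 2 ≤ n) {β κ₀ : ℝ} (hβ : 0 ≤ β) (hκ₀ : 0 < κ₀) :
    ∃ C : ℝ≥0, ∀ (κ ε : ℝ) (v w : Rn n) (g₁ g₂ : 𝓢(Rn n, ℂ)), κ₀ ≤ κ → 0 < ε →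
      ‖resForm κ ε v w (schwartzFourier β g₁) (schwartzFourier β g₂)‖ₑ ≤
        C * (eLpNorm g₁ 2 volume * eLpNorm g₂ 2 volume) := by
  obtain ⟨C, hC, h⟩ := exists_enorm_resForm_le hn hβ hκ₀
  set D : ℝ≥0 := (1 + n + n * n) * Real.toNNReal ((2 * Real.pi) ^ 2) with hD
  have hD' : ∀ g : 𝓢(Rn n, ℂ), eLpNorm (jet (decayFourier g)) 2 volume ≤ D * eLpNorm g 2 volume :=
    fun g ↦ (eLpNorm_jet_decayFourier_le g).trans (le_of_eq (by
      rw [hD]; push_cast; rw [mul_assoc]; rfl))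
  refine ⟨C.toNNReal * (κ₀⁻¹).toNNReal * D ^ 2, fun κ ε v w g₁ g₂ hκ hε ↦
    (h κ ε v w g₁ g₂ hκ hε).trans ?_⟩
  have hκ0 := hκ₀.trans_le hκ
  have c1 := continuous_jet ((decayFourier g₁).smooth 2)
  have c2 := continuous_jet ((decayFourier g₂).smooth 2)
  have hle : ∫⁻ ξ, ENNReal.ofReal (jet (decayFourier g₁) (w - ξ) * jet (decayFourier g₂) (ξ - v)) *
      ENNReal.ofReal (kerK κ ‖ξ‖ * (jap (w - ξ) ^ (-β) * jap (ξ - v) ^ (-β))) ≤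
      ENNReal.ofReal κ₀⁻¹ * ∫⁻ ξ, ENNReal.ofReal (jet (decayFourier g₁) (w - ξ)) *
        ENNReal.ofReal (jet (decayFourier g₂) (ξ - v)) := by
    rw [← lintegral_const_mul' _ _ ENNReal.ofReal_ne_top]
    refine lintegral_mono fun ξ ↦ ?_
    rw [← ENNReal.ofReal_mul (jet_nonneg _ _), mul_comm]
    gcongr
    have hj : ∀ x : Rn n, jap x ^ (-β) ≤ 1 := fun x ↦
      Real.rpow_le_one_of_one_le_of_nonpos (one_le_jap x) (by linarith)
    have hj0 : ∀ x : Rn n, 0 ≤ jap x ^ (-β) := fun x ↦ Real.rpow_nonneg (jap_pos x).le _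
    calc _ ≤ κ⁻¹ * (1 * 1) := mul_le_mul (kerK_le hκ0 (norm_nonneg _))
          (mul_le_mul (hj _) (hj _) (hj0 _) zero_le_one) (mul_nonneg (hj0 _) (hj0 _))
          (by positivity)
      _ ≤ κ₀⁻¹ := by rw [mul_one, mul_one]; exact inv_anti₀ hκ₀ hκ
  have hcs : ∫⁻ ξ, ENNReal.ofReal (jet (decayFourier g₁) (w - ξ)) *
        ENNReal.ofReal (jet (decayFourier g₂) (ξ - v)) ≤
      eLpNorm (jet (decayFourier g₁)) 2 volume * eLpNorm (jet (decayFourier g₂)) 2 volume := by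
    rw [← ENNReal.pow_le_pow_left_iff two_ne_zero]
    refine (sq_lintegral_mul_le ?_ ?_).trans ?_
    · exact (c1.comp (continuous_const.sub continuous_id)).measurable.ennreal_ofReal.aemeasurable
    · exact (c2.comp (continuous_id.sub continuous_const)).measurable.ennreal_ofReal.aemeasurable
    · rw [lintegral_sub_left_eq_self
        (fun ξ ↦ ENNReal.ofReal (jet (decayFourier g₁) ξ) ^ 2),
        lintegral_sub_right_eq_self (fun ξ ↦ ENNReal.ofReal (jet (decayFourier g₂) ξ) ^ 2),
        lintegral_sq_eq (jet_nonneg _), lintegral_sq_eq (jet_nonneg _), mul_pow]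
  calc _ ≤ ENNReal.ofReal C * (ENNReal.ofReal κ₀⁻¹ *
        ((D * eLpNorm g₁ 2 volume) * (D * eLpNorm g₂ 2 volume))) := by
        gcongr
        exact hle.trans (mul_le_mul_right (hcs.trans (mul_le_mul' (hD' _) (hD' _))) _)
    _ = _ := by
        push_cast
        simp only [ENNReal.ofReal]
        ring

/-- Cauchy–Schwarz separates the kernel with its brackets from the jets. The former yields the decay
in w − v, the latter a convolution of squares evaluated at w − v, because a translation by v removes
the separate dependence on v. -/
theorem exists_sq_enorm_resForm_le (hn : 2 ≤ n) {α β κ₀ : ℝ} (hβ : 0 ≤ β) (hκ₀ : 0 < κ₀)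
    (h : ((n : ℝ) - 3) / 2 < β ∧ β < ((n : ℝ) - 1) / 2 ∧ α < 2 * β - ((n : ℝ) - 3) / 2 ∨
        ((n : ℝ) - 1) / 2 ≤ β ∧ α < β + 1) :
    ∃ C : ℝ≥0∞, C < ⊤ ∧ ∀ (κ ε : ℝ) (v w : Rn n) (g : 𝓢(Rn n, ℂ)), κ₀ ≤ κ → 0 < ε → ‖v‖ = κ →
      ‖w - v‖ ≤ κ →
      ‖resForm κ ε v w (schwartzFourier β g) (schwartzFourier β g)‖ₑ ^ 2 ≤
        C * (ENNReal.ofReal (jap (w - v) ^ (-(2 * α))) *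
          ∫⁻ ξ, ENNReal.ofReal (jet (decayFourier g) (w - v - ξ)) ^ 2 *
            ENNReal.ofReal (jet (decayFourier g) ξ) ^ 2) := by
  obtain ⟨C₁, hC₁, h₁⟩ := exists_enorm_resForm_le hn hβ hκ₀
  obtain ⟨C₂, hC₂, h₂⟩ := exists_lintegral_kerK_le (by omega) hβ h hκ₀
  refine ⟨ENNReal.ofReal C₁ ^ 2 * C₂, ENNReal.mul_lt_top (by simp) hC₂,
    fun κ ε v w g hκ hε hv hwv ↦ ?_⟩
  have hκ0 := hκ₀.trans_le hκ
  have c1 := continuous_jet ((decayFourier g).smooth 2)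
  have j1 := continuous_jap_rpow (E := Rn n) (-β)
  have hk := continuous_kerK (n := n) hκ0
  refine (pow_le_pow_left' (h₁ κ ε v w g g hκ hε) 2).trans ?_
  rw [mul_pow, mul_assoc]
  gcongr
  refine (sq_lintegral_mul_le ?_ ?_).trans ?_
  · refine (Continuous.measurable ?_).ennreal_ofReal.aemeasurable
    exact (c1.comp (continuous_const.sub continuous_id)).mul
      (c1.comp (continuous_id.sub continuous_const))
  · refine (Continuous.measurable ?_).ennreal_ofReal.aemeasurable
    exact hk.mul ((j1.comp (continuous_const.sub continuous_id)).mul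
      (j1.comp (continuous_id.sub continuous_const)))
  · have e1 : ∫⁻ ξ, ENNReal.ofReal (jet (decayFourier g) (w - ξ) *
          jet (decayFourier g) (ξ - v)) ^ 2 = ∫⁻ ξ, ENNReal.ofReal
          (jet (decayFourier g) (w - v - ξ)) ^ 2 * ENNReal.ofReal (jet (decayFourier g) ξ) ^ 2 := by
      rw [← lintegral_add_right_eq_self _ v]
      refine lintegral_congr fun ξ ↦ ?_
      rw [ENNReal.ofReal_mul (jet_nonneg _ _), mul_pow, add_sub_cancel_right, add_comm ξ v, sub_sub]
    have e2 : ∫⁻ ξ, ENNReal.ofReal (kerK κ ‖ξ‖ * (jap (w - ξ) ^ (-β) * jap (ξ - v) ^ (-β))) ^ 2 =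
        ∫⁻ ξ, ENNReal.ofReal (kerK κ ‖ξ‖ ^ 2 *
          (jap (w - ξ) ^ (-(2 * β)) * jap (ξ - v) ^ (-(2 * β)))) := by
      refine lintegral_congr fun ξ ↦ ?_
      have hk := kerK_nonneg hκ0 (norm_nonneg ξ)
      have hp : ∀ x : Rn n, (jap x ^ (-β)) ^ 2 = jap x ^ (-(2 * β)) := fun x ↦ by
        rw [← Real.rpow_natCast, ← Real.rpow_mul (jap_pos x).le]; congr 1; push_cast; ring
      have p1 := jap_pos (w - ξ)
      have p2 := jap_pos (ξ - v)
      rw [← ENNReal.ofReal_pow (by positivity), mul_pow, mul_pow, hp, hp]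
    rw [e1, e2, mul_comm, ← mul_assoc]
    gcongr
    exact h₂ κ v w hκ hv hwv

/-! ### The bilinear form on `L²` -/

theorem L2.integrable_resForm (κ : ℝ) {ε : ℝ} (hε : 0 < ε) (v w : Rn n) (f g : L2 n) :
    Integrable fun ξ ↦ f (w - ξ) * g (ξ - v) * res κ ε ‖ξ‖ :=
  integrable_mul_res ((L2.comp_sub_left_ae f w).integrable_mul (L2.comp_sub_right_ae g v)) κ hε

/-- The constant blows up as ε → 0; the bound only provides continuity on L² for a fixed ε. -/
theorem L2.norm_resForm_le (κ : ℝ) {ε : ℝ} (hε : 0 < ε) (v w : Rn n) (f g : L2 n) :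
    ‖resForm κ ε v w f g‖ ≤ ε⁻¹ * ‖f‖ * ‖g‖ := by
  have hf := L2.comp_sub_left_ae f w
  have hg := L2.comp_sub_right_ae g v
  have h1 : ‖resForm κ ε v w f g‖ₑ ≤ ENNReal.ofReal ε⁻¹ * (‖f‖ₑ * ‖g‖ₑ) := by
    refine (enorm_integral_le_lintegral_enorm _).trans ?_
    calc ∫⁻ ξ, ‖f (w - ξ) * g (ξ - v) * res κ ε ‖ξ‖‖ₑ
        ≤ ∫⁻ ξ, ENNReal.ofReal ε⁻¹ * (‖f (w - ξ)‖ₑ * ‖g (ξ - v)‖ₑ) := by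
          refine lintegral_mono fun ξ ↦ ?_
          rw [enorm_mul, enorm_mul, mul_comm]
          gcongr
          rw [← ofReal_norm]
          exact ENNReal.ofReal_le_ofReal (norm_res_le_inv_eps κ hε _)
      _ = ENNReal.ofReal ε⁻¹ * ∫⁻ ξ, ‖f (w - ξ)‖ₑ * ‖g (ξ - v)‖ₑ :=
          lintegral_const_mul' _ _ ENNReal.ofReal_ne_top
      _ ≤ _ := by
          gcongr
          rw [← ENNReal.pow_le_pow_left_iff two_ne_zero]
          refine (sq_lintegral_mul_le hf.1.enorm hg.1.enorm).trans (le_of_eq ?_)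
          rw [lintegral_sub_left_eq_self (fun ξ ↦ ‖f ξ‖ₑ ^ 2),
            lintegral_sub_right_eq_self (fun ξ ↦ ‖g ξ‖ₑ ^ 2), mul_pow]
          have key : ∀ f : L2 n, ∫⁻ ξ, ‖f ξ‖ₑ ^ 2 = ‖f‖ₑ ^ 2 := fun f ↦ by
            rw [Lp.enorm_def, eLpNorm_eq_lintegral_rpow_enorm_toReal (by norm_num) (by norm_num),
              ← ENNReal.rpow_natCast, ← ENNReal.rpow_mul]
            norm_num
          rw [key, key]
  rw [← ofReal_norm, ← ofReal_norm f, ← ofReal_norm g, ← ENNReal.ofReal_mul (norm_nonneg _),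
    ← ENNReal.ofReal_mul (by positivity), ENNReal.ofReal_le_ofReal_iff (by positivity)] at h1
  rwa [mul_assoc]

/-- `resForm` as a bounded bilinear form on `L²`. -/
def resFormL (κ : ℝ) {ε : ℝ} (hε : 0 < ε) (v w : Rn n) : L2 n →L[ℂ] L2 n →L[ℂ] ℂ :=
  LinearMap.mkContinuous₂ (LinearMap.mk₂ ℂ (fun f g : L2 n ↦ resForm κ ε v w f g)
    (fun f f' g ↦ by
      rw [resForm_congr (Lp.coeFn_add f f') (ae_eq_refl _), resForm, resForm, resForm,
        ← integral_add (L2.integrable_resForm κ hε v w f g) (L2.integrable_resForm κ hε v w f' g)]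
      congr 1; ext ξ; simp only [Pi.add_apply]; ring)
    (fun c f g ↦ by
      rw [resForm_congr (Lp.coeFn_smul c f) (ae_eq_refl _), resForm, resForm, smul_eq_mul,
        ← integral_const_mul]
      congr 1; ext ξ; simp only [Pi.smul_apply, smul_eq_mul]; ring)
    (fun f g g' ↦ by
      rw [resForm_congr (ae_eq_refl _) (Lp.coeFn_add g g'), resForm, resForm, resForm,
        ← integral_add (L2.integrable_resForm κ hε v w f g) (L2.integrable_resForm κ hε v w f g')]
      congr 1; ext ξ; simp only [Pi.add_apply]; ring)
    (fun c f g ↦ by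
      rw [resForm_congr (ae_eq_refl _) (Lp.coeFn_smul c g), resForm, resForm, smul_eq_mul,
        ← integral_const_mul]
      congr 1; ext ξ; simp only [Pi.smul_apply, smul_eq_mul]; ring))
    ε⁻¹ (L2.norm_resForm_le κ hε v w)

theorem resFormL_apply (κ : ℝ) {ε : ℝ} (hε : 0 < ε) (v w : Rn n) (f g : L2 n) :
    resFormL κ hε v w f g = resForm κ ε v w f g := rfl

/-- For fixed ε both sides are continuous in the pair, so the ε-uniform bound extends from the dense
Schwartz functions. -/
theorem exists_norm_resFormL_le (hn : 2 ≤ n) {β κ₀ : ℝ} (hβ : 0 ≤ β) (hκ₀ : 0 < κ₀) :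
    ∃ C : ℝ, 0 ≤ C ∧ ∀ (κ ε : ℝ) (v w : Rn n) (g₁ g₂ : L2 n), κ₀ ≤ κ → ∀ hε : 0 < ε,
      ‖resFormL κ hε v w (weightedFourier hβ g₁) (weightedFourier hβ g₂)‖ ≤ C * ‖g₁‖ * ‖g₂‖ := by
  obtain ⟨C, h⟩ := exists_enorm_resForm_le_mul hn hβ hκ₀
  refine ⟨C, C.2, fun κ ε v w g₁ g₂ hκ hε ↦ ?_⟩
  have hd := SchwartzMap.denseRange_toLpCLM (E := Rn n) (F := ℂ) (p := 2)
    (μ := (volume : Measure (Rn n))) ENNReal.ofNat_ne_top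
  refine hd.induction_on₂ (p := fun g₁ g₂ : L2 n ↦ ‖resFormL κ hε v w (weightedFourier hβ g₁)
    (weightedFourier hβ g₂)‖ ≤ C * ‖g₁‖ * ‖g₂‖) ?_ (fun φ ψ ↦ ?_) g₁ g₂
  · refine isClosed_le ?_ (by fun_prop)
    exact ((((resFormL κ hε v w).continuous.comp
      ((weightedFourier hβ).continuous.comp continuous_fst))).clm_apply
      ((weightedFourier hβ).continuous.comp continuous_snd)).norm
  · have h1 := h κ ε v w φ ψ hκ hε
    rw [SchwartzMap.toLpCLM_apply, SchwartzMap.toLpCLM_apply, resFormL_apply,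
      resForm_congr (weightedFourier_toLp hβ φ) (weightedFourier_toLp hβ ψ),
      SchwartzMap.norm_toLp, SchwartzMap.norm_toLp]
    have h2 := ENNReal.toReal_mono (ENNReal.mul_ne_top ENNReal.coe_ne_top (ENNReal.mul_ne_top
      (φ.eLpNorm_lt_top 2 volume).ne (ψ.eLpNorm_lt_top 2 volume).ne)) h1
    rw [ENNReal.toReal_mul, ENNReal.toReal_mul, ← mul_assoc, toReal_enorm] at h2
    exact h2

/-! ### Passage from Schwartz functions to L² and to ε → 0 -/

theorem exists_tendsto_of_approx {l : Filter ℝ} [NeBot l] {F : ℝ → ℂ}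
    (h : ∀ δ > 0, ∃ (G : ℝ → ℂ) (L : ℂ), Tendsto G l (𝓝 L) ∧ ∀ᶠ ε in l, ‖F ε - G ε‖ ≤ δ) :
    ∃ L, Tendsto F l (𝓝 L) := by
  refine cauchy_map_iff_exists_tendsto.1 (Metric.cauchy_iff.2 ⟨inferInstance, fun δ hδ ↦ ?_⟩)
  obtain ⟨G, L, hG, hFG⟩ := h (δ / 5) (by positivity)
  have h1 : ∀ᶠ ε in l, dist (G ε) L < δ / 5 := Metric.tendsto_nhds.1 hG _ (by positivity)
  refine ⟨Metric.closedBall L (2 * δ / 5), mem_map.2 ?_, fun x hx y hy ↦ ?_⟩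
  · filter_upwards [h1, hFG] with ε h2 h3
    rw [Set.mem_preimage, Metric.mem_closedBall]
    have := dist_triangle (F ε) (G ε) L
    rw [dist_eq_norm (F ε) (G ε)] at this
    linarith
  · rw [Metric.mem_closedBall] at hx hy
    have := dist_triangle_right x y L
    linarith

theorem sub_quadratic {B : L2 n →L[ℂ] L2 n →L[ℂ] ℂ} (g g' : L2 n) :
    B g g - B g' g' = B (g - g') g + B g' (g - g') := by
  simp [map_sub]

theorem norm_resFormL_sub_le {β : ℝ} {hβ : 0 ≤ β} {κ₀ C : ℝ}
    (hC : ∀ (κ ε : ℝ) (v w : Rn n) (g₁ g₂ : L2 n), κ₀ ≤ κ → ∀ hε : 0 < ε,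
      ‖resFormL κ hε v w (weightedFourier hβ g₁) (weightedFourier hβ g₂)‖ ≤ C * ‖g₁‖ * ‖g₂‖)
    {κ ε : ℝ} (v w : Rn n) (hκ : κ₀ ≤ κ) (hε : 0 < ε) (g g' : L2 n) :
    ‖resForm κ ε v w (weightedFourier hβ g) (weightedFourier hβ g) -
      resForm κ ε v w (weightedFourier hβ g') (weightedFourier hβ g')‖ ≤
      C * ‖g - g'‖ * (‖g‖ + ‖g'‖) := by
  rw [← resFormL_apply κ hε, ← resFormL_apply κ hε, sub_quadratic, ← map_sub]
  refine (norm_add_le _ _).trans ((add_le_add (hC κ ε v w _ _ hκ hε)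
    (hC κ ε v w _ _ hκ hε)).trans (le_of_eq ?_))
  ring

theorem exists_schwartz_seq (g : L2 n) : ∃ φ : ℕ → 𝓢(Rn n, ℂ),
    Tendsto (fun j ↦ ((φ j).toLp 2 : L2 n)) atTop (𝓝 g) := by
  have hd := SchwartzMap.denseRange_toLpCLM (E := Rn n) (F := ℂ) (p := 2)
    (μ := (volume : Measure (Rn n))) ENNReal.ofNat_ne_top
  obtain ⟨x, hx, hxg⟩ := mem_closure_iff_seq_limit.1 (hd g)
  choose φ hφ using hx
  refine ⟨φ, ?_⟩
  have : (fun j ↦ ((φ j).toLp 2 : L2 n)) = x := by ext1 j; exact hφ j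
  rwa [this]

/-- The limit exists for Schwartz data, whose transforms are smooth, and the quadratic form is
approximated by such data uniformly in ε; the Cauchy criterion concludes. -/
theorem exists_tendsto_resForm (hn : 2 ≤ n) {β : ℝ} (hβ : 0 ≤ β) {κ : ℝ} (hκ : 0 < κ) (v w : Rn n)
    (g : L2 n) : ∃ L, Tendsto (fun ε ↦ resForm κ ε v w (weightedFourier hβ g)
      (weightedFourier hβ g)) (𝓝[>] 0) (𝓝 L) := by
  obtain ⟨C, hC0, hC⟩ := exists_norm_resFormL_le hn hβ hκ
  refine exists_tendsto_of_approx fun δ hδ ↦ ?_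
  obtain ⟨φ, hφ⟩ := exists_schwartz_seq g
  have h1 : Tendsto (fun j ↦ C * ‖g - ((φ j).toLp 2 : L2 n)‖ * (‖g‖ + ‖((φ j).toLp 2 : L2 n)‖)) atTop
      (𝓝 (C * ‖g - g‖ * (‖g‖ + ‖g‖))) :=
    ((tendsto_const_nhds.sub hφ).norm.const_mul C).mul (tendsto_const_nhds.add hφ.norm)
  rw [sub_self, norm_zero, mul_zero, zero_mul] at h1
  obtain ⟨j, hj⟩ := (h1.eventually (gt_mem_nhds hδ)).exists
  set p := schwartzFourier β (φ j)
  have hp : ContDiff ℝ 1 p := p.smooth 1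
  obtain ⟨L, hL⟩ := exists_tendsto_integral_res hn (f := fun ξ ↦ p (w - ξ) * p (ξ - v))
    (by fun_prop) (((p.memLp 2 volume).comp_measurePreserving
      (Measure.measurePreserving_sub_left volume w)).integrable_mul
      ((p.memLp 2 volume).comp_measurePreserving (measurePreserving_sub_right volume v))) hκ
  refine ⟨_, L, hL, ?_⟩
  filter_upwards [self_mem_nhdsWithin] with ε hε
  have h2 := norm_resFormL_sub_le hC v w le_rfl hε g ((φ j).toLp 2)
  rw [resForm_congr (weightedFourier_toLp hβ (φ j)) (weightedFourier_toLp hβ (φ j))] at h2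
  exact h2.trans hj.le

/-! ### Measurability -/

theorem measurable_waveNumber (θ : Rn n) : Measurable (waveNumber θ) := by
  unfold waveNumber
  exact ((measurable_norm.pow_const 2).div
    ((continuous_const.inner continuous_id).measurable)).neg

theorem stronglyMeasurable_resForm {κ : Rn n → ℝ} {v w : Rn n → Rn n} (hκ : Measurable κ)
    (hv : Measurable v) (hw : Measurable w) (ε : ℝ) (f g : L2 n) :
    StronglyMeasurable fun η ↦ resForm (κ η) ε (v η) (w η) f g := by
  unfold resForm
  refine StronglyMeasurable.integral_prod_right'
    (f := fun p : Rn n × Rn n ↦ f (w p.1 - p.2) * g (p.2 - v p.1) * res (κ p.1) ε ‖p.2‖)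
    (Measurable.stronglyMeasurable ?_)
  have hf := (Lp.stronglyMeasurable f).measurable
  have hg := (Lp.stronglyMeasurable g).measurable
  unfold res
  have h1 : Measurable fun p : Rn n × Rn n ↦ f (w p.1 - p.2) :=
    hf.comp ((hw.comp measurable_fst).sub measurable_snd)
  have h2 : Measurable fun p : Rn n × Rn n ↦ g (p.2 - v p.1) :=
    hg.comp (measurable_snd.sub (hv.comp measurable_fst))
  have h3 : Measurable fun p : Rn n × Rn n ↦ (κ p.1 ^ 2 - ‖p.2‖ ^ 2 : ℝ) :=
    ((hκ.comp measurable_fst).pow_const 2).sub (measurable_snd.norm.pow_const 2)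
  exact (h1.mul h2).mul ((Complex.measurable_ofReal.comp h3).add_const _).inv

/-- The quadratic form that represents `B_θ` in frequency space. -/
def quadB (ε : ℝ) (θ : Rn n) (f : Rn n → ℂ) (η : Rn n) : ℂ :=
  resForm (waveNumber θ η / (2 * Real.pi)) ε ((2 * Real.pi)⁻¹ • (waveNumber θ η • θ))
    ((2 * Real.pi)⁻¹ • (η + waveNumber θ η • θ)) f f

theorem regB_eq_quadB {ε : ℝ} (hε : 0 < ε) (q : L2 n) {θ η : Rn n} (h : inner ℝ η θ < 0) :
    regB ε θ q η = ((4 * Real.pi ^ 2 : ℝ) : ℂ)⁻¹ *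
      quadB (ε / (4 * Real.pi ^ 2)) θ (𝓕 q : L2 n) η :=
  regB_eq_resForm hε q h

theorem measurable_quadB (ε : ℝ) (θ : Rn n) (f : L2 n) : Measurable (quadB ε θ f) := by
  have hk := measurable_waveNumber θ
  have h1 : Measurable fun η ↦ waveNumber θ η / (2 * Real.pi) := hk.div_const _
  have h2 : Measurable fun η ↦ (2 * Real.pi)⁻¹ • (waveNumber θ η • θ) := by fun_prop
  have h3 : Measurable fun η : Rn n ↦ (2 * Real.pi)⁻¹ • (η + waveNumber θ η • θ) := by
    fun_prop
  exact (stronglyMeasurable_resForm h1 h2 h3 ε f f).measurable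

theorem stronglyMeasurable_regB {ε : ℝ} (hε : 0 < ε) (θ : Rn n) (q : L2 n) :
    StronglyMeasurable (regB ε θ q) := by
  have h1 : MeasurableSet {η : Rn n | inner ℝ η θ < 0} :=
    measurableSet_lt (continuous_id.inner continuous_const).measurable measurable_const
  have h2 : Measurable fun η ↦ ((4 * Real.pi ^ 2 : ℝ) : ℂ)⁻¹ *
      quadB (ε / (4 * Real.pi ^ 2)) θ (𝓕 q : L2 n) η := (measurable_quadB _ _ _).const_mul _
  have h3 : regB ε θ q = Set.indicator {η : Rn n | inner ℝ η θ < 0} fun η ↦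
      ((4 * Real.pi ^ 2 : ℝ) : ℂ)⁻¹ * quadB (ε / (4 * Real.pi ^ 2)) θ (𝓕 q : L2 n) η := by
    ext η
    by_cases h : inner ℝ η θ < 0
    · rw [Set.indicator_of_mem (by exact h), regB_eq_quadB hε q h]
    · rw [Set.indicator_of_notMem (by exact h), regB_of_nonneg q (not_lt.1 h)]
  rw [h3]
  exact (h2.indicator h1).stronglyMeasurable

/-- The limit of `regB` along `ε = 1/(j+1)`. -/
def limB (θ : Rn n) (q : L2 n) (η : Rn n) : ℂ :=
  limUnder atTop fun j : ℕ ↦ regB (1 / ((j : ℝ) + 1)) θ q η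

/-- A limit along a sequence is measurable without any continuity in η; it equals the full limit ε →
0+ wherever that exists. -/
theorem stronglyMeasurable_limB (θ : Rn n) (q : L2 n) : StronglyMeasurable (limB θ q) :=
  StronglyMeasurable.limUnder fun j ↦ stronglyMeasurable_regB (by positivity) θ q

theorem tendsto_one_div_nhdsGT : Tendsto (fun j : ℕ ↦ 1 / ((j : ℝ) + 1)) atTop (𝓝[>] 0) :=
  tendsto_nhdsWithin_iff.2 ⟨tendsto_one_div_add_atTop_nhds_zero_nat,
    Eventually.of_forall fun j ↦ by rw [Set.mem_Ioi]; positivity⟩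

theorem isB_limB_of_exists {θ : Rn n} {q : L2 n} {η : Rn n} (h : ∃ b, IsB θ q η b) :
    IsB θ q η (limB θ q η) := by
  obtain ⟨b, hb⟩ := h
  have : limB θ q η = b := (hb.comp tendsto_one_div_nhdsGT).limUnder_eq
  rwa [this]

theorem isB_zero {θ : Rn n} (q : L2 n) {η : Rn n} (h : 0 ≤ inner ℝ η θ) : IsB θ q η 0 := by
  unfold IsB
  simp only [regB_of_nonneg q h]
  exact tendsto_const_nhds

theorem limB_of_nonneg {θ : Rn n} (q : L2 n) {η : Rn n} (h : 0 ≤ inner ℝ η θ) : limB θ q η = 0 :=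
  tendsto_nhds_unique ((isB_limB_of_exists ⟨0, isB_zero q h⟩)) (isB_zero q h)

theorem tendsto_div_nhdsGT {c : ℝ} (hc : 0 < c) :
    Tendsto (fun ε : ℝ ↦ ε / c) (𝓝[>] 0) (𝓝[>] 0) := by
  refine tendsto_nhdsWithin_iff.2 ⟨?_, ?_⟩
  · have : Tendsto (fun ε : ℝ ↦ ε / c) (𝓝 0) (𝓝 (0 / c)) := tendsto_id.div_const c
    rw [zero_div] at this
    exact this.mono_left nhdsWithin_le_nhds
  · filter_upwards [self_mem_nhdsWithin] with ε hε
    exact div_pos hε hc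

theorem exists_isB_of_quadB {θ : Rn n} {q : L2 n} {η : Rn n} (h : inner ℝ η θ < 0)
    (hL : ∃ L, Tendsto (fun ε ↦ quadB ε θ (𝓕 q : L2 n) η) (𝓝[>] 0) (𝓝 L)) :
    ∃ b, IsB θ q η b := by
  obtain ⟨L, hL⟩ := hL
  refine ⟨((4 * Real.pi ^ 2 : ℝ) : ℂ)⁻¹ * L, ?_⟩
  refine ((hL.comp (tendsto_div_nhdsGT (c := 4 * Real.pi ^ 2) (by positivity))).const_mul
    _).congr' ?_
  filter_upwards [self_mem_nhdsWithin] with ε hε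
  rw [regB_eq_quadB hε q h]
  rfl

theorem exists_isB (hn : 2 ≤ n) {β : ℝ} (hβ : 0 ≤ β) {q g : L2 n}
    (hg : (𝓕 q : L2 n) = weightedFourier hβ g) (θ η : Rn n) : ∃ b, IsB θ q η b := by
  by_cases h : inner ℝ η θ < 0
  · refine exists_isB_of_quadB h ?_
    rw [hg]
    exact exists_tendsto_resForm hn hβ (div_pos (waveNumber_pos h) (by positivity)) _ _ g
  · exact ⟨0, isB_zero q (not_lt.1 h)⟩

/-! ### The weighted `L²` bound -/

theorem exists_dualWeight_le (a : ℝ) : ∃ C : ℝ, 0 ≤ C ∧ ∀ ξ : Rn n,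
    dualWeight a ξ ≤ C * jap ξ ^ (2 * a) := by
  have hπ : 1 ≤ 2 * Real.pi := by linarith [Real.pi_gt_three]
  have hπ2 : 1 ≤ (2 * Real.pi) ^ 2 := one_le_pow₀ hπ
  have e : ∀ ξ : Rn n, jap ξ ^ (2 * a) = (1 + ‖ξ‖ ^ 2) ^ a := fun ξ ↦ by
    rw [jap_rpow]; congr 1; ring
  have e2 : ∀ ξ : Rn n, dualWeight a ξ = (1 + (2 * Real.pi) ^ 2 * ‖ξ‖ ^ 2) ^ a := fun ξ ↦ by
    rw [dualWeight, norm_smul, mul_pow, Real.norm_eq_abs, sq_abs]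
  rcases le_total 0 a with ha | ha
  · refine ⟨((2 * Real.pi) ^ 2) ^ a, by positivity, fun ξ ↦ ?_⟩
    rw [e, e2, ← Real.mul_rpow (by positivity) (by positivity)]
    refine Real.rpow_le_rpow (by positivity) ?_ ha
    linarith [sq_nonneg ‖ξ‖]
  · refine ⟨1, zero_le_one, fun ξ ↦ ?_⟩
    rw [e, e2, one_mul]
    refine Real.rpow_le_rpow_of_nonpos (by positivity) ?_ ha
    nlinarith [sq_nonneg ‖ξ‖]

/-- The set of `ξ` such that `2πξ` lies in the half space `H_θ`, off the unit ball. -/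
def highHalf (θ : Rn n) : Set (Rn n) :=
  {ξ | inner ℝ ((2 * Real.pi) • ξ) θ < 0 ∧ 1 ≤ ‖(2 * Real.pi) • ξ‖}

theorem measurableSet_highHalf (θ : Rn n) : MeasurableSet (highHalf θ) :=
  MeasurableSet.inter (s₁ := {ξ : Rn n | inner ℝ ((2 * Real.pi) • ξ) θ < 0})
    (s₂ := {ξ : Rn n | 1 ≤ ‖(2 * Real.pi) • ξ‖})
    (measurableSet_lt ((continuous_const_smul (2 * Real.pi)).inner continuous_const).measurable
      measurable_const)
    (measurableSet_le measurable_const (continuous_const_smul (2 * Real.pi)).norm.measurable)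

/-- Here w − v = ξ, so the weight of order 2α cancels the decay of the pointwise estimate up to a
constant. What remains is the integral of H * H with H the squared jet, which factors as (∫ H)². -/
theorem exists_lintegral_quadB_schwartz_le (hn : 2 ≤ n) {α β : ℝ} (hβ : 0 ≤ β)
    (h : ((n : ℝ) - 3) / 2 < β ∧ β < ((n : ℝ) - 1) / 2 ∧ α < 2 * β - ((n : ℝ) - 3) / 2 ∨
        ((n : ℝ) - 1) / 2 ≤ β ∧ α < β + 1) :
    ∃ C : ℝ≥0, ∀ θ : Rn n, ‖θ‖ = 1 → ∀ ε, 0 < ε → ∀ g : 𝓢(Rn n, ℂ),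
      ∫⁻ ξ in highHalf θ, ENNReal.ofReal (dualWeight α ξ) *
        ‖quadB ε θ (schwartzFourier β g) ((2 * Real.pi) • ξ)‖ₑ ^ 2 ≤ C * eLpNorm g 2 volume ^ 4 := by
  -- The lower bound for κ = k/2π on the set where |η| ≥ 1.
  have hκ₀ : 0 < (2 * Real.pi)⁻¹ := by positivity
  obtain ⟨C₁, hC₁, h₁⟩ := exists_sq_enorm_resForm_le hn hβ hκ₀ h
  obtain ⟨C₂, hC₂, h₂⟩ := exists_dualWeight_le (n := n) α
  set D : ℝ≥0∞ := (1 + n + n * n) * ENNReal.ofReal ((2 * Real.pi) ^ 2) with hD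
  have hDt : D < ⊤ := ENNReal.mul_lt_top (by exact_mod_cast ENNReal.natCast_lt_top (1 + n + n * n))
    ENNReal.ofReal_lt_top
  have hfin : ENNReal.ofReal C₂ * C₁ * D ^ 4 < ⊤ :=
    ENNReal.mul_lt_top (ENNReal.mul_lt_top ENNReal.ofReal_lt_top hC₁) (ENNReal.pow_lt_top hDt)
  refine ⟨(ENNReal.ofReal C₂ * C₁ * D ^ 4).toNNReal, fun θ hθ ε hε g ↦ ?_⟩
  rw [ENNReal.coe_toNNReal hfin.ne]
  have c1 := continuous_jet ((decayFourier g).smooth 2)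
  set H : Rn n → ℝ≥0∞ := fun ξ ↦ ENNReal.ofReal (jet (decayFourier g) ξ) ^ 2 with hH
  have hHm : Measurable H := c1.measurable.ennreal_ofReal.pow_const 2
  have hpt : ∀ ξ ∈ highHalf θ, ENNReal.ofReal (dualWeight α ξ) *
      ‖quadB ε θ (schwartzFourier β g) ((2 * Real.pi) • ξ)‖ₑ ^ 2 ≤
      ENNReal.ofReal C₂ * C₁ * ∫⁻ ζ, H (ξ - ζ) * H ζ := fun ξ hξ ↦ by
    set k := waveNumber θ ((2 * Real.pi) • ξ) with hk
    have hk0 : 0 < k := waveNumber_pos hξ.1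
    have hk1 : ‖(2 * Real.pi) • ξ‖ ≤ k := norm_le_waveNumber hθ hξ.1
    have hwv : (2 * Real.pi)⁻¹ • ((2 * Real.pi) • ξ + k • θ) - (2 * Real.pi)⁻¹ • (k • θ) = ξ := by
      rw [← smul_sub, add_sub_cancel_right, inv_smul_smul₀ (by positivity)]
    have hξk : ‖ξ‖ ≤ k / (2 * Real.pi) := by
      rw [norm_smul, Real.norm_of_nonneg (by positivity)] at hk1
      rw [le_div_iff₀ (by positivity)]; linarith
    have h3 := h₁ (k / (2 * Real.pi)) ε ((2 * Real.pi)⁻¹ • (k • θ))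
      ((2 * Real.pi)⁻¹ • ((2 * Real.pi) • ξ + k • θ)) g
      (by rw [inv_eq_one_div]; gcongr; exact hξ.2.trans hk1) hε
      (by rw [norm_smul, norm_smul, hθ, Real.norm_of_nonneg (by positivity),
        Real.norm_of_nonneg hk0.le]; ring) (by rwa [hwv])
    rw [hwv] at h3
    rw [quadB, ← hk]
    calc _ ≤ ENNReal.ofReal (C₂ * jap ξ ^ (2 * α)) *
          (C₁ * (ENNReal.ofReal (jap ξ ^ (-(2 * α))) * ∫⁻ ζ, H (ξ - ζ) * H ζ)) := by
          gcongr
          exact h₂ ξ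
      _ = ENNReal.ofReal C₂ * C₁ * (ENNReal.ofReal (jap ξ ^ (2 * α)) *
          ENNReal.ofReal (jap ξ ^ (-(2 * α)))) * ∫⁻ ζ, H (ξ - ζ) * H ζ := by
          rw [ENNReal.ofReal_mul hC₂]; ring
      _ = _ := by
          have hj := jap_pos ξ
          rw [← ENNReal.ofReal_mul (by positivity), ← Real.rpow_add hj, add_neg_cancel,
            Real.rpow_zero, ENNReal.ofReal_one, mul_one]
  calc _ ≤ ∫⁻ ξ in highHalf θ, ENNReal.ofReal C₂ * C₁ * ∫⁻ ζ, H (ξ - ζ) * H ζ :=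
        setLIntegral_mono' (measurableSet_highHalf θ) hpt
    _ ≤ ∫⁻ ξ, ENNReal.ofReal C₂ * C₁ * ∫⁻ ζ, H (ξ - ζ) * H ζ := setLIntegral_le_lintegral _ _
    _ = ENNReal.ofReal C₂ * C₁ * ∫⁻ ξ, ∫⁻ ζ, H (ξ - ζ) * H ζ :=
        lintegral_const_mul' _ _ (ENNReal.mul_lt_top ENNReal.ofReal_lt_top hC₁).ne
    _ = ENNReal.ofReal C₂ * C₁ * ((∫⁻ ξ, H ξ) * ∫⁻ ζ, H ζ) := by
        congr 1
        rw [lintegral_lintegral_swap]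
        · rw [← lintegral_const_mul _ hHm]
          refine lintegral_congr fun ζ ↦ ?_
          rw [lintegral_mul_const (f := fun x ↦ H (x - ζ)) _ (hHm.comp (measurable_id.sub_const ζ)),
            lintegral_sub_right_eq_self H ζ]
        · exact ((hHm.comp (measurable_fst.sub measurable_snd)).mul
            (hHm.comp measurable_snd)).aemeasurable
    _ ≤ ENNReal.ofReal C₂ * C₁ * ((D * eLpNorm g 2 volume) ^ 2 * (D * eLpNorm g 2 volume) ^ 2) := by
        have h4 : ∫⁻ ξ, H ξ ≤ (D * eLpNorm g 2 volume) ^ 2 := by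
          rw [hH, lintegral_sq_eq (jet_nonneg _), hD, mul_assoc]
          exact pow_le_pow_left' (eLpNorm_jet_decayFourier_le g) 2
        gcongr
    _ = _ := by ring

theorem inv_le_waveNumber_div {θ η : Rn n} (hθ : ‖θ‖ = 1) (h : inner ℝ η θ < 0) (hη : 1 ≤ ‖η‖) :
    (2 * Real.pi)⁻¹ ≤ waveNumber θ η / (2 * Real.pi) := by
  rw [inv_eq_one_div]
  have := hη.trans (norm_le_waveNumber hθ h)
  gcongr

theorem norm_quadB_sub_le {β : ℝ} {hβ : 0 ≤ β} {C : ℝ}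
    (hC : ∀ (κ ε : ℝ) (v w : Rn n) (g₁ g₂ : L2 n), (2 * Real.pi)⁻¹ ≤ κ → ∀ hε : 0 < ε,
      ‖resFormL κ hε v w (weightedFourier hβ g₁) (weightedFourier hβ g₂)‖ ≤ C * ‖g₁‖ * ‖g₂‖)
    {θ η : Rn n} (hθ : ‖θ‖ = 1) (h : inner ℝ η θ < 0) (hη : 1 ≤ ‖η‖) {ε : ℝ} (hε : 0 < ε)
    (g g' : L2 n) :
    ‖quadB ε θ (weightedFourier hβ g) η - quadB ε θ (weightedFourier hβ g') η‖ ≤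
      C * ‖g - g'‖ * (‖g‖ + ‖g'‖) :=
  norm_resFormL_sub_le hC _ _ (inv_le_waveNumber_div hθ h hη) hε g g'

theorem quadB_toLp {β : ℝ} (hβ : 0 ≤ β) (ε : ℝ) (θ η : Rn n) (φ : 𝓢(Rn n, ℂ)) :
    quadB ε θ (weightedFourier hβ (φ.toLp 2)) η = quadB ε θ (schwartzFourier β φ) η :=
  resForm_congr (weightedFourier_toLp hβ φ) (weightedFourier_toLp hβ φ)

/-- `4π²`, the ratio of the squares of the two frequency variables. -/
def fourPiSq : ℝ := 4 * Real.pi ^ 2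

theorem fourPiSq_pos : 0 < fourPiSq := by unfold fourPiSq; positivity

theorem norm_inv_fourPiSq_le : ‖((fourPiSq : ℂ))⁻¹‖ ≤ 1 := by
  rw [norm_inv, Complex.norm_real, Real.norm_of_nonneg fourPiSq_pos.le]
  refine inv_le_one_of_one_le₀ ?_
  unfold fourPiSq
  nlinarith [Real.pi_gt_three]

/-- An approximation of `limB` through Schwartz functions. -/
def approxB {β : ℝ} (hβ : 0 ≤ β) (θ : Rn n) (φ : ℕ → 𝓢(Rn n, ℂ)) (j : ℕ) (η : Rn n) : ℂ :=
  (fourPiSq : ℂ)⁻¹ *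
    quadB (1 / ((j : ℝ) + 1) / fourPiSq) θ (weightedFourier hβ ((φ j).toLp 2)) η

theorem measurable_approxB {β : ℝ} (hβ : 0 ≤ β) (θ : Rn n) (φ : ℕ → 𝓢(Rn n, ℂ)) (j : ℕ) :
    Measurable (approxB hβ θ φ j) :=
  (measurable_quadB _ _ _).const_mul _

theorem enorm_approxB_le {β : ℝ} (hβ : 0 ≤ β) (θ : Rn n) (φ : ℕ → 𝓢(Rn n, ℂ)) (j : ℕ) (η : Rn n) :
    ‖approxB hβ θ φ j η‖ₑ ≤
      ‖quadB (1 / ((j : ℝ) + 1) / fourPiSq) θ (schwartzFourier β (φ j)) η‖ₑ := by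
  rw [approxB, quadB_toLp, enorm_mul]
  refine mul_le_of_le_one_left zero_le ?_
  rw [← ofReal_norm]
  exact ENNReal.ofReal_le_one.2 norm_inv_fourPiSq_le

/-- A diagonal sequence: ε = 1/(j+1) together with the j-th Schwartz approximation. The error of the
approximation is bounded independently of ε, so both limits may be taken at once, ready for Fatou.
-/
theorem tendsto_approxB (hn : 2 ≤ n) {β : ℝ} (hβ : 0 ≤ β) {θ η : Rn n} (hθ : ‖θ‖ = 1)
    (h : inner ℝ η θ < 0) (hη : 1 ≤ ‖η‖) {q g : L2 n} (hg : (𝓕 q : L2 n) = weightedFourier hβ g)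
    {φ : ℕ → 𝓢(Rn n, ℂ)} (hφ : Tendsto (fun j ↦ ((φ j).toLp 2 : L2 n)) atTop (𝓝 g)) :
    Tendsto (fun j ↦ approxB hβ θ φ j η) atTop (𝓝 (limB θ q η)) := by
  obtain ⟨M, hM0, hM⟩ := exists_norm_resFormL_le (n := n) hn hβ
    (by positivity : 0 < (2 * Real.pi)⁻¹)
  have h1 : Tendsto (fun j : ℕ ↦ regB (1 / ((j : ℝ) + 1)) θ q η) atTop (𝓝 (limB θ q η)) :=
    (isB_limB_of_exists (exists_isB hn hβ hg θ _)).comp tendsto_one_div_nhdsGT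
  have h2 : Tendsto (fun j ↦ M * ‖g - ((φ j).toLp 2 : L2 n)‖ * (‖g‖ + ‖((φ j).toLp 2 : L2 n)‖))
      atTop (𝓝 (M * ‖g - g‖ * (‖g‖ + ‖g‖))) :=
    ((tendsto_const_nhds.sub hφ).norm.const_mul M).mul (tendsto_const_nhds.add hφ.norm)
  rw [sub_self, norm_zero, mul_zero, zero_mul] at h2
  refine (tendsto_iff_of_dist ?_).1 h1
  refine squeeze_zero (fun _ ↦ dist_nonneg) (fun j ↦ ?_) h2
  have hj : (0 : ℝ) < 1 / ((j : ℝ) + 1) := by positivity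
  rw [dist_eq_norm, regB_eq_quadB hj q h, hg, approxB, ← fourPiSq, ← mul_sub, norm_mul]
  exact (mul_le_of_le_one_left (norm_nonneg _) norm_inv_fourPiSq_le).trans
    (norm_quadB_sub_le hM hθ h hη (div_pos hj fourPiSq_pos) g _)

theorem lintegral_le_of_tendsto {X : Type*} [MeasurableSpace X] {μ : Measure X} {f : ℕ → X → ℝ≥0∞}
    {g : X → ℝ≥0∞} {b : ℕ → ℝ≥0∞} {B : ℝ≥0∞} (hf : ∀ j, Measurable (f j))
    (hlim : ∀ᵐ x ∂μ, Tendsto (fun j ↦ f j x) atTop (𝓝 (g x)))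
    (hb : ∀ j, ∫⁻ x, f j x ∂μ ≤ b j) (hB : Tendsto b atTop (𝓝 B)) : ∫⁻ x, g x ∂μ ≤ B :=
  calc ∫⁻ x, g x ∂μ = ∫⁻ x, liminf (fun j ↦ f j x) atTop ∂μ :=
        lintegral_congr_ae (hlim.mono fun x hx ↦ hx.liminf_eq.symm)
    _ ≤ liminf (fun j ↦ ∫⁻ x, f j x ∂μ) atTop := lintegral_liminf_le hf
    _ ≤ liminf b atTop := liminf_le_liminf (Eventually.of_forall hb)
    _ = B := hB.liminf_eq

/-- The quadratic bound for the limit, by Fatou's lemma. -/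
theorem exists_lintegral_limB_le (hn : 2 ≤ n) {α β : ℝ} (hβ : 0 ≤ β)
    (h : ((n : ℝ) - 3) / 2 < β ∧ β < ((n : ℝ) - 1) / 2 ∧ α < 2 * β - ((n : ℝ) - 3) / 2 ∨
        ((n : ℝ) - 1) / 2 ≤ β ∧ α < β + 1) :
    ∃ C : ℝ≥0, ∀ θ : Rn n, ‖θ‖ = 1 → ∀ q g : L2 n, (𝓕 q : L2 n) = weightedFourier hβ g →
      ∫⁻ ξ in highHalf θ, ENNReal.ofReal (dualWeight α ξ) *
        ‖limB θ q ((2 * Real.pi) • ξ)‖ₑ ^ 2 ≤ C * ‖g‖ₑ ^ 4 := by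
  obtain ⟨C, hC⟩ := exists_lintegral_quadB_schwartz_le hn hβ h
  refine ⟨C, fun θ hθ q g hg ↦ ?_⟩
  obtain ⟨φ, hφ⟩ := exists_schwartz_seq g
  have hlim : ∀ ξ ∈ highHalf θ, Tendsto (fun j ↦ approxB hβ θ φ j ((2 * Real.pi) • ξ)) atTop
      (𝓝 (limB θ q ((2 * Real.pi) • ξ))) :=
    fun ξ hξ ↦ tendsto_approxB hn hβ hθ hξ.1 hξ.2 hg hφ
  have hGm : ∀ j, Measurable fun ξ ↦ approxB hβ θ φ j ((2 * Real.pi) • ξ) := fun j ↦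
    (measurable_approxB hβ θ φ j).comp (measurable_const_smul _)
  have hbd : ∀ j, ∫⁻ ξ in highHalf θ, ENNReal.ofReal (dualWeight α ξ) *
      ‖approxB hβ θ φ j ((2 * Real.pi) • ξ)‖ₑ ^ 2 ≤ C * ‖((φ j).toLp 2 : L2 n)‖ₑ ^ 4 := fun j ↦ by
    have hj : (0 : ℝ) < 1 / ((j : ℝ) + 1) := by positivity
    have h1 := hC θ hθ _ (div_pos hj fourPiSq_pos) (φ j)
    have h2 : ‖((φ j).toLp 2 : L2 n)‖ₑ = eLpNorm (φ j) 2 volume := by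
      rw [Lp.enorm_def, eLpNorm_congr_ae ((φ j).coeFn_toLp 2 volume)]
    rw [h2]
    refine le_trans (lintegral_mono fun ξ ↦ ?_) h1
    exact mul_le_mul_right (pow_le_pow_left' (enorm_approxB_le hβ θ φ j _) 2) _
  have hW : Measurable fun ξ : Rn n ↦ ENNReal.ofReal (dualWeight α ξ) :=
    (contDiff_dualWeight α).continuous.measurable.ennreal_ofReal
  refine lintegral_le_of_tendsto (fun j ↦ hW.mul ((hGm j).enorm.pow_const 2)) ?_ hbd ?_
  · filter_upwards [ae_restrict_mem (measurableSet_highHalf θ)] with ξ hξ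
    exact ENNReal.Tendsto.const_mul (ENNReal.Tendsto.pow (hlim ξ hξ).enorm)
      (Or.inr ENNReal.ofReal_ne_top)
  · exact ENNReal.Tendsto.const_mul (ENNReal.Tendsto.pow hφ.enorm) (Or.inr ENNReal.coe_ne_top)

/-- The weighted `L²` norm of the high-frequency part of one summand. -/
theorem exists_eLpNorm_limB_le (hn : 2 ≤ n) {α β : ℝ} (hβ : 0 ≤ β)
    (h : ((n : ℝ) - 3) / 2 < β ∧ β < ((n : ℝ) - 1) / 2 ∧ α < 2 * β - ((n : ℝ) - 3) / 2 ∨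
        ((n : ℝ) - 1) / 2 ≤ β ∧ α < β + 1) :
    ∃ C : ℝ≥0, ∀ θ : Rn n, ‖θ‖ = 1 → ∀ q g : L2 n, (𝓕 q : L2 n) = weightedFourier hβ g →
      ∀ χ : Rn n → ℝ, Measurable χ → (∀ η, 0 ≤ χ η) → (∀ η, χ η ≤ 1) →
      (∀ η, ‖η‖ < 1 → χ η = 0) →
      eLpNorm (fun ξ ↦ (dualWeight (α / 2) ξ : ℂ) *
        ((χ ((2 * Real.pi) • ξ) : ℂ) * limB θ q ((2 * Real.pi) • ξ))) 2 volume ≤ C * ‖g‖ₑ ^ 2 := by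
  obtain ⟨C, hC⟩ := exists_lintegral_limB_le hn hβ h
  refine ⟨NNReal.sqrt C, fun θ hθ q g hg χ hχm hχ0 hχ1 hχ ↦ ?_⟩
  rw [← ENNReal.pow_le_pow_left_iff two_ne_zero, mul_pow, ← pow_mul, ← ENNReal.coe_pow,
    NNReal.sq_sqrt]
  refine le_trans ?_ (hC θ hθ q g hg)
  rw [eLpNorm_eq_lintegral_rpow_enorm_toReal (by norm_num) (by norm_num), ← ENNReal.rpow_natCast,
    ← ENNReal.rpow_mul]
  norm_num
  rw [← lintegral_indicator (measurableSet_highHalf θ)]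
  refine lintegral_mono fun ξ ↦ ?_
  by_cases hξ : ξ ∈ highHalf θ
  · rw [Set.indicator_of_mem hξ, mul_pow, mul_pow]
    refine mul_le_mul' (le_of_eq ?_) (mul_le_of_le_one_left zero_le ?_)
    · rw [← ofReal_norm, Complex.norm_real, Real.norm_of_nonneg (dualWeight_pos _ _).le,
        ← ENNReal.ofReal_pow (dualWeight_pos _ _).le, sq, dualWeight_mul, add_halves]
    · refine pow_le_one' ?_ 2
      rw [← ofReal_norm, Complex.norm_real, Real.norm_of_nonneg (hχ0 _)]
      exact ENNReal.ofReal_le_one.2 (hχ1 _)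
  · rw [Set.indicator_of_notMem hξ]
    by_cases h1 : inner ℝ ((2 * Real.pi) • ξ) θ < 0
    · have h2 : ‖(2 * Real.pi) • ξ‖ < 1 := by
        by_contra hcon
        exact hξ ⟨h1, not_lt.1 hcon⟩
      simp [hχ _ h2]
    · simp [limB_of_nonneg q (not_lt.1 h1)]

/-- The estimate for the high-frequency part of the double dispersion operator. -/
theorem exists_filteredQ (hn : 2 ≤ n) {α β : ℝ} (hβ : 0 ≤ β)
    (h : ((n : ℝ) - 3) / 2 < β ∧ β < ((n : ℝ) - 1) / 2 ∧ α < 2 * β - ((n : ℝ) - 3) / 2 ∨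
        ((n : ℝ) - 1) / 2 ≤ β ∧ α < β + 1) :
    ∃ C : ℝ≥0, ∀ θ : Rn n, ‖θ‖ = 1 → ∀ C₀ : ℝ, 1 < C₀ → ∀ χ : Rn n → ℝ, IsCutoff C₀ χ →
      ∀ q : L2 n, sobolevNorm β 2 (q : 𝓢'(Rn n, ℂ)) < ⊤ →
        ∃ u : 𝓢'(Rn n, ℂ), IsFilteredQ χ θ q u ∧
          sobolevNorm α 0 u ≤ C * sobolevNorm β 2 (q : 𝓢'(Rn n, ℂ)) ^ 2 := by
  obtain ⟨C, hC⟩ := exists_eLpNorm_limB_le hn hβ h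
  refine ⟨C + C, fun θ hθ C₀ hC₀ χ hχ q hq ↦ ?_⟩
  obtain ⟨g, hg⟩ := exists_of_sobolevNorm_lt_top hq
  have hgq := fourier_eq_weightedFourier hβ hg
  have hχm : Measurable χ := hχ.smooth.continuous.measurable
  -- The threshold enters only through C₀ > 1, hence the constant depends neither on C₀ nor on χ.
  have hχ0 : ∀ η : Rn n, ‖η‖ < 1 → χ η = 0 := fun η hη ↦ hχ.eq_zero η (hη.trans hC₀)
  have hs : Measurable fun ξ : Rn n ↦ (2 * Real.pi) • ξ := measurable_const_smul _
  have hmeas : ∀ θ : Rn n, AEStronglyMeasurable (fun ξ ↦ (dualWeight (α / 2) ξ : ℂ) *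
      ((χ ((2 * Real.pi) • ξ) : ℂ) * limB θ q ((2 * Real.pi) • ξ))) volume := fun θ ↦ by
    refine (Measurable.stronglyMeasurable ?_).aestronglyMeasurable
    exact (contDiff_ofReal_dualWeight _).continuous.measurable.mul
      ((Complex.measurable_ofReal.comp (hχm.comp hs)).mul
        ((stronglyMeasurable_limB θ q).measurable.comp hs))
  have b1 := hC θ hθ q g hgq χ hχm hχ.nonneg hχ.le_one hχ0
  have b2 := hC (-θ) (by rwa [norm_neg]) q g hgq χ hχm hχ.nonneg hχ.le_one hχ0
  set F : Rn n → ℂ := fun η ↦ limB θ q η + limB (-θ) q η with hF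
  have hsum : (fun ξ ↦ (dualWeight (α / 2) ξ : ℂ) *
      ((χ ((2 * Real.pi) • ξ) : ℂ) * F ((2 * Real.pi) • ξ))) =
      (fun ξ ↦ (dualWeight (α / 2) ξ : ℂ) *
        ((χ ((2 * Real.pi) • ξ) : ℂ) * limB θ q ((2 * Real.pi) • ξ))) +
      fun ξ ↦ (dualWeight (α / 2) ξ : ℂ) *
        ((χ ((2 * Real.pi) • ξ) : ℂ) * limB (-θ) q ((2 * Real.pi) • ξ)) := by
    ext ξ; simp only [hF, Pi.add_apply]; ring
  have hle : eLpNorm (fun ξ ↦ (dualWeight (α / 2) ξ : ℂ) *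
      ((χ ((2 * Real.pi) • ξ) : ℂ) * F ((2 * Real.pi) • ξ))) 2 volume ≤
      ((C + C : ℝ≥0) : ℝ≥0∞) * ‖g‖ₑ ^ 2 := by
    rw [hsum]
    refine (eLpNorm_add_le (hmeas θ) (hmeas (-θ)) (by norm_num)).trans ((add_le_add b1 b2).trans ?_)
    rw [ENNReal.coe_add, add_mul]
  have hmem : MemLp (fun ξ ↦ (dualWeight (α / 2) ξ : ℂ) *
      ((χ ((2 * Real.pi) • ξ) : ℂ) * F ((2 * Real.pi) • ξ))) 2 volume := by
    refine ⟨by rw [hsum]; exact (hmeas θ).add (hmeas (-θ)), hle.trans_lt ?_⟩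
    exact ENNReal.mul_lt_top ENNReal.coe_lt_top (ENNReal.pow_lt_top (by simp))
  obtain ⟨u, hu, hun⟩ := exists_fourier_eq α hmem
  refine ⟨u, ⟨F, ae_of_all _ fun η _ ↦ ⟨_, _, isB_limB_of_exists (exists_isB hn hβ hgq θ η),
    isB_limB_of_exists (exists_isB hn hβ hgq (-θ) η), rfl⟩, hu⟩, ?_⟩
  rw [hun, sobolevNorm_eq hg]
  exact hle

/-! ### Radial real functions -/

/-- `f` is a real-valued function of `‖x‖`. -/
def RadialReal (f : Rn n → ℂ) : Prop := ∃ g : ℝ → ℝ, ∀ x, f x = (g ‖x‖ : ℂ)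

open Classical in
theorem radialReal_of {f : Rn n → ℂ} (h : ∀ x y, ‖x‖ = ‖y‖ → f x = f y) (him : ∀ x, (f x).im = 0) :
    RadialReal f := by
  refine ⟨fun r ↦ if hr : ∃ x : Rn n, ‖x‖ = r then (f hr.choose).re else 0, fun x ↦ ?_⟩
  have hr : ∃ y : Rn n, ‖y‖ = ‖x‖ := ⟨x, rfl⟩
  beta_reduce
  rw [dif_pos hr, h hr.choose x hr.choose_spec]
  exact Complex.ext (by simp) (by simp [him x])

theorem RadialReal.comp_isometry {f : Rn n → ℂ} (h : RadialReal f) (A : Rn n ≃ₗᵢ[ℝ] Rn n) :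
    f ∘ A = f := by
  obtain ⟨g, hg⟩ := h
  ext x
  simp [hg]

theorem RadialReal.conj {f : Rn n → ℂ} (h : RadialReal f) (x : Rn n) :
    (starRingEnd ℂ) (f x) = f x := by
  obtain ⟨g, hg⟩ := h
  rw [hg, Complex.conj_ofReal]

theorem RadialReal.mul {f f' : Rn n → ℂ} (h : RadialReal f) (h' : RadialReal f') :
    RadialReal fun x ↦ f x * f' x := by
  obtain ⟨g, hg⟩ := h
  obtain ⟨g', hg'⟩ := h'
  exact ⟨fun r ↦ g r * g' r, fun x ↦ by simp [hg, hg']⟩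

/-- The reflection exchanging two points of equal norm fixes the function, so its transform takes
equal values at them. Applied to x and −x, this evenness turns conjugation of the transform into the
identity. -/
theorem RadialReal.fourier {φ : 𝓢(Rn n, ℂ)} (h : RadialReal φ) :
    RadialReal (𝓕 φ : 𝓢(Rn n, ℂ)) := by
  have hinv : ∀ x y : Rn n, ‖x‖ = ‖y‖ → (𝓕 φ) x = (𝓕 φ) y := fun x y hxy ↦ by
    have h1 := Real.fourier_comp_linearIsometry (Submodule.reflection (ℝ ∙ (x - y))ᗮ) φ x
    rw [h.comp_isometry, Submodule.reflection_sub hxy] at h1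
    rwa [SchwartzMap.fourier_coe]
  refine radialReal_of hinv fun x ↦ Complex.conj_eq_iff_im.1 ?_
  rw [hinv x (-x) (norm_neg x).symm]
  nth_rw 2 [← hinv x (-x) (norm_neg x).symm]
  rw [SchwartzMap.fourier_coe, Real.fourier_eq', Real.fourier_eq', ← integral_conj]
  refine integral_congr_ae (ae_of_all _ fun v ↦ ?_)
  simp only [smul_eq_mul, map_mul, h.conj, ← Complex.exp_conj, inner_neg_right]
  congr 2
  simp [Complex.conj_ofNat]

theorem RadialReal.fourierInv {φ : 𝓢(Rn n, ℂ)} (h : RadialReal φ) :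
    RadialReal (𝓕⁻ φ : 𝓢(Rn n, ℂ)) := by
  obtain ⟨g, hg⟩ := h.fourier
  refine ⟨g, fun x ↦ ?_⟩
  rw [SchwartzMap.fourierInv_coe, Real.fourierInv_eq_fourier_neg, ← SchwartzMap.fourier_coe, hg,
    norm_neg]

/-- Radiality must survive an L² limit, where values are defined only almost everywhere. The profile
is the pointwise limit of the profiles of an almost everywhere convergent subsequence. -/
theorem exists_radial_fourierInv_ae {f : L2 n} {φ : ℕ → 𝓢(Rn n, ℂ)} (hφ : ∀ j, RadialReal (φ j))
    (hf : Tendsto (fun j ↦ ((φ j).toLp 2 : L2 n)) atTop (𝓝 f)) :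
    ∃ g : ℝ → ℝ, ∀ᵐ x, (𝓕⁻ f : L2 n) x = (g ‖x‖ : ℂ) := by
  have h1 : Tendsto (fun j ↦ ((𝓕⁻ (φ j)).toLp 2 : L2 n)) atTop (𝓝 (𝓕⁻ f)) := by
    have hc : Continuous fun f : L2 n ↦ (𝓕⁻ f : L2 n) := continuous_fourierInv
    have := (hc.tendsto f).comp hf
    refine this.congr fun j ↦ ?_
    exact SchwartzMap.toLp_fourierInv_eq (φ j)
  choose g hg using fun j ↦ (hφ j).fourierInv
  obtain ⟨ns, -, hns⟩ := (tendstoInMeasure_of_tendsto_Lp h1).exists_seq_tendsto_ae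
  refine ⟨fun r ↦ limUnder atTop fun j ↦ g (ns j) r, ?_⟩
  have h2 : ∀ᵐ x, ∀ j, ((𝓕⁻ (φ j)).toLp 2 : L2 n) x = (𝓕⁻ (φ j)) x :=
    ae_all_iff.2 fun j ↦ (𝓕⁻ (φ j)).coeFn_toLp 2 volume
  filter_upwards [hns, h2] with x h3 h4
  have h5 : Tendsto (fun j ↦ (g (ns j) ‖x‖ : ℂ)) atTop (𝓝 ((𝓕⁻ f : L2 n) x)) := by
    refine h3.congr fun j ↦ ?_
    rw [h4, hg]
  have h6 : Tendsto (fun j ↦ g (ns j) ‖x‖) atTop (𝓝 ((𝓕⁻ f : L2 n) x).re) := by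
    refine ((Complex.continuous_re.tendsto _).comp h5).congr fun j ↦ ?_
    exact Complex.ofReal_re _
  have h7 : ((𝓕⁻ f : L2 n) x).im = 0 := by
    refine tendsto_nhds_unique ((Complex.continuous_im.tendsto _).comp h5) ?_
    simp only [Function.comp_def, Complex.ofReal_im]
    exact tendsto_const_nhds
  rw [h6.limUnder_eq]
  exact Complex.ext (by simp) (by simp [h7])

/-! ### A compactly supported radial function with nonnegative Fourier transform -/

theorem hasCompactSupport_of_norm {f : Rn n → ℂ} {R : ℝ} (h : ∀ x, R < ‖x‖ → f x = 0) :
    HasCompactSupport f :=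
  HasCompactSupport.intro (isCompact_closedBall (0 : Rn n) R) fun x hx ↦ h x (by
    simpa using hx)

/-- The smooth radial bump function `τ(1/4 - |x|²)`. -/
def halfBump (x : Rn n) : ℂ := (Real.smoothTransition (1 / 4 - ‖x‖ ^ 2) : ℝ)

theorem contDiff_halfBump : ContDiff ℝ ∞ (halfBump : Rn n → ℂ) :=
  Complex.ofRealCLM.contDiff.comp (Real.smoothTransition.contDiff.comp
    (contDiff_const.sub (contDiff_norm_sq ℝ)))

theorem halfBump_eq_zero {x : Rn n} (h : 1 / 2 ≤ ‖x‖) : halfBump x = 0 := by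
  rw [halfBump, Real.smoothTransition.zero_of_nonpos (by nlinarith), Complex.ofReal_zero]

theorem hasCompactSupport_halfBump : HasCompactSupport (halfBump : Rn n → ℂ) :=
  hasCompactSupport_of_norm fun _ hx ↦ halfBump_eq_zero hx.le

/-- The bump function as a Schwartz function. -/
def halfBumpS : 𝓢(Rn n, ℂ) := hasCompactSupport_halfBump.toSchwartzMap contDiff_halfBump

theorem halfBumpS_apply (x : Rn n) : halfBumpS x = halfBump x := rfl

theorem radialReal_halfBumpS : RadialReal (halfBumpS : 𝓢(Rn n, ℂ)) :=
  ⟨fun r ↦ Real.smoothTransition (1 / 4 - r ^ 2), fun _ ↦ rfl⟩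

theorem fourier_halfBumpS_zero_re_pos : 0 < ((𝓕 halfBumpS : 𝓢(Rn n, ℂ)) 0).re := by
  rw [SchwartzMap.fourier_coe, Real.fourier_eq']
  simp only [inner_zero_right, mul_zero, Complex.ofReal_zero, zero_mul, Complex.exp_zero, one_smul]
  have h1 : ∫ v : Rn n, halfBumpS v =
      ((∫ v : Rn n, Real.smoothTransition (1 / 4 - ‖v‖ ^ 2) : ℝ) : ℂ) := by
    exact integral_ofReal
  rw [h1, Complex.ofReal_re]
  have hc : Continuous fun v : Rn n ↦ Real.smoothTransition (1 / 4 - ‖v‖ ^ 2) :=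
    Real.smoothTransition.continuous.comp (by fun_prop)
  refine hc.integral_pos_of_hasCompactSupport_nonneg_nonzero ?_
    (fun _ ↦ Real.smoothTransition.nonneg _) (x := 0) ?_
  · refine HasCompactSupport.intro (isCompact_closedBall (0 : Rn n) (1 / 2)) fun x hx ↦ ?_
    have : 1 / 2 < ‖x‖ := by simpa using hx
    exact Real.smoothTransition.zero_of_nonpos (by nlinarith)
  · exact (Real.smoothTransition.pos_of_pos (by simp)).ne'

/-- The autocorrelation of the bump function. -/
def autoBump : 𝓢(Rn n, ℂ) := SchwartzMap.convolution (ContinuousLinearMap.mul ℂ ℂ) halfBumpS halfBumpS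

theorem fourier_autoBump_apply (ξ : Rn n) :
    (𝓕 autoBump : 𝓢(Rn n, ℂ)) ξ = (𝓕 halfBumpS : 𝓢(Rn n, ℂ)) ξ * (𝓕 halfBumpS : 𝓢(Rn n, ℂ)) ξ := by
  rw [autoBump, SchwartzMap.fourier_convolution, SchwartzMap.pairing_apply_apply]
  simp

theorem radialReal_fourier_autoBump : RadialReal (𝓕 autoBump : 𝓢(Rn n, ℂ)) := by
  have h := radialReal_halfBumpS (n := n).fourier
  have := h.mul h
  simp only [← fourier_autoBump_apply] at this
  exact this

theorem radialReal_autoBump : RadialReal (autoBump : 𝓢(Rn n, ℂ)) := by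
  have := radialReal_fourier_autoBump (n := n).fourierInv
  rwa [FourierTransform.fourierInv_fourier_eq] at this

theorem autoBump_eq_zero {x : Rn n} (h : 1 < ‖x‖) : autoBump x = 0 := by
  rw [autoBump, SchwartzMap.convolution_apply]
  unfold MeasureTheory.convolution
  refine integral_eq_zero_of_ae (ae_of_all _ fun t ↦ ?_)
  simp only [ContinuousLinearMap.mul_apply', halfBumpS_apply, Pi.zero_apply]
  rcases le_or_gt (1 / 2) ‖t‖ with h1 | h1
  · rw [halfBump_eq_zero h1, zero_mul]
  · have := norm_sub_norm_le x t
    rw [halfBump_eq_zero (x := x - t) (by linarith), mul_zero]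

/-- The Fourier transform of `autoBump`, as a real function. -/
def bumpHat (ξ : Rn n) : ℝ := ((𝓕 autoBump : 𝓢(Rn n, ℂ)) ξ).re

theorem fourier_autoBump (ξ : Rn n) : (𝓕 autoBump : 𝓢(Rn n, ℂ)) ξ = (bumpHat ξ : ℂ) := by
  obtain ⟨g, hg⟩ := radialReal_fourier_autoBump (n := n)
  rw [bumpHat, hg, Complex.ofReal_re]

/-- A convolution square of a real even function has for transform the square of a real function.
This positivity lets averages against the bump retain lower bounds. -/
theorem bumpHat_nonneg (ξ : Rn n) : 0 ≤ bumpHat ξ := by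
  obtain ⟨g, hg⟩ := radialReal_halfBumpS (n := n).fourier
  rw [bumpHat, fourier_autoBump_apply, hg, ← Complex.ofReal_mul, Complex.ofReal_re]
  exact mul_self_nonneg _

theorem continuous_bumpHat : Continuous (bumpHat : Rn n → ℝ) :=
  Complex.continuous_re.comp (SchwartzMap.continuous _)

theorem exists_le_bumpHat : ∃ ρ c : ℝ, 0 < ρ ∧ ρ ≤ 1 ∧ 0 < c ∧
    ∀ ξ : Rn n, ‖ξ‖ ≤ ρ → c ≤ bumpHat ξ := by
  have h0 : 0 < bumpHat (0 : Rn n) := by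
    obtain ⟨g, hg⟩ := radialReal_halfBumpS (n := n).fourier
    have := fourier_halfBumpS_zero_re_pos (n := n)
    rw [hg, Complex.ofReal_re] at this
    rw [bumpHat, fourier_autoBump_apply, hg, ← Complex.ofReal_mul, Complex.ofReal_re]
    exact mul_pos this this
  obtain ⟨δ, hδ, hb⟩ := Metric.eventually_nhds_iff.1
    (continuous_bumpHat.continuousAt.eventually (lt_mem_nhds (half_lt_self h0)))
  refine ⟨min (δ / 2) 1, bumpHat (0 : Rn n) / 2, by positivity, min_le_right _ _, by positivity,
    fun ξ hξ ↦ (hb ?_).le⟩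
  rw [dist_zero_right]
  have := hξ.trans (min_le_left _ _)
  linarith

/-! ### The weight `⟨ξ⟩^(-s)` -/

/-- `⟨ξ⟩^(-s)` as a complex function. -/
def japC (s : ℝ) (ξ : Rn n) : ℂ := (jap ξ ^ (-s) : ℝ)

theorem norm_japC (s : ℝ) (ξ : Rn n) : ‖japC s ξ‖ = jap ξ ^ (-s) := by
  have := jap_pos ξ
  rw [japC, Complex.norm_real, Real.norm_of_nonneg (by positivity)]

theorem continuous_japC (s : ℝ) : Continuous (japC s : Rn n → ℂ) :=
  Complex.continuous_ofReal.comp (continuous_jap_rpow _)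

theorem memLp_japC {s : ℝ} (hs : (n : ℝ) < 2 * s) : MemLp (japC s : Rn n → ℂ) 2 volume := by
  refine ⟨(continuous_japC s).aestronglyMeasurable, ?_⟩
  rw [eLpNorm_lt_top_iff_lintegral_rpow_enorm_lt_top (by norm_num) (by norm_num)]
  refine lt_of_eq_of_lt (lintegral_congr fun ξ ↦ ?_) (lintegral_jap_rpow_lt_top hs)
  have := jap_pos ξ
  rw [← ofReal_norm, norm_japC, ENNReal.toReal_ofNat, ENNReal.rpow_two,
    ← ENNReal.ofReal_pow (by positivity), ← Real.rpow_natCast, ← Real.rpow_mul this.le]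
  congr 2
  push_cast; ring

theorem contDiff_japC (s : ℝ) : ContDiff ℝ ∞ (japC s : Rn n → ℂ) := by
  have h : ContDiff ℝ ∞ fun ξ : Rn n ↦ (1 + ‖ξ‖ ^ 2) ^ (-s / 2) :=
    ContDiff.rpow_const_of_ne (contDiff_const.add (contDiff_norm_sq ℝ)) fun x ↦ by positivity
  simp only [← jap_rpow] at h
  exact Complex.ofRealCLM.contDiff.comp h

/-- A smooth radial cut-off at radius `j + 1`. -/
def radialCut (j : ℕ) (ξ : Rn n) : ℝ := Real.smoothTransition (2 - ‖ξ‖ ^ 2 / (j + 1) ^ 2)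

theorem contDiff_radialCut (j : ℕ) : ContDiff ℝ ∞ fun ξ : Rn n ↦ (radialCut j ξ : ℂ) :=
  Complex.ofRealCLM.contDiff.comp (Real.smoothTransition.contDiff.comp
    (contDiff_const.sub ((contDiff_norm_sq ℝ).div_const _)))

theorem radialCut_eq_zero {j : ℕ} {ξ : Rn n} (h : 2 * ((j : ℝ) + 1) < ‖ξ‖) : radialCut j ξ = 0 := by
  refine Real.smoothTransition.zero_of_nonpos ?_
  have hj : (0 : ℝ) < (j : ℝ) + 1 := by positivity
  rw [sub_nonpos, le_div_iff₀ (by positivity)]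
  nlinarith

theorem radialCut_eq_one {j : ℕ} {ξ : Rn n} (h : ‖ξ‖ ≤ (j : ℝ) + 1) : radialCut j ξ = 1 := by
  refine Real.smoothTransition.one_of_one_le ?_
  have hj : (0 : ℝ) < (j : ℝ) + 1 := by positivity
  have : ‖ξ‖ ^ 2 / ((j : ℝ) + 1) ^ 2 ≤ 1 := by
    rw [div_le_one (by positivity)]
    exact pow_le_pow_left₀ (norm_nonneg _) h 2
  linarith

/-- The truncation of `⟨ξ⟩^(-s)` as a Schwartz function. -/
def japTrunc (s : ℝ) (j : ℕ) : 𝓢(Rn n, ℂ) :=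
  HasCompactSupport.toSchwartzMap (f := fun ξ ↦ (radialCut j ξ : ℂ) * japC s ξ)
    (hasCompactSupport_of_norm (R := 2 * ((j : ℝ) + 1)) fun ξ h ↦ by
      rw [radialCut_eq_zero h, Complex.ofReal_zero, zero_mul])
    ((contDiff_radialCut j).mul (contDiff_japC s))

theorem japTrunc_apply (s : ℝ) (j : ℕ) (ξ : Rn n) :
    japTrunc s j ξ = (radialCut j ξ : ℂ) * japC s ξ := rfl

theorem radialReal_japTrunc (s : ℝ) (j : ℕ) : RadialReal (japTrunc s j : 𝓢(Rn n, ℂ)) :=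
  ⟨fun r ↦ Real.smoothTransition (2 - r ^ 2 / (j + 1) ^ 2) * (Real.sqrt (1 + r ^ 2)) ^ (-s),
    fun ξ ↦ by rw [japTrunc_apply, radialCut, japC, jap]; push_cast; rfl⟩

theorem tendsto_japTrunc {s : ℝ} (hs : (n : ℝ) < 2 * s) :
    Tendsto (fun j ↦ ((japTrunc s j).toLp 2 : L2 n)) atTop (𝓝 (memLp_japC hs).toLp) := by
  refine (Lp.tendsto_Lp_iff_tendsto_eLpNorm'' _ (fun j ↦ (japTrunc s j).memLp 2 volume) _
    (memLp_japC hs)).2 ?_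
  have hfin : ∫⁻ ξ : Rn n, ‖japC s ξ‖ₑ ^ 2 ≠ ⊤ := by
    have := (eLpNorm_lt_top_iff_lintegral_rpow_enorm_lt_top (by norm_num) (by norm_num)).1
      (memLp_japC hs).2
    simpa using this.ne
  have h1 : Tendsto (fun j : ℕ ↦ ∫⁻ ξ : Rn n, ‖japTrunc s j ξ - japC s ξ‖ₑ ^ 2) atTop
      (𝓝 (∫⁻ _ξ : Rn n, 0)) := by
    refine tendsto_lintegral_of_dominated_convergence (fun ξ ↦ ‖japC s ξ‖ₑ ^ 2) (fun j ↦ ?_)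
      (fun j ↦ ae_of_all _ fun ξ ↦ ?_) hfin (ae_of_all _ fun ξ ↦ ?_)
    · exact ((japTrunc s j).continuous.sub (continuous_japC s)).measurable.enorm.pow_const 2
    · refine pow_le_pow_left' ?_ 2
      rw [japTrunc_apply, ← sub_one_mul, enorm_mul]
      refine mul_le_of_le_one_left zero_le ?_
      rw [← ofReal_norm, ← Complex.ofReal_one, ← Complex.ofReal_sub, Complex.norm_real,
        Real.norm_eq_abs]
      refine ENNReal.ofReal_le_one.2 (abs_le.2 ⟨?_, ?_⟩)
      · have : 0 ≤ radialCut j ξ := Real.smoothTransition.nonneg _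
        linarith
      · have : radialCut j ξ ≤ 1 := Real.smoothTransition.le_one _
        linarith
    · refine tendsto_const_nhds.congr' ?_
      filter_upwards [eventually_ge_atTop ⌈‖ξ‖⌉₊] with j hj
      have : ‖ξ‖ ≤ (j : ℝ) + 1 := (Nat.le_ceil _).trans (by exact_mod_cast hj.trans (Nat.le_succ j))
      rw [japTrunc_apply, radialCut_eq_one this]
      simp
  rw [lintegral_zero] at h1
  have h2 := (ENNReal.continuous_rpow_const (y := 1 / 2)).tendsto 0 |>.comp h1
  rw [ENNReal.zero_rpow_of_pos (by norm_num)] at h2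
  refine h2.congr fun j ↦ ?_
  rw [eLpNorm_eq_lintegral_rpow_enorm_toReal (by norm_num) (by norm_num)]
  simp

/-! ### Fourier transforms of products of a Schwartz function and an `L²` function -/

/-- The Fourier transform of `φ G`. -/
def fourierMul (φ : 𝓢(Rn n, ℂ)) (G : L2 n) : Rn n → ℂ := 𝓕 fun x ↦ φ x * G x

/-- The Schwartz function `-2πi ⟨x, m⟩ φ(x)`. -/
def mulInner (m : Rn n) (φ : 𝓢(Rn n, ℂ)) : 𝓢(Rn n, ℂ) :=
  -(2 * Real.pi * Complex.I) • SchwartzMap.smulLeftCLM ℂ (inner ℝ · m) φ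

theorem mulInner_apply (m : Rn n) (φ : 𝓢(Rn n, ℂ)) (x : Rn n) :
    mulInner m φ x = -(2 * Real.pi * Complex.I) * ((inner ℝ x m : ℝ) * φ x) := by
  rw [mulInner, smul_apply, SchwartzMap.smulLeftCLM_apply_apply (by fun_prop), smul_eq_mul,
    Complex.real_smul]

/-- The Schwartz function `⟨x⟩^δ φ(x)`. -/
def japMul (δ : ℝ) (φ : 𝓢(Rn n, ℂ)) : 𝓢(Rn n, ℂ) :=
  SchwartzMap.smulLeftCLM ℂ (fun x : Rn n ↦ (((1 + ‖x‖ ^ 2) ^ (δ / 2) : ℝ) : ℂ)) φ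

theorem norm_japMul_apply (δ : ℝ) (φ : 𝓢(Rn n, ℂ)) (x : Rn n) :
    ‖japMul δ φ x‖ = jap x ^ δ * ‖φ x‖ := by
  rw [japMul, SchwartzMap.smulLeftCLM_apply_apply (hasTemperateGrowth_jap_rpow _), norm_smul,
    Complex.norm_real, Real.norm_of_nonneg (by positivity), jap_rpow]

theorem integrable_schwartz_mul (φ : 𝓢(Rn n, ℂ)) (G : L2 n) :
    Integrable fun x ↦ φ x * G x := by
  refine (L2.integrable_mul (φ.toLp 2) G).congr ?_
  filter_upwards [φ.coeFn_toLp 2 volume] with x hx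
  rw [hx]

theorem integrable_pow_schwartz_mul (k : ℕ) (φ : 𝓢(Rn n, ℂ)) (G : L2 n) :
    Integrable fun x ↦ ‖x‖ ^ k * ‖φ x * G x‖ := by
  refine (integrable_schwartz_mul (japMul k φ) G).norm.mono' ?_ (ae_of_all _ fun x ↦ ?_)
  · exact (continuous_norm.pow k).aestronglyMeasurable.mul
      (integrable_schwartz_mul φ G).aestronglyMeasurable.norm
  · rw [Real.norm_of_nonneg (by positivity), norm_mul, norm_mul, norm_japMul_apply, ← mul_assoc,
      Real.rpow_natCast]
    have := norm_le_jap x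
    gcongr

theorem contDiff_fourierMul (φ : 𝓢(Rn n, ℂ)) (G : L2 n) : ContDiff ℝ 2 (fourierMul φ G) :=
  Real.contDiff_fourier (N := 2) fun k _ ↦ integrable_pow_schwartz_mul k φ G

theorem fderiv_fourierMul_apply (φ : 𝓢(Rn n, ℂ)) (G : L2 n) (ξ m : Rn n) :
    fderiv ℝ (fourierMul φ G) ξ m = fourierMul (mulInner m φ) G ξ := by
  have h0 := integrable_schwartz_mul φ G
  have h1 : Integrable fun x ↦ ‖x‖ * ‖φ x * G x‖ := by
    simpa using integrable_pow_schwartz_mul 1 φ G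
  have h2 : Integrable (VectorFourier.fourierSMulRight (innerSL ℝ) fun x ↦ φ x * G x) := by
    refine (h1.const_mul (2 * Real.pi * ‖innerSL ℝ (E := Rn n)‖)).mono'
      ((h0.aestronglyMeasurable.fourierSMulRight)) (ae_of_all _ fun v ↦ ?_)
    exact (VectorFourier.norm_fourierSMulRight_le _ _ _).trans_eq (by ring)
  unfold fourierMul
  rw [Real.fderiv_fourier h0 h1, Real.fourier_continuousLinearMap_apply h2]
  refine congrFun (congrArg _ (funext fun x ↦ ?_)) ξ
  rw [VectorFourier.fourierSMulRight_apply, mulInner_apply, innerSL_apply_apply, smul_eq_mul,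
    Complex.real_smul]
  ring

theorem jet_fourierMul_le (φ : 𝓢(Rn n, ℂ)) (G : L2 n) (ξ : Rn n) :
    jet (fourierMul φ G) ξ ≤ ‖fourierMul φ G ξ‖ +
      ∑ i, ‖fourierMul (mulInner (stdVec i) φ) G ξ‖ +
      ∑ i, ∑ j, ‖fourierMul (mulInner (stdVec i) (mulInner (stdVec j) φ)) G ξ‖ := by
  have h1 : ‖fderiv ℝ (fourierMul φ G) ξ‖ ≤ ∑ i, ‖fourierMul (mulInner (stdVec i) φ) G ξ‖ := by
    refine (opNorm_le_sum _).trans (Finset.sum_le_sum fun i _ ↦ ?_)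
    rw [fderiv_fourierMul_apply]
  have hd : DifferentiableAt ℝ (fderiv ℝ (fourierMul φ G)) ξ :=
    (((contDiff_fourierMul φ G).fderiv_right (m := 1) (by norm_num)).differentiable
      (by norm_num)) ξ
  have h2 : ‖fderiv ℝ (fderiv ℝ (fourierMul φ G)) ξ‖ ≤
      ∑ i, ∑ j, ‖fourierMul (mulInner (stdVec i) (mulInner (stdVec j) φ)) G ξ‖ := by
    refine (opNorm_le_sum _).trans (Finset.sum_le_sum fun i _ ↦ ?_)
    refine (opNorm_le_sum _).trans (Finset.sum_le_sum fun j _ ↦ ?_)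
    rw [← fderiv_fourierMul_apply]
    have h3 : fourierMul (mulInner (stdVec j) φ) G =
        fun y ↦ fderiv ℝ (fourierMul φ G) y (stdVec j) := by
      ext y; rw [fderiv_fourierMul_apply]
    have h4 := (hd.hasFDerivAt.clm_apply (hasFDerivAt_const (stdVec j) ξ)).fderiv
    rw [h3, h4]
    simp
  unfold jet
  linarith

theorem fourierMul_eq_integral_modulate (φ : 𝓢(Rn n, ℂ)) (G : L2 n) (ξ : Rn n) :
    fourierMul φ G ξ =
      ∫ x, modulate (-((2 * Real.pi) • ξ)) (φ.toLp 2 : L2 n) x * G x := by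
  unfold fourierMul
  rw [Real.fourier_eq']
  refine integral_congr_ae ?_
  filter_upwards [(memLp_modulate (-((2 * Real.pi) • ξ)) (φ.toLp 2 : L2 n)).coeFn_toLp,
    φ.coeFn_toLp 2 volume] with x h1 h2
  rw [modulate, h1, h2, smul_eq_mul, inner_neg_left, real_inner_smul_left,
    real_inner_comm, ← mul_assoc]
  congr 3
  push_cast
  ring

theorem fourierInv_modulate_schwartz (φ : 𝓢(Rn n, ℂ)) (ξ : Rn n) :
    (𝓕⁻ (modulate (-((2 * Real.pi) • ξ)) (φ.toLp 2 : L2 n)) : L2 n) =ᵐ[volume]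
      fun ζ ↦ (𝓕 φ : 𝓢(Rn n, ℂ)) (ξ - ζ) := by
  have hu' : (2 * Real.pi)⁻¹ • ((2 * Real.pi) • ξ) = ξ := by
    rw [smul_smul, inv_mul_cancel₀ (by positivity), one_smul]
  have h1 : (𝓕 (φ.toLp 2 : L2 n) : L2 n) =ᵐ[volume] (𝓕 φ : 𝓢(Rn n, ℂ)) := by
    rw [SchwartzMap.toLp_fourier_eq]
    exact SchwartzMap.coeFn_toLp (𝓕 φ : 𝓢(Rn n, ℂ)) 2 volume
  have h2 : ∀ᵐ ζ, (𝓕 (φ.toLp 2 : L2 n) : L2 n) (ξ - ζ) = (𝓕 φ : 𝓢(Rn n, ℂ)) (ξ - ζ) :=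
    (Measure.measurePreserving_sub_left (volume : Measure (Rn n)) ξ)
      |>.quasiMeasurePreserving.ae h1
  filter_upwards [fourierInv_modulate ((2 * Real.pi) • ξ) (φ.toLp 2 : L2 n), h2] with ζ h3 h4
  rw [h3, hu', h4]

theorem fourierMul_fourierInv (φ : 𝓢(Rn n, ℂ)) (W : L2 n) (ξ : Rn n) :
    fourierMul φ (𝓕⁻ W) ξ = ∫ ζ, (𝓕 φ : 𝓢(Rn n, ℂ)) (ξ - ζ) * W ζ := by
  rw [fourierMul_eq_integral_modulate, L2.integral_mul_fourierInv]
  refine integral_congr_ae ?_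
  filter_upwards [fourierInv_modulate_schwartz φ ξ] with ζ h
  rw [h]

theorem fourier_schwartz_mul_ae (φ : 𝓢(Rn n, ℂ)) (G q : L2 n)
    (hq : q =ᵐ[volume] fun x ↦ φ x * G x) (hP : MemLp (fourierMul φ G) 2 volume) :
    (𝓕 q : L2 n) =ᵐ[volume] fourierMul φ G := by
  suffices h : (𝓕 q : L2 n) = hP.toLp by rw [h]; exact hP.coeFn_toLp
  refine L2.ext_schwartz fun ψ ↦ ?_
  rw [integral_mul_fourier]
  calc ∫ x, (𝓕 ψ) x * q x = ∫ x, (𝓕 (ψ : Rn n → ℂ)) x • (φ x * G x) := by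
        refine integral_congr_ae ?_
        filter_upwards [hq] with x hx
        rw [hx, SchwartzMap.fourier_coe, smul_eq_mul]
    _ = ∫ x, ψ x • fourierMul φ G x := by
        have := VectorFourier.integral_fourierIntegral_smul_eq_flip (L := innerₗ (Rn n))
          (μ := volume) (ν := volume) Real.continuous_fourierChar continuous_inner ψ.integrable
          (integrable_schwartz_mul φ G)
        rw [flip_innerₗ] at this
        exact this
    _ = ∫ x, ψ x * (MemLp.toLp _ hP : L2 n) x := by
        refine integral_congr_ae ?_
        filter_upwards [hP.coeFn_toLp] with x hx
        rw [hx, smul_eq_mul]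

/-! ### Convolution of a Schwartz function with `⟨ξ⟩^(-s)` -/

/-- Peetre's inequality: a bracket weight passes through a convolution at the cost of a weight on
the kernel. -/
theorem jap_rpow_neg_le {s : ℝ} (hs : 0 ≤ s) (ξ ζ : Rn n) :
    jap ζ ^ (-s) ≤ 2 ^ s * jap (ξ - ζ) ^ s * jap ξ ^ (-s) := by
  have h1 := jap_pos ξ
  have h2 := jap_pos ζ
  have h3 := jap_pos (ξ - ζ)
  have h := jap_add_le_mul (ξ - ζ) ζ
  rw [sub_add_cancel] at h
  rw [Real.rpow_neg h1.le, Real.rpow_neg h2.le, ← div_eq_mul_inv, le_div_iff₀ (by positivity),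
    inv_mul_le_iff₀ (by positivity), ← Real.mul_rpow (by positivity) h3.le,
    ← Real.mul_rpow h2.le (by positivity)]
  exact Real.rpow_le_rpow h1.le (by linarith) hs

theorem exists_norm_integral_mul_japC_le (φ : 𝓢(Rn n, ℂ)) {s : ℝ} (hs : 0 ≤ s) :
    ∃ C, 0 ≤ C ∧ ∀ ξ : Rn n, ‖∫ ζ, φ (ξ - ζ) * japC s ζ‖ ≤ C * jap ξ ^ (-s) := by
  refine ⟨∫ ζ, 2 ^ s * ‖japMul s φ ζ‖, integral_nonneg fun ζ ↦ by positivity, fun ξ ↦ ?_⟩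
  have hi : Integrable fun ζ ↦ 2 ^ s * ‖japMul s φ ζ‖ :=
    (SchwartzMap.integrable _).norm.const_mul _
  rw [← integral_sub_left_eq_self (fun ζ ↦ 2 ^ s * ‖japMul s φ ζ‖) volume ξ,
    ← integral_mul_const]
  refine norm_integral_le_of_norm_le ((hi.comp_sub_left ξ).mul_const _) (ae_of_all _ fun ζ ↦ ?_)
  rw [norm_mul, norm_japC, norm_japMul_apply]
  calc ‖φ (ξ - ζ)‖ * jap ζ ^ (-s)
      ≤ ‖φ (ξ - ζ)‖ * (2 ^ s * jap (ξ - ζ) ^ s * jap ξ ^ (-s)) := by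
        gcongr; exact jap_rpow_neg_le hs ξ ζ
    _ = _ := by ring

/-- The `L²` function whose Fourier transform is `⟨ξ⟩^(-s)`. -/
def besselL {s : ℝ} (hs : (n : ℝ) < 2 * s) : L2 n := 𝓕⁻ ((memLp_japC hs).toLp : L2 n)

theorem fourierMul_besselL (φ : 𝓢(Rn n, ℂ)) {s : ℝ} (hs : (n : ℝ) < 2 * s) (ξ : Rn n) :
    fourierMul φ (besselL hs) ξ = ∫ ζ, (𝓕 φ : 𝓢(Rn n, ℂ)) (ξ - ζ) * japC s ζ := by
  rw [besselL, fourierMul_fourierInv]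
  refine integral_congr_ae ?_
  filter_upwards [(memLp_japC hs).coeFn_toLp] with ζ h
  rw [h]

/-- Derivatives of the transform are transforms with the cut-off multiplied by coordinates, which is
again a Schwartz function. So one convolution bound covers the whole jet, with no loss of decay. -/
theorem exists_jet_fourierMul_le (φ : 𝓢(Rn n, ℂ)) {s : ℝ} (hs : (n : ℝ) < 2 * s) :
    ∃ C, 0 ≤ C ∧ ∀ ξ, jet (fourierMul φ (besselL hs)) ξ ≤ C * jap ξ ^ (-s) := by
  have hs0 : 0 ≤ s := by linarith [(Nat.cast_nonneg n : (0 : ℝ) ≤ n)]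
  have key : ∀ ψ : 𝓢(Rn n, ℂ), ∃ C, 0 ≤ C ∧
      ∀ ξ, ‖fourierMul ψ (besselL hs) ξ‖ ≤ C * jap ξ ^ (-s) := fun ψ ↦ by
    simp only [fourierMul_besselL]
    exact exists_norm_integral_mul_japC_le _ hs0
  choose C hC0 hC using key
  refine ⟨C φ + ∑ i, C (mulInner (stdVec i) φ) +
    ∑ i, ∑ j, C (mulInner (stdVec i) (mulInner (stdVec j) φ)), ?_, fun ξ ↦ ?_⟩
  · exact add_nonneg (add_nonneg (hC0 _) (Finset.sum_nonneg fun i _ ↦ hC0 _))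
      (Finset.sum_nonneg fun i _ ↦ Finset.sum_nonneg fun j _ ↦ hC0 _)
  · refine (jet_fourierMul_le _ _ _).trans ?_
    simp only [add_mul, Finset.sum_mul]
    exact add_le_add (add_le_add (hC _ _) (Finset.sum_le_sum fun i _ ↦ hC _ _))
      (Finset.sum_le_sum fun i _ ↦ Finset.sum_le_sum fun j _ ↦ hC _ _)

/-! ### A radial potential with prescribed decay of its Fourier transform -/

/-- The convolution of `bumpHat` with `⟨ξ⟩^(-s)`. -/
def bumpConv (s : ℝ) (ξ : Rn n) : ℝ := ∫ ζ, bumpHat (ξ - ζ) * jap ζ ^ (-s)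

theorem fourierMul_autoBump {s : ℝ} (hs : (n : ℝ) < 2 * s) (ξ : Rn n) :
    fourierMul autoBump (besselL hs) ξ = (bumpConv s ξ : ℂ) := by
  rw [fourierMul_besselL, bumpConv, ← integral_complex_ofReal]
  refine integral_congr_ae (ae_of_all _ fun ζ ↦ ?_)
  simp only [fourier_autoBump, japC]
  push_cast; rfl

/-- Both factors are nonnegative, so the integral may be restricted to a small ball about ξ, where
⟨ζ⟩ ≤ 4⟨ξ⟩. -/
theorem exists_le_bumpConv {s : ℝ} (hs : (n : ℝ) < 2 * s) :
    ∃ c, 0 < c ∧ ∀ ξ : Rn n, c * jap ξ ^ (-s) ≤ bumpConv s ξ := by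
  have hs0 : 0 ≤ s := by linarith [(Nat.cast_nonneg n : (0 : ℝ) ≤ n)]
  obtain ⟨ρ, c, hρ, hρ1, hc, hb⟩ := exists_le_bumpHat (n := n)
  have hV : 0 < (volume : Measure (Rn n)).real (Metric.closedBall 0 ρ) :=
    ENNReal.toReal_pos (Metric.measure_closedBall_pos _ _ hρ).ne' measure_closedBall_lt_top.ne
  refine ⟨c * 4 ^ (-s) * (volume : Measure (Rn n)).real (Metric.closedBall 0 ρ), by positivity,
    fun ξ ↦ ?_⟩
  have hvol : (volume : Measure (Rn n)).real (Metric.closedBall ξ ρ) =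
      (volume : Measure (Rn n)).real (Metric.closedBall 0 ρ) := by
    simp [measureReal_def, Measure.addHaar_closedBall_center]
  have hpos : ∀ ζ, 0 ≤ bumpHat (ξ - ζ) * jap ζ ^ (-s) := fun ζ ↦
    mul_nonneg (bumpHat_nonneg _) (Real.rpow_nonneg (jap_pos ζ).le _)
  have hint : Integrable fun ζ ↦ bumpHat (ξ - ζ) * jap ζ ^ (-s) := by
    have hi : Integrable fun ζ : Rn n ↦ (𝓕 autoBump : 𝓢(Rn n, ℂ)) (ξ - ζ) :=
      (SchwartzMap.integrable _).comp_sub_left ξ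
    refine hi.norm.mono' ?_ (ae_of_all _ fun ζ ↦ ?_)
    · exact ((continuous_bumpHat.comp (continuous_const.sub continuous_id)).mul
        (continuous_jap_rpow _)).aestronglyMeasurable
    · rw [Real.norm_of_nonneg (hpos ζ), fourier_autoBump, Complex.norm_real,
        Real.norm_of_nonneg (bumpHat_nonneg _)]
      exact mul_le_of_le_one_right (bumpHat_nonneg _)
        (Real.rpow_le_one_of_one_le_of_nonpos (one_le_jap ζ) (by linarith))
  calc c * 4 ^ (-s) * (volume : Measure (Rn n)).real (Metric.closedBall 0 ρ) * jap ξ ^ (-s)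
      = ∫ _ζ in Metric.closedBall ξ ρ, c * (4 ^ (-s) * jap ξ ^ (-s)) := by
        rw [setIntegral_const, hvol, smul_eq_mul]; ring
    _ ≤ ∫ ζ in Metric.closedBall ξ ρ, bumpHat (ξ - ζ) * jap ζ ^ (-s) := by
        refine setIntegral_mono_on ((continuous_const (y := c * (4 ^ (-s) * jap ξ ^ (-s))))
          |>.continuousOn.integrableOn_compact (isCompact_closedBall ξ ρ)) hint.integrableOn
          measurableSet_closedBall fun ζ hζ ↦ ?_
        have hd : ‖ξ - ζ‖ ≤ ρ := by rw [← dist_eq_norm, dist_comm]; exact hζ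
        have h1 : jap ζ ≤ 4 * jap ξ := by
          have e1 := jap_add_le_mul ξ (ζ - ξ)
          rw [add_sub_cancel, jap_sub_comm] at e1
          have e2 := jap_le (ξ - ζ)
          nlinarith [jap_pos ξ]
        have h2 := jap_pos ζ
        have h3 := jap_pos ξ
        rw [← Real.mul_rpow (by norm_num) h3.le]
        exact mul_le_mul (hb _ hd) (Real.rpow_le_rpow_of_nonpos h2 h1 (by linarith))
          (by positivity) (bumpHat_nonneg _)
    _ ≤ bumpConv s ξ := setIntegral_le_integral hint (ae_of_all _ hpos)

/-- The test potential is the product of the autocorrelation bump and the Bessel kernel with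
transform ⟨ξ⟩^(-s). The cut-off gives compact support and a smooth transform, and since its own
transform is nonnegative the lower bound on the decay is not destroyed. -/
theorem exists_potential {s : ℝ} (hs : (n : ℝ) < 2 * s) :
    ∃ (q : L2 n) (P : Rn n → ℝ) (c C : ℝ), 0 < c ∧ 0 ≤ C ∧
      ContDiff ℝ 2 (fun ξ ↦ (P ξ : ℂ)) ∧ (∀ ξ, jet (fun ξ ↦ (P ξ : ℂ)) ξ ≤ C * jap ξ ^ (-s)) ∧
      (∀ ξ, c * jap ξ ^ (-s) ≤ P ξ) ∧ (𝓕 q : L2 n) =ᵐ[volume] (fun ξ ↦ (P ξ : ℂ)) ∧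
      IsRealValued q ∧ IsRadial q ∧ IsCompactlySupported q := by
  obtain ⟨C, hC0, hC⟩ := exists_jet_fourierMul_le (autoBump (n := n)) hs
  obtain ⟨c, hc0, hc⟩ := exists_le_bumpConv (n := n) hs
  have hfun : fourierMul autoBump (besselL hs) = fun ξ : Rn n ↦ (bumpConv s ξ : ℂ) :=
    funext (fourierMul_autoBump hs)
  obtain ⟨g, hg⟩ := exists_radial_fourierInv_ae (n := n) (radialReal_japTrunc s)
    (tendsto_japTrunc hs)
  obtain ⟨g', hg'⟩ := radialReal_autoBump (n := n)
  have hq : MemLp (fun x ↦ autoBump x * besselL hs x) 2 (volume : Measure (Rn n)) := by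
    obtain ⟨M, hM⟩ := (autoBump (n := n)).toZeroAtInfty.isBounded_range.exists_norm_le
    refine (Lp.memLp (besselL hs)).of_le_mul (c := M)
      (autoBump.continuous.aestronglyMeasurable.mul (Lp.aestronglyMeasurable _))
      (ae_of_all _ fun x ↦ ?_)
    rw [norm_mul]
    gcongr
    exact hM _ ⟨x, rfl⟩
  have hP : MemLp (fourierMul autoBump (besselL hs)) 2 (volume : Measure (Rn n)) := by
    refine (memLp_japC hs).of_le_mul (c := C)
      (contDiff_fourierMul _ _).continuous.aestronglyMeasurable (ae_of_all _ fun ξ ↦ ?_)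
    rw [norm_japC]
    exact (norm_le_jet _ _).trans (hC ξ)
  have hqe : ∀ᵐ x, (hq.toLp : L2 n) x = ((g' ‖x‖ * g ‖x‖ : ℝ) : ℂ) := by
    filter_upwards [hq.coeFn_toLp, hg] with x h1 h2
    rw [h1, hg', besselL, h2]; push_cast; rfl
  refine ⟨hq.toLp, bumpConv s, c, C, hc0, hC0, ?_, ?_, hc, ?_, ?_, ?_, 1, ?_⟩
  · rw [← hfun]; exact contDiff_fourierMul _ _
  · rw [← hfun]; exact hC
  · rw [← hfun]; exact fourier_schwartz_mul_ae _ _ _ hq.coeFn_toLp hP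
  · filter_upwards [hqe] with x h
    rw [h, Complex.ofReal_im]
  · exact ⟨fun r ↦ ((g' r * g r : ℝ) : ℂ), hqe⟩
  · filter_upwards [hq.coeFn_toLp] with x h hx
    rw [h, autoBump_eq_zero hx, zero_mul]

theorem sobolevNorm_lt_top_of_fourier {q : L2 n} {β : ℝ}
    (h : MemLp (fun ξ ↦ (dualWeight (β / 2) ξ : ℂ) * (𝓕 q : L2 n) ξ) 2 volume) :
    sobolevNorm β 0 (q : 𝓢'(Rn n, ℂ)) < ⊤ := by
  obtain ⟨u, hu, hn⟩ := exists_fourier_eq β h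
  have : u = (q : 𝓢'(Rn n, ℂ)) := by
    have h1 : 𝓕 u = 𝓕 (q : 𝓢'(Rn n, ℂ)) := by
      rw [Lp.fourier_toTemperedDistribution_eq]
      ext φ
      rw [(hu φ).2]
      simp
    have := congrArg (fun v : 𝓢'(Rn n, ℂ) ↦ 𝓕⁻ v) h1
    simpa only [fourierInv_fourier_eq] using this
  rw [← this, hn]
  exact h.2

theorem sobolevNorm_potential_lt_top {q : L2 n} {P : Rn n → ℝ} {C s β : ℝ}
    (hs : (n : ℝ) < 2 * (s - β)) (hP : (𝓕 q : L2 n) =ᵐ[volume] fun ξ ↦ (P ξ : ℂ))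
    (hc : ∀ ξ, jet (fun ξ ↦ (P ξ : ℂ)) ξ ≤ C * jap ξ ^ (-s)) :
    sobolevNorm β 0 (q : 𝓢'(Rn n, ℂ)) < ⊤ := by
  obtain ⟨D, hD0, hD⟩ := exists_dualWeight_le (n := n) (β / 2)
  refine sobolevNorm_lt_top_of_fourier ((memLp_japC hs).of_le_mul (c := D * C) ?_ ?_)
  · exact (contDiff_ofReal_dualWeight _).continuous.aestronglyMeasurable.mul
      (Lp.aestronglyMeasurable _)
  · filter_upwards [hP] with ξ h
    have h1 := jap_pos ξ
    rw [norm_mul, h, norm_japC, Complex.norm_real, Real.norm_of_nonneg (dualWeight_pos _ _).le]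
    calc dualWeight (β / 2) ξ * ‖(P ξ : ℂ)‖
        ≤ (D * jap ξ ^ (2 * (β / 2))) * (C * jap ξ ^ (-s)) :=
          mul_le_mul (hD ξ) ((norm_le_jet (fun ξ ↦ (P ξ : ℂ)) ξ).trans (hc ξ)) (norm_nonneg _) (by positivity)
      _ = D * C * (jap ξ ^ (2 * (β / 2)) * jap ξ ^ (-s)) := by ring
      _ = D * C * jap ξ ^ (-(s - β)) := by
          rw [← Real.rpow_add h1]; congr 2; ring

/-! ### The double dispersion operator for potentials with smooth decaying Fourier transform -/

theorem integrable_jap_sq {s : ℝ} (hs : (n : ℝ) < 2 * s) :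
    Integrable fun ξ : Rn n ↦ (jap ξ ^ (-s)) ^ 2 := by
  have h := (memLp_japC hs).integrable_norm_pow (by norm_num)
  simpa only [norm_japC] using h

theorem integrable_jap_mul_sub {s : ℝ} (hs : (n : ℝ) < 2 * s) (v w : Rn n) :
    Integrable fun ξ : Rn n ↦ jap (w - ξ) ^ (-s) * jap (ξ - v) ^ (-s) := by
  have h : MemLp (fun ξ : Rn n ↦ jap ξ ^ (-s)) 2 volume := by
    simpa only [norm_japC] using (memLp_japC hs).norm
  exact integrable_mul_sub h h v w

theorem integral_jap_mul_sub_le {s : ℝ} (hs : (n : ℝ) < 2 * s) (v w : Rn n) :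
    ∫ ξ : Rn n, jap (w - ξ) ^ (-s) * jap (ξ - v) ^ (-s) ≤
      2 * ∫ ξ : Rn n, (jap ξ ^ (-s)) ^ 2 := by
  have h := integrable_jap_sq hs
  have h1 := h.comp_sub_left w
  have h2 := h.comp_sub_right v
  calc ∫ ξ : Rn n, jap (w - ξ) ^ (-s) * jap (ξ - v) ^ (-s)
      ≤ ∫ ξ : Rn n, ((jap (w - ξ) ^ (-s)) ^ 2 + (jap (ξ - v) ^ (-s)) ^ 2) :=
        integral_mono (integrable_jap_mul_sub hs v w) (h1.add h2) fun ξ ↦ by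
          nlinarith [sq_nonneg (jap (w - ξ) ^ (-s) - jap (ξ - v) ^ (-s)),
            sq_nonneg (jap (w - ξ) ^ (-s)), sq_nonneg (jap (ξ - v) ^ (-s))]
    _ = 2 * ∫ ξ : Rn n, (jap ξ ^ (-s)) ^ 2 := by
        rw [integral_add h1 h2, integral_sub_left_eq_self (fun ξ : Rn n ↦ (jap ξ ^ (-s)) ^ 2),
          integral_sub_right_eq_self (fun ξ : Rn n ↦ (jap ξ ^ (-s)) ^ 2)]
        ring

section decay

variable {f : Rn n → ℂ} {C s : ℝ}

theorem contDiff_mul_sub (hf : ContDiff ℝ 2 f) (v w : Rn n) :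
    ContDiff ℝ 2 fun ξ ↦ f (w - ξ) * f (ξ - v) := by fun_prop

theorem jet_mul_sub_le_jap (hf : ContDiff ℝ 2 f) (hC : 0 ≤ C)
    (hj : ∀ ξ, jet f ξ ≤ C * jap ξ ^ (-s)) (v w ξ : Rn n) :
    jet (fun y ↦ f (w - y) * f (y - v)) ξ ≤
      2 * C ^ 2 * (jap (w - ξ) ^ (-s) * jap (ξ - v) ^ (-s)) := by
  have h1 := jap_pos (w - ξ)
  calc jet (fun y ↦ f (w - y) * f (y - v)) ξ
      ≤ 2 * jet f (w - ξ) * jet f (ξ - v) := jet_mul_sub_le hf hf v w ξ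
    _ ≤ 2 * (C * jap (w - ξ) ^ (-s)) * (C * jap (ξ - v) ^ (-s)) := by
        have := jet_nonneg f (ξ - v)
        exact mul_le_mul (mul_le_mul_of_nonneg_left (hj _) (by norm_num)) (hj _) this
          (by positivity)
    _ = _ := by ring

theorem integrable_jet_mul_sub (hf : ContDiff ℝ 2 f) (hC : 0 ≤ C)
    (hj : ∀ ξ, jet f ξ ≤ C * jap ξ ^ (-s)) (hs : (n : ℝ) < 2 * s) (v w : Rn n) :
    Integrable (jet fun y ↦ f (w - y) * f (y - v)) := by
  refine ((integrable_jap_mul_sub hs v w).const_mul (2 * C ^ 2)).mono'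
    (continuous_jet (contDiff_mul_sub hf v w)).aestronglyMeasurable (ae_of_all _ fun ξ ↦ ?_)
  rw [Real.norm_of_nonneg (jet_nonneg _ _)]
  exact jet_mul_sub_le_jap hf hC hj v w ξ

theorem integrable_mul_sub_of_jet (hf : ContDiff ℝ 2 f) (hC : 0 ≤ C)
    (hj : ∀ ξ, jet f ξ ≤ C * jap ξ ^ (-s)) (hs : (n : ℝ) < 2 * s) (v w : Rn n) :
    Integrable fun y ↦ f (w - y) * f (y - v) :=
  (integrable_jet_mul_sub hf hC hj hs v w).mono'
    (contDiff_mul_sub hf v w).continuous.aestronglyMeasurable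
    (ae_of_all _ fun ξ ↦ norm_le_jet (fun y ↦ f (w - y) * f (y - v)) ξ)

/-- The converse concerns the whole of Q and not its high-frequency part, so small wave numbers must
be allowed. The singularity κ^(-1/2) is harmless, being square integrable near the origin in
dimension at least two. -/
theorem exists_norm_resForm_le (hn : 2 ≤ n) (hf : ContDiff ℝ 2 f) (hC : 0 ≤ C)
    (hj : ∀ ξ, jet f ξ ≤ C * jap ξ ^ (-s)) (hs : (n : ℝ) < 2 * s) :
    ∃ D, 0 ≤ D ∧ ∀ κ ε : ℝ, 0 < κ → 0 < ε → ∀ v w : Rn n,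
      ‖resForm κ ε v w f f‖ ≤ D * (1 + κ ^ (-(1 / 2) : ℝ)) := by
  obtain ⟨C₁, hC₁, h₁⟩ := exists_norm_integral_res_le hn one_pos
  obtain ⟨C₂, hC₂, h₂⟩ := exists_norm_integral_res_le_rpow hn one_pos
  have hs0 : 0 ≤ s := by linarith [(Nat.cast_nonneg n : (0 : ℝ) ≤ n)]
  set J := ∫ ξ : Rn n, (jap ξ ^ (-s)) ^ 2 with hJ
  have hJ0 : 0 ≤ J := integral_nonneg fun ξ ↦ sq_nonneg _
  set M := 2 * C ^ 2 * (2 * J) with hM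
  set M' := 2 * C ^ 2 * (2 * J + 1) with hM'
  have hjle : ∀ v w ξ : Rn n, jet (fun y ↦ f (w - y) * f (y - v)) ξ ≤ M' := fun v w ξ ↦ by
    refine (jet_mul_sub_le_jap hf hC hj v w ξ).trans ?_
    rw [hM']
    gcongr
    have := mul_le_one₀ (Real.rpow_le_one_of_one_le_of_nonpos (one_le_jap (w - ξ))
      (show -s ≤ 0 by linarith)) (Real.rpow_nonneg (jap_pos (ξ - v)).le _)
      (Real.rpow_le_one_of_one_le_of_nonpos (one_le_jap (ξ - v)) (show -s ≤ 0 by linarith))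
    linarith
  have hjint : ∀ v w : Rn n, ∫ ξ, jet (fun y ↦ f (w - y) * f (y - v)) ξ ≤ M := fun v w ↦ by
    refine (integral_mono (integrable_jet_mul_sub hf hC hj hs v w)
      ((integrable_jap_mul_sub hs v w).const_mul (2 * C ^ 2))
      (jet_mul_sub_le_jap hf hC hj v w)).trans ?_
    rw [integral_const_mul, hM]
    exact mul_le_mul_of_nonneg_left (integral_jap_mul_sub_le hs v w) (by positivity)
  refine ⟨C₁ * M + C₂ * M', by positivity, fun κ ε hκ hε v w ↦ ?_⟩
  have hcd := contDiff_mul_sub hf v w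
  have hji := integrable_jet_mul_sub hf hC hj hs v w
  have hκ2 : 0 ≤ κ ^ (-(1 / 2) : ℝ) := by positivity
  rcases le_or_gt 1 κ with h | h
  · have hb : ‖resForm κ ε v w f f‖ ≤ C₁ * M := by
      refine (h₁ κ h _ hcd hji ε hε).trans (mul_le_mul_of_nonneg_left ?_ hC₁)
      refine le_trans ?_ (hjint v w)
      refine integral_mono_of_nonneg (ae_of_all _ fun ξ ↦ mul_nonneg (jet_nonneg _ _)
        (kerK_nonneg hκ (norm_nonneg _))) hji (ae_of_all _ fun ξ ↦ ?_)
      refine mul_le_of_le_one_right (jet_nonneg _ _) ((kerK_le hκ (norm_nonneg ξ)).trans ?_)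
      exact inv_le_one_of_one_le₀ h
    have h3 : 0 ≤ C₂ * M' := by positivity
    have h4 : 0 ≤ C₁ * M := by positivity
    nlinarith [mul_nonneg (add_nonneg h4 h3) hκ2]
  · have hb : ‖resForm κ ε v w f f‖ ≤ C₂ * M' * κ ^ (-(1 / 2) : ℝ) := by
      refine h₂ κ hκ h.le _ (hcd.of_le (by norm_num))
        (integrable_mul_sub_of_jet hf hC hj hs v w) M'
        (fun ξ ↦ (norm_le_jet (fun y ↦ f (w - y) * f (y - v)) ξ).trans (hjle v w ξ)) (fun ξ ↦ ?_) ?_ ε hε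
      · refine le_trans ?_ (hjle v w ξ)
        unfold jet
        have := norm_nonneg (fderiv ℝ (fderiv ℝ fun y ↦ f (w - y) * f (y - v)) ξ)
        have := norm_nonneg (f (w - ξ) * f (ξ - v))
        linarith
      · refine (integral_mono_of_nonneg (ae_of_all _ fun _ ↦ norm_nonneg _) hji
          (ae_of_all _ fun ξ ↦ norm_le_jet (fun y ↦ f (w - y) * f (y - v)) ξ)).trans ((hjint v w).trans ?_)
        rw [hM, hM']; gcongr; linarith
    have h3 : 0 ≤ C₂ * M' := by positivity
    have h4 : 0 ≤ C₁ * M := by positivity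
    nlinarith [mul_nonneg h4 hκ2]

theorem quadB_congr {ε : ℝ} {θ η : Rn n} {f g : Rn n → ℂ} (h : f =ᵐ[volume] g) :
    quadB ε θ f η = quadB ε θ g η := resForm_congr h h

theorem exists_isB_of_contDiff (hn : 2 ≤ n) (hf : ContDiff ℝ 2 f) (hC : 0 ≤ C)
    (hj : ∀ ξ, jet f ξ ≤ C * jap ξ ^ (-s)) (hs : (n : ℝ) < 2 * s) {q : L2 n}
    (hq : (𝓕 q : L2 n) =ᵐ[volume] f) (θ η : Rn n) : ∃ b, IsB θ q η b := by
  rcases lt_or_ge (inner ℝ η θ) 0 with h | h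
  · refine exists_isB_of_quadB h ?_
    simp only [quadB_congr hq]
    exact exists_tendsto_integral_res hn ((contDiff_mul_sub hf _ _).of_le (by norm_num))
      (integrable_mul_sub_of_jet hf hC hj hs _ _)
      (div_pos (waveNumber_pos h) (by positivity))
  · exact ⟨0, isB_zero q h⟩

theorem norm_le_waveNumber_div {θ ξ : Rn n} (hθ : ‖θ‖ = 1)
    (h : inner ℝ ((2 * Real.pi) • ξ) θ < 0) :
    ‖ξ‖ ≤ waveNumber θ ((2 * Real.pi) • ξ) / (2 * Real.pi) := by
  have := norm_le_waveNumber hθ h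
  rw [norm_smul, Real.norm_of_nonneg (by positivity)] at this
  rw [le_div_iff₀ (by positivity)]
  linarith

theorem exists_norm_limB_le (hn : 2 ≤ n) (hf : ContDiff ℝ 2 f) (hC : 0 ≤ C)
    (hj : ∀ ξ, jet f ξ ≤ C * jap ξ ^ (-s)) (hs : (n : ℝ) < 2 * s) {q : L2 n}
    (hq : (𝓕 q : L2 n) =ᵐ[volume] f) : ∃ D, 0 ≤ D ∧ ∀ θ : Rn n, ‖θ‖ = 1 → ∀ ξ : Rn n,
      ‖limB θ q ((2 * Real.pi) • ξ)‖ ≤ D * (1 + ‖ξ‖ ^ (-(1 / 2) : ℝ)) := by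
  obtain ⟨D, hD, hb⟩ := exists_norm_resForm_le hn hf hC hj hs
  refine ⟨D, hD, fun θ hθ ξ ↦ ?_⟩
  rcases lt_or_ge (inner ℝ ((2 * Real.pi) • ξ) θ) 0 with h | h
  · have hlim := isB_limB_of_exists (exists_isB_of_contDiff hn hf hC hj hs hq θ
      ((2 * Real.pi) • ξ))
    refine le_of_tendsto hlim.norm ?_
    filter_upwards [self_mem_nhdsWithin] with ε (hε : 0 < ε)
    have hξ : 0 < ‖ξ‖ := norm_pos_iff.2 (by rintro rfl; simp at h)
    rw [regB_eq_quadB hε q h, norm_mul, quadB_congr hq]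
    refine (mul_le_of_le_one_left (norm_nonneg _) norm_inv_fourPiSq_le).trans ?_
    refine (hb _ _ (div_pos (waveNumber_pos h) (by positivity)) (by positivity) _ _).trans ?_
    have := Real.rpow_le_rpow_of_nonpos hξ (norm_le_waveNumber_div hθ h)
      (show (-(1 / 2) : ℝ) ≤ 0 by norm_num)
    gcongr
  · rw [limB_of_nonneg q h, norm_zero]
    positivity

theorem sq_one_add_rpow_le {r : ℝ} (h0 : 0 < r) :
    (1 + r ^ (-(1 / 2) : ℝ)) ^ 2 ≤ 2 * (1 + r⁻¹) := by
  have h1 : (r ^ (-(1 / 2) : ℝ)) ^ 2 = r⁻¹ := by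
    rw [← Real.rpow_natCast, ← Real.rpow_mul h0.le, ← Real.rpow_neg_one]
    norm_num
  nlinarith [sq_nonneg (1 - r ^ (-(1 / 2) : ℝ))]

/-- The square of the singularity is |ξ|⁻¹, dominated by |ξ|^(-3/2) on the unit ball; at infinity
the weight of order −2n is far more than enough. This makes Q a tempered distribution. -/
theorem memLp_dualWeight_mul (hn : 2 ≤ n) {F : Rn n → ℂ} {D : ℝ} (hF : Measurable F)
    (hb : ∀ ξ, ‖F ξ‖ ≤ D * (1 + ‖ξ‖ ^ (-(1 / 2) : ℝ))) :
    MemLp (fun ξ ↦ (dualWeight ((-(2 * n) : ℝ) / 2) ξ : ℂ) * F ξ) 2 volume := by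
  have hm : AEStronglyMeasurable (fun ξ ↦ (dualWeight ((-(2 * n) : ℝ) / 2) ξ : ℂ) * F ξ)
      (volume : Measure (Rn n)) :=
    ((contDiff_ofReal_dualWeight _).continuous.measurable.mul hF).aestronglyMeasurable
  have hn' : (0 : ℝ) < n := by exact_mod_cast (by omega : 0 < n)
  refine (memLp_two_iff_integrable_sq_norm hm).2 ?_
  have hi := ((integrable_indicator_norm_rpow hn).add (integrable_jap_sq (n := n) (s := n)
    (by linarith))).const_mul (4 * D ^ 2)
  refine hi.mono' (hm.norm.pow 2) ?_
  have hnt : Nontrivial (Rn n) := by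
    have : Nonempty (Fin n) := ⟨⟨0, by omega⟩⟩
    infer_instance
  filter_upwards [compl_mem_ae_iff.2 (measure_singleton (μ := (volume : Measure (Rn n))) 0)]
    with ξ hξ
  have hr : 0 < ‖ξ‖ := norm_pos_iff.2 hξ
  have hw0 := dualWeight_pos ((-(2 * n) : ℝ) / 2) ξ
  have hw1 : dualWeight ((-(2 * n) : ℝ) / 2) ξ ≤ jap ξ ^ (-(n : ℝ)) := by
    refine (dualWeight_mono (t := -(n / 2 : ℝ)) (by linarith) ξ).trans ?_
    exact dualWeight_le_jap hn'.le ξ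
  have hw2 : jap ξ ^ (-(n : ℝ)) ≤ 1 :=
    Real.rpow_le_one_of_one_le_of_nonpos (one_le_jap ξ) (by linarith)
  have hj0 : 0 < jap ξ ^ (-(n : ℝ)) := Real.rpow_pos_of_pos (jap_pos ξ) _
  rw [Real.norm_of_nonneg (by positivity), norm_mul, Complex.norm_real,
    Real.norm_of_nonneg hw0.le, mul_pow]
  have hF2 : ‖F ξ‖ ^ 2 ≤ D ^ 2 * (2 * (1 + ‖ξ‖⁻¹)) := by
    refine (pow_le_pow_left₀ (norm_nonneg _) (hb ξ) 2).trans ?_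
    rw [mul_pow]
    exact mul_le_mul_of_nonneg_left (sq_one_add_rpow_le hr) (sq_nonneg _)
  have hw3 : dualWeight ((-(2 * n) : ℝ) / 2) ξ ^ 2 ≤ (jap ξ ^ (-(n : ℝ))) ^ 2 :=
    pow_le_pow_left₀ hw0.le hw1 2
  simp only [Pi.add_apply]
  by_cases hb1 : ξ ∈ Metric.ball (0 : Rn n) 1
  · rw [Set.indicator_of_mem hb1]
    have h1 : ‖ξ‖ < 1 := by simpa using hb1
    have h2 : ‖ξ‖⁻¹ ≤ ‖ξ‖ ^ (-(3 / 2) : ℝ) := by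
      rw [← Real.rpow_neg_one]
      exact Real.rpow_le_rpow_of_exponent_ge hr h1.le (by norm_num)
    have h3 : 1 ≤ ‖ξ‖⁻¹ := (one_le_inv₀ hr).2 h1.le
    have h4 : dualWeight ((-(2 * n) : ℝ) / 2) ξ ^ 2 ≤ 1 :=
      hw3.trans (pow_le_one₀ hj0.le hw2)
    calc dualWeight ((-(2 * n) : ℝ) / 2) ξ ^ 2 * ‖F ξ‖ ^ 2
        ≤ 1 * (D ^ 2 * (2 * (1 + ‖ξ‖⁻¹))) := mul_le_mul h4 hF2 (by positivity) (by norm_num)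
      _ ≤ 4 * D ^ 2 * (‖ξ‖ ^ (-(3 / 2) : ℝ)) := by nlinarith [sq_nonneg D]
      _ ≤ _ := by gcongr; exact le_add_of_nonneg_right (sq_nonneg _)
  · rw [Set.indicator_of_notMem hb1, zero_add]
    have h1 : 1 ≤ ‖ξ‖ := by simpa using hb1
    have h3 : ‖ξ‖⁻¹ ≤ 1 := inv_le_one_of_one_le₀ h1
    calc dualWeight ((-(2 * n) : ℝ) / 2) ξ ^ 2 * ‖F ξ‖ ^ 2
        ≤ (jap ξ ^ (-(n : ℝ))) ^ 2 * (D ^ 2 * (2 * (1 + 1))) :=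
          mul_le_mul hw3 (hF2.trans (by gcongr)) (by positivity) (by positivity)
      _ = _ := by ring

/-- The assumption of the converse speaks of distributions that represent Q. Such a distribution has
to be exhibited for the test potential before anything can be inferred. -/
theorem exists_isQ (hn : 2 ≤ n) (hf : ContDiff ℝ 2 f) (hC : 0 ≤ C)
    (hj : ∀ ξ, jet f ξ ≤ C * jap ξ ^ (-s)) (hs : (n : ℝ) < 2 * s) {q : L2 n}
    (hq : (𝓕 q : L2 n) =ᵐ[volume] f) {θ : Rn n} (hθ : ‖θ‖ = 1) :
    ∃ u : 𝓢'(Rn n, ℂ), IsQ θ q u ∧ ∀ φ : 𝓢(Rn n, ℂ),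
      Integrable (fun ξ ↦ φ ξ * (limB θ q ((2 * Real.pi) • ξ) +
        limB (-θ) q ((2 * Real.pi) • ξ))) ∧
      𝓕 u φ = ∫ ξ, φ ξ * (limB θ q ((2 * Real.pi) • ξ) + limB (-θ) q ((2 * Real.pi) • ξ)) := by
  obtain ⟨D, hD, hb⟩ := exists_norm_limB_le hn hf hC hj hs hq
  have hsm : Measurable fun ξ : Rn n ↦ (2 * Real.pi) • ξ := measurable_const_smul _
  have hm := memLp_dualWeight_mul hn (F := fun ξ ↦ limB θ q ((2 * Real.pi) • ξ) +
    limB (-θ) q ((2 * Real.pi) • ξ)) (D := 2 * D)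
    (((stronglyMeasurable_limB θ q).measurable.comp hsm).add
      ((stronglyMeasurable_limB (-θ) q).measurable.comp hsm)) fun ξ ↦ by
    refine (norm_add_le _ _).trans ?_
    have h1 := hb θ hθ ξ
    have h2 := hb (-θ) (by rwa [norm_neg]) ξ
    linarith
  obtain ⟨u, hu, -⟩ := exists_fourier_eq _ hm
  refine ⟨u, ⟨fun η ↦ limB θ q η + limB (-θ) q η, ae_of_all _ fun η _ ↦ ⟨_, _,
    isB_limB_of_exists (exists_isB_of_contDiff hn hf hC hj hs hq θ η),
    isB_limB_of_exists (exists_isB_of_contDiff hn hf hC hj hs hq (-θ) η), rfl⟩,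
    fun φ ↦ ?_⟩, hu⟩
  simpa only [Complex.ofReal_one, one_mul] using hu φ

end decay

/-! ### Lower bounds for the imaginary part of the double dispersion operator -/

/-- The Poisson-type kernel `-Im (κ² - r² + iε)⁻¹`. -/
def lor (κ ε r : ℝ) : ℝ := ε / ((κ ^ 2 - r ^ 2) ^ 2 + ε ^ 2)

theorem im_res (κ ε r : ℝ) : (res κ ε r).im = -lor κ ε r := by
  rw [res_eq, Complex.sub_im, Complex.ofReal_im, Complex.im_ofReal_mul, Complex.I_im, mul_one,
    zero_sub, lor]

theorem lor_nonneg (κ : ℝ) {ε : ℝ} (hε : 0 < ε) (r : ℝ) : 0 ≤ lor κ ε r := by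
  unfold lor; positivity

theorem continuous_lor (κ : ℝ) {ε : ℝ} (hε : 0 < ε) : Continuous (lor κ ε) := by
  unfold lor
  exact continuous_const.div (by fun_prop) fun r ↦ by positivity

theorem lor_le (κ : ℝ) {ε : ℝ} (hε : 0 < ε) (r : ℝ) : lor κ ε r ≤ ε⁻¹ := by
  have := (Complex.abs_im_le_norm _).trans (norm_res_le_inv_eps κ hε r)
  rw [im_res, abs_neg] at this
  exact (le_abs_self _).trans this

/-- The mass of the Poisson-type kernel across the shell, at least π/4 as soon as ε ≤ d. -/
theorem integral_mul_lor {κ d a b : ℝ} (ha : a ^ 2 = κ ^ 2 - d) (hb : b ^ 2 = κ ^ 2 + d)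
    {ε : ℝ} (hε : 0 < ε) : ∫ r in a..b, r * lor κ ε r = Real.arctan (d / ε) := by
  have h := congrArg (fun z : ℂ ↦ -z.im) (integral_mul_res ha hb hε)
  have hi : IntervalIntegrable (fun r : ℝ ↦ (r : ℂ) * res κ ε r) volume a b :=
    (Complex.continuous_ofReal.mul (continuous_res κ hε)).intervalIntegrable a b
  have h1 := Complex.imCLM.intervalIntegral_comp_comm hi
  simp only [Complex.imCLM_apply, Complex.im_ofReal_mul, im_res] at h1
  simp only [← h1] at h
  rw [← intervalIntegral.integral_neg, Complex.neg_im, Complex.I_mul_im, Complex.ofReal_re,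
    neg_neg] at h
  simpa only [mul_neg, neg_neg] using h

theorem integrable_mul_lor {F : Rn n → ℝ} (hF : Integrable F) (κ : ℝ) {ε : ℝ} (hε : 0 < ε) :
    Integrable fun ξ ↦ F ξ * lor κ ε ‖ξ‖ := by
  refine hF.mul_bdd (c := ε⁻¹) ((continuous_lor κ hε).comp continuous_norm).aestronglyMeasurable
    (ae_of_all _ fun ξ ↦ ?_)
  rw [Real.norm_of_nonneg (lor_nonneg κ hε _)]
  exact lor_le κ hε _

/-- With real P only the imaginary part of the symbol contributes. For P ≥ 0 the integrand is
nonnegative and any part of the domain may be discarded. -/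
theorem neg_im_resForm {P : Rn n → ℝ} (κ : ℝ) {ε : ℝ} (hε : 0 < ε) (v w : Rn n)
    (hi : Integrable fun ξ ↦ (P (w - ξ) : ℂ) * (P (ξ - v) : ℂ)) :
    -(resForm κ ε v w (fun ξ ↦ (P ξ : ℂ)) fun ξ ↦ (P ξ : ℂ)).im =
      ∫ ξ, P (w - ξ) * P (ξ - v) * lor κ ε ‖ξ‖ := by
  have h := Complex.imCLM.integral_comp_comm (integrable_mul_res hi κ hε)
  rw [resForm, ← Complex.imCLM_apply, ← h, ← integral_neg]
  refine integral_congr_ae (ae_of_all _ fun ξ ↦ ?_)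
  simp only [← Complex.ofReal_mul, Complex.imCLM_apply, Complex.im_ofReal_mul, im_res]
  ring

/-- Only radii in [a, b] and directions in E are kept. One factor r of the Jacobian supplies the
mass of the kernel, the other m powers are at least a^m. -/
theorem le_integral_mul_lor {m : ℕ} {F : Rn (m + 2) → ℝ} (hF0 : ∀ ξ, 0 ≤ F ξ) (hFc : Continuous F)
    (hF : Integrable F) {κ d a b M : ℝ} (ha0 : 0 < a) (hab : a ≤ b) (ha : a ^ 2 = κ ^ 2 - d)
    (hb : b ^ 2 = κ ^ 2 + d) {E : Set (Metric.sphere (0 : Rn (m + 2)) 1)}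
    (hE : MeasurableSet E) (hFE : ∀ e ∈ E, ∀ r ∈ Set.Icc a b, M ≤ F (r • (e : Rn (m + 2))))
    {ε : ℝ} (hε : 0 < ε) :
    M * a ^ m * Real.arctan (d / ε) * (sphereMeasure (m + 2)).real E ≤
      ∫ ξ, F ξ * lor κ ε ‖ξ‖ := by
  have hi := integrable_mul_lor hF κ hε
  have hpos : ∀ ξ, 0 ≤ F ξ * lor κ ε ‖ξ‖ := fun ξ ↦ mul_nonneg (hF0 ξ) (lor_nonneg κ hε _)
  have hG := integrable_annulus ha0 hab hi.integrableOn
  set G : Metric.sphere (0 : Rn (m + 2)) 1 → ℝ := fun e ↦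
    ∫ r in a..b, r ^ (m + 2 - 1) • (F (r • (e : Rn (m + 2))) * lor κ ε ‖r • (e : Rn (m + 2))‖)
    with hGdef
  have hG0 : ∀ e, 0 ≤ G e := fun e ↦ intervalIntegral.integral_nonneg hab fun r hr ↦
    smul_nonneg (pow_nonneg (ha0.le.trans hr.1) _) (hpos _)
  have hGE : ∀ e ∈ E, M * a ^ m * Real.arctan (d / ε) ≤ G e := fun e he ↦ by
    rw [← integral_mul_lor ha hb hε, ← intervalIntegral.integral_const_mul]
    refine intervalIntegral.integral_mono_on hab ?_ ?_ fun r hr ↦ ?_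
    · exact (continuous_const.mul (continuous_id.mul (continuous_lor κ hε))).intervalIntegrable _ _
    · have := continuous_lor κ hε
      exact Continuous.intervalIntegrable (by fun_prop) _ _
    · have hr0 : 0 < r := ha0.trans_le hr.1
      have he1 : ‖r • (e : Rn (m + 2))‖ = r := by
        rw [norm_smul, norm_eq_of_mem_sphere, mul_one, Real.norm_of_nonneg hr0.le]
      rw [he1, smul_eq_mul, Nat.add_sub_assoc (by norm_num : 1 ≤ 2), pow_succ]
      have h1 := hFE e he r hr
      have h2 := lor_nonneg κ hε r
      have h3 : a ^ m ≤ r ^ m := pow_le_pow_left₀ ha0.le hr.1 m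
      calc M * a ^ m * (r * lor κ ε r) ≤ F (r • (e : Rn (m + 2))) * r ^ m * (r * lor κ ε r) := by
            gcongr
            exact hF0 _
        _ = _ := by ring
  calc M * a ^ m * Real.arctan (d / ε) * (sphereMeasure (m + 2)).real E
      = ∫ _e in E, M * a ^ m * Real.arctan (d / ε) ∂sphereMeasure (m + 2) := by
        rw [setIntegral_const, smul_eq_mul, mul_comm]
    _ ≤ ∫ e in E, G e ∂sphereMeasure (m + 2) :=
        setIntegral_mono_on (integrable_const _) hG.integrableOn hE hGE
    _ ≤ ∫ e, G e ∂sphereMeasure (m + 2) := setIntegral_le_integral hG (ae_of_all _ hG0)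
    _ = ∫ ξ in annulus (m + 2) a b, F ξ * lor κ ε ‖ξ‖ :=
        (integral_annulus (by omega) ha0 hab hi.integrableOn).symm
    _ ≤ ∫ ξ, F ξ * lor κ ε ‖ξ‖ := setIntegral_le_integral hi (ae_of_all _ hpos)

/-- The cap of angular size `1/(2κ)` about `θ`. -/
def cap (κ : ℝ) (θ : Rn n) : Set (Metric.sphere (0 : Rn n) 1) :=
  {e | ‖(e : Rn n) - θ‖ ≤ (1 / 2) / κ}

theorem measurableSet_cap (κ : ℝ) (θ : Rn n) : MeasurableSet (cap κ θ) :=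
  measurableSet_le (by fun_prop) measurable_const

/-- The ball of radius 1/4 about κθ projects radially into the cap. Its volume is a constant, and
polar coordinates bound it by a multiple of κ^(n−1) times the measure of the cap. -/
theorem exists_le_sphereMeasure_cap (hn : 2 ≤ n) : ∃ c, 0 < c ∧ ∀ κ, 1 ≤ κ → ∀ θ : Rn n, ‖θ‖ = 1 →
    c * (κ ^ (n - 1))⁻¹ ≤ (sphereMeasure n).real (cap κ θ) := by
  set V := (volume : Measure (Rn n)).real (Metric.closedBall 0 (1 / 4)) with hV
  have hV0 : 0 < V := ENNReal.toReal_pos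
    (Metric.measure_closedBall_pos _ _ (by norm_num)).ne' measure_closedBall_lt_top.ne
  refine ⟨V * (2 ^ (n - 1))⁻¹, by positivity, fun κ hκ θ hθ ↦ ?_⟩
  set S := Metric.closedBall (κ • θ) (1 / 4) with hS
  have hκ0 : 0 < κ := one_pos.trans_le hκ
  have ha : 0 < κ - 1 / 4 := by linarith
  have hab : κ - 1 / 4 ≤ κ + 1 / 4 := by linarith
  have hi : Integrable (S.indicator fun _ ↦ (1 : ℝ)) :=
    (integrable_indicator_iff measurableSet_closedBall).2
      (integrableOn_const measure_closedBall_lt_top.ne)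
  have hnorm : ‖κ • θ‖ = κ := by rw [norm_smul, hθ, mul_one, Real.norm_of_nonneg hκ0.le]
  have hsub : S ⊆ annulus n (κ - 1 / 4) (κ + 1 / 4) := fun x hx ↦ by
    have h1 : ‖x - κ • θ‖ ≤ 1 / 4 := by rw [← dist_eq_norm]; exact hx
    have h2 := abs_norm_sub_norm_le x (κ • θ)
    rw [hnorm] at h2
    have h3 := abs_le.1 (h2.trans h1)
    exact ⟨by linarith [h3.1], by linarith [h3.2]⟩
  have hG := integrable_annulus ha hab hi.integrableOn
  have hle : V ≤ (κ + 1 / 4) ^ (n - 1) * (sphereMeasure n).real (cap κ θ) := by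
    calc V = ∫ x, S.indicator (fun _ ↦ (1 : ℝ)) x := by
          rw [integral_indicator measurableSet_closedBall, setIntegral_const, smul_eq_mul, mul_one,
            hV, measureReal_def, measureReal_def,
            ← Measure.addHaar_closedBall_center volume (κ • θ)]
      _ = ∫ x in annulus n (κ - 1 / 4) (κ + 1 / 4), S.indicator (fun _ ↦ (1 : ℝ)) x := by
          refine (setIntegral_eq_integral_of_forall_compl_eq_zero fun x hx ↦ ?_).symm
          exact Set.indicator_of_notMem (fun h ↦ hx (hsub h)) _
      _ = ∫ e, (∫ r in (κ - 1 / 4)..(κ + 1 / 4), r ^ (n - 1) •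
            S.indicator (fun _ ↦ (1 : ℝ)) (r • (e : Rn n))) ∂sphereMeasure n :=
          integral_annulus (by omega) ha hab hi.integrableOn
      _ ≤ ∫ e, (cap κ θ).indicator (fun _ ↦ (κ + 1 / 4) ^ (n - 1)) e ∂sphereMeasure n := by
          refine integral_mono hG ((integrable_const _).indicator (measurableSet_cap κ θ))
            fun e ↦ ?_
          by_cases he : e ∈ cap κ θ
          · rw [Set.indicator_of_mem he]
            have hb : ‖∫ r in (κ - 1 / 4)..(κ + 1 / 4), r ^ (n - 1) •
                S.indicator (fun _ ↦ (1 : ℝ)) (r • (e : Rn n))‖ ≤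
                (κ + 1 / 4) ^ (n - 1) * |κ + 1 / 4 - (κ - 1 / 4)| := by
              refine intervalIntegral.norm_integral_le_of_norm_le_const fun r hr ↦ ?_
              rw [Set.uIoc_of_le hab] at hr
              have hr0 : 0 ≤ r := ha.le.trans hr.1.le
              rw [norm_smul, norm_pow, Real.norm_of_nonneg hr0]
              have h1 : ‖S.indicator (fun _ ↦ (1 : ℝ)) (r • (e : Rn n))‖ ≤ 1 :=
                (norm_indicator_le_norm_self _ _).trans (by simp)
              calc _ ≤ (κ + 1 / 4) ^ (n - 1) * 1 :=
                    mul_le_mul (pow_le_pow_left₀ hr0 hr.2 _) h1 (norm_nonneg _) (by positivity)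
                _ = _ := mul_one _
            refine (le_abs_self _).trans (hb.trans ?_)
            have : |κ + 1 / 4 - (κ - 1 / 4)| = 1 / 2 := by rw [abs_of_nonneg] <;> linarith
            rw [this]
            have : 0 ≤ (κ + 1 / 4) ^ (n - 1) := by positivity
            linarith
          · rw [Set.indicator_of_notMem he]
            refine le_of_eq ?_
            refine intervalIntegral.integral_zero_ae (ae_of_all _ fun r hr ↦ ?_)
            rw [Set.uIoc_of_le hab] at hr
            rw [Set.indicator_of_notMem, smul_zero]
            intro hmem
            apply he
            have h1 : ‖r • (e : Rn n) - κ • θ‖ ≤ 1 / 4 := by rw [← dist_eq_norm]; exact hmem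
            have h2 : κ • ((e : Rn n) - θ) = (r • (e : Rn n) - κ • θ) - (r - κ) • (e : Rn n) := by
              module
            have h3 : ‖κ • ((e : Rn n) - θ)‖ ≤ 1 / 4 + 1 / 4 := by
              rw [h2]
              refine (norm_sub_le _ _).trans (add_le_add h1 ?_)
              rw [norm_smul, norm_eq_of_mem_sphere, mul_one, Real.norm_eq_abs, abs_le]
              constructor <;> linarith [hr.1, hr.2]
            rw [norm_smul, Real.norm_of_nonneg hκ0.le] at h3
            change ‖(e : Rn n) - θ‖ ≤ (1 / 2) / κ
            rw [le_div_iff₀ hκ0]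
            linarith
      _ = (κ + 1 / 4) ^ (n - 1) * (sphereMeasure n).real (cap κ θ) := by
          rw [integral_indicator (measurableSet_cap κ θ), setIntegral_const, smul_eq_mul, mul_comm]
  have h2 : (κ + 1 / 4) ^ (n - 1) ≤ (2 * κ) ^ (n - 1) :=
    pow_le_pow_left₀ (by positivity) (by linarith) _
  have h3 : V ≤ (2 * κ) ^ (n - 1) * (sphereMeasure n).real (cap κ θ) :=
    hle.trans (mul_le_mul_of_nonneg_right h2 measureReal_nonneg)
  rw [mul_assoc, ← mul_inv, ← mul_pow, ← div_eq_mul_inv, div_le_iff₀ (by positivity),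
    mul_comm _ ((2 * κ) ^ (n - 1))]
  exact h3

section lower

variable {P : Rn n → ℝ} {c C s : ℝ}

theorem pos_of_jap_le (hc : 0 < c) (hP : ∀ ξ, c * jap ξ ^ (-s) ≤ P ξ) (ξ : Rn n) : 0 < P ξ := by
  have := jap_pos ξ
  exact lt_of_lt_of_le (by positivity) (hP ξ)

theorem le_of_norm_le (hc : 0 < c) (hs : 0 ≤ s) (hP : ∀ ξ, c * jap ξ ^ (-s) ≤ P ξ) {ξ : Rn n}
    {r : ℝ} (h : 1 + ‖ξ‖ ≤ r) : c * r ^ (-s) ≤ P ξ := by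
  refine le_trans ?_ (hP ξ)
  have := Real.rpow_le_rpow_of_nonpos (jap_pos ξ) ((jap_le ξ).trans h) (show -s ≤ 0 by linarith)
  gcongr

theorem pi_div_four_le_arctan {x : ℝ} (h : 1 ≤ x) : Real.pi / 4 ≤ Real.arctan x := by
  rw [← Real.arctan_one]
  exact Real.arctan_mono h

theorem integrable_mul_sub_real (hf : ContDiff ℝ 2 fun ξ ↦ (P ξ : ℂ)) (hC : 0 ≤ C)
    (hj : ∀ ξ, jet (fun ξ ↦ (P ξ : ℂ)) ξ ≤ C * jap ξ ^ (-s)) (hs : (n : ℝ) < 2 * s)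
    (v w : Rn n) : Integrable fun ξ ↦ P (w - ξ) * P (ξ - v) := by
  have h := (integrable_mul_sub_of_jet hf hC hj hs v w).re
  refine h.congr (ae_of_all _ fun ξ ↦ ?_)
  simp [← Complex.ofReal_mul]

/-- The two exponents correspond to two sets of directions. On the cap about θ, of measure κ^(1−n),
the point ξ stays at bounded distance from v and only one factor decays, giving κ^(-s) κ^(n−2)
κ^(1−n). On the whole sphere both factors are at least of order κ^(-s), giving κ^(-2s) κ^(n−2). -/
theorem exists_le_neg_im_resForm (hn : 2 ≤ n) (hf : ContDiff ℝ 2 fun ξ ↦ (P ξ : ℂ)) (hC : 0 ≤ C)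
    (hj : ∀ ξ, jet (fun ξ ↦ (P ξ : ℂ)) ξ ≤ C * jap ξ ^ (-s)) (hs : (n : ℝ) < 2 * s)
    (hc : 0 < c) (hP : ∀ ξ, c * jap ξ ^ (-s) ≤ P ξ) {a : ℝ} (ha : a = s + 1 ∨ a = 2 * s + 2 - n) :
    ∃ c', 0 < c' ∧ ∀ κ, 1 ≤ κ → ∀ θ : Rn n, ‖θ‖ = 1 → ∀ w : Rn n, ‖w‖ ≤ 2 * κ →
      ∀ ε, 0 < ε → ε ≤ κ / 2 →
      c' * κ ^ (-a) ≤ -(resForm κ ε (κ • θ) w (fun ξ ↦ (P ξ : ℂ)) fun ξ ↦ (P ξ : ℂ)).im := by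
  have hs0 : 0 ≤ s := by linarith [(Nat.cast_nonneg n : (0 : ℝ) ≤ n)]
  obtain ⟨c₂, hc₂, hcap⟩ := exists_le_sphereMeasure_cap hn
  obtain ⟨m, rfl⟩ : ∃ m, n = m + 2 := ⟨n - 2, by omega⟩
  set σ := (sphereMeasure (m + 2)).real Set.univ with hσ
  have hcap0 : 0 < σ := by
    have h1 := hcap 1 le_rfl (stdVec 0) (norm_stdVec 0)
    have h2 : (sphereMeasure (m + 2)).real (cap 1 (stdVec 0)) ≤ σ :=
      measureReal_mono (Set.subset_univ _)
    simp only [one_pow, inv_one, mul_one] at h1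
    linarith
  have hPc : Continuous P := by
    have := Complex.continuous_re.comp hf.continuous
    simpa [Function.comp_def] using this
  -- the bound from a set of directions
  have key : ∀ κ : ℝ, 1 ≤ κ → ∀ θ : Rn (m + 2), ‖θ‖ = 1 → ∀ w : Rn (m + 2), ‖w‖ ≤ 2 * κ →
      ∀ ε, 0 < ε → ε ≤ κ / 2 → ∀ E : Set (Metric.sphere (0 : Rn (m + 2)) 1), MeasurableSet E →
      ∀ ρ : ℝ, 0 < ρ → (∀ e ∈ E, ∀ r, |r - κ| ≤ 1 → r ≤ 2 * κ → 0 ≤ r →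
        1 + ‖r • (e : Rn (m + 2)) - κ • θ‖ ≤ ρ) →
      (c * (5 * κ) ^ (-s)) * (c * ρ ^ (-s)) * (κ / 2) ^ m * (Real.pi / 4) *
        (sphereMeasure (m + 2)).real E ≤
      -(resForm κ ε (κ • θ) w (fun ξ ↦ (P ξ : ℂ)) fun ξ ↦ (P ξ : ℂ)).im := by
    intro κ hκ θ hθ w hw ε hε hεκ E hE ρ hρ hEρ
    have hκ0 : 0 < κ := one_pos.trans_le hκ
    obtain ⟨a₀, b₀, h1, h2, h3, h4, h5, h6, -, h8, -, -⟩ := exists_radii one_pos hκ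
    rw [one_mul] at h1 h2
    rw [neg_im_resForm κ hε _ _ (integrable_mul_sub_of_jet hf hC hj hs _ _)]
    refine le_trans ?_ (le_integral_mul_lor (M := (c * (5 * κ) ^ (-s)) * (c * ρ ^ (-s)))
      (fun ξ ↦ (mul_pos (pos_of_jap_le hc hP _) (pos_of_jap_le hc hP _)).le) (by fun_prop)
      (integrable_mul_sub_real hf hC hj hs _ _) (by linarith) (h4.trans h5) h1 h2 hE
      (fun e he r hr ↦ ?_) hε)
    -- The shell has d = κ/2, so the restriction on ε is exactly ε ≤ d.
    · have := pi_div_four_le_arctan ((one_le_div hε).2 hεκ)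
      have : 0 ≤ a₀ := by linarith
      have : 0 ≤ c * (5 * κ) ^ (-s) * (c * ρ ^ (-s)) * a₀ ^ m := by positivity
      gcongr
    · have hr0 : 0 ≤ r := by linarith [hr.1]
      have hre : ‖r • (e : Rn (m + 2))‖ = r := by
        rw [norm_smul, norm_eq_of_mem_sphere, mul_one, Real.norm_of_nonneg hr0]
      have hw2 : 1 + ‖w - r • (e : Rn (m + 2))‖ ≤ 5 * κ := by
        have := norm_sub_le w (r • (e : Rn (m + 2)))
        rw [hre] at this
        linarith [hr.2]
      refine mul_le_mul (le_of_norm_le hc hs0 hP hw2) (le_of_norm_le hc hs0 hP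
        (hEρ e he r ?_ (hr.2.trans h6) hr0)) (by positivity) (pos_of_jap_le hc hP _).le
      rw [abs_le]
      constructor <;> linarith [hr.1, hr.2]
  have hpow : ∀ κ : ℝ, 1 ≤ κ → (5 * κ) ^ (-s) = 5 ^ (-s) * κ ^ (-s) := fun κ hκ ↦
    Real.mul_rpow (by norm_num) (by linarith)
  have hdiv : ∀ κ : ℝ, (κ / 2) ^ m = (2 ^ m)⁻¹ * κ ^ m := fun κ ↦ by
    rw [div_pow, div_eq_inv_mul]
  rcases ha with rfl | rfl
  · refine ⟨(c * 5 ^ (-s)) * (c * 3 ^ (-s)) * (2 ^ m)⁻¹ * (Real.pi / 4) * c₂, by positivity,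
      fun κ hκ θ hθ w hw ε hε hεκ ↦ ?_⟩
    have hκ0 : 0 < κ := one_pos.trans_le hκ
    -- The constant 3 covers 1 for the bracket, 1 for |r − κ| and 1/2 for κ times the size of the
    -- cap.
    refine le_trans ?_ (key κ hκ θ hθ w hw ε hε hεκ _ (measurableSet_cap κ θ) 3 (by norm_num)
      fun e he r hr _ _ ↦ ?_)
    · have h1 := hcap κ hκ θ hθ
      have h2 : κ ^ (-(s + 1)) = κ ^ (-s) * (κ ^ m * (κ ^ (m + 1))⁻¹) := by
        rw [neg_add, Real.rpow_add hκ0, Real.rpow_neg_one, pow_succ]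
        field_simp
      calc _ = (c * (5 ^ (-s) * κ ^ (-s))) * (c * 3 ^ (-s)) * ((2 ^ m)⁻¹ * κ ^ m) * (Real.pi / 4) *
            (c₂ * (κ ^ (m + 1))⁻¹) := by rw [h2]; ring
        _ ≤ _ := by
          rw [hpow κ hκ, hdiv]
          exact mul_le_mul_of_nonneg_left h1 (by positivity)
    · have he' : ‖(e : Rn (m + 2)) - θ‖ ≤ (1 / 2) / κ := he
      have h2 : r • (e : Rn (m + 2)) - κ • θ =
          (r - κ) • (e : Rn (m + 2)) + κ • ((e : Rn (m + 2)) - θ) := by module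
      have h3 := norm_add_le ((r - κ) • (e : Rn (m + 2))) (κ • ((e : Rn (m + 2)) - θ))
      rw [← h2, norm_smul, norm_smul, norm_eq_of_mem_sphere, mul_one, Real.norm_eq_abs,
        Real.norm_of_nonneg hκ0.le] at h3
      rw [le_div_iff₀ hκ0] at he'
      linarith
  · refine ⟨(c * 5 ^ (-s)) * (c * 5 ^ (-s)) * (2 ^ m)⁻¹ * (Real.pi / 4) * σ, by positivity,
      fun κ hκ θ hθ w hw ε hε hεκ ↦ ?_⟩
    have hκ0 : 0 < κ := one_pos.trans_le hκ
    refine le_trans (le_of_eq ?_) (key κ hκ θ hθ w hw ε hε hεκ _ MeasurableSet.univ (5 * κ)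
      (by positivity) fun e _ r _ hr hr0 ↦ ?_)
    · have h2 : κ ^ (-(2 * s + 2 - ((m + 2 : ℕ) : ℝ))) = κ ^ (-s) * κ ^ (-s) * κ ^ m := by
        rw [← Real.rpow_natCast, ← Real.rpow_add hκ0, ← Real.rpow_add hκ0]
        congr 1; push_cast; ring
      rw [h2, hpow κ hκ, hdiv]
      ring
    · have := norm_sub_le (r • (e : Rn (m + 2))) (κ • θ)
      rw [norm_smul, norm_smul, norm_eq_of_mem_sphere, mul_one, Real.norm_of_nonneg hr0, hθ,
        Real.norm_of_nonneg hκ0.le] at this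
      linarith

theorem inner_le_of_mem {θ ξ : Rn n} (hθ : ‖θ‖ = 1) {R : ℝ} (h : ‖ξ + R • θ‖ ≤ R / 2) :
    inner ℝ ξ θ ≤ -(R / 2) := by
  have h1 := real_inner_le_norm (ξ + R • θ) θ
  rw [inner_add_left, real_inner_smul_left, real_inner_self_eq_norm_sq, hθ] at h1
  linarith

/-- The wave number blows up at the boundary of the half space. On the ball of radius R/2 about −Rθ
the angle with that boundary stays bounded below, so κ is comparable to R. -/
theorem waveNumber_div_bounds {θ ξ : Rn n} (hθ : ‖θ‖ = 1) {R : ℝ} (hR : 0 < R)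
    (h : ‖ξ + R • θ‖ ≤ R / 2) :
    inner ℝ ((2 * Real.pi) • ξ) θ < 0 ∧
      R / 2 ≤ waveNumber θ ((2 * Real.pi) • ξ) / (2 * Real.pi) ∧
      waveNumber θ ((2 * Real.pi) • ξ) / (2 * Real.pi) ≤ 5 * R := by
  have hin := inner_le_of_mem hθ h
  have hπ : 0 < 2 * Real.pi := by positivity
  have h0 : inner ℝ ((2 * Real.pi) • ξ) θ < 0 := by
    rw [real_inner_smul_left]
    exact mul_neg_of_pos_of_neg hπ (by linarith)
  have hR' : ‖R • θ‖ = R := by rw [norm_smul, hθ, mul_one, Real.norm_of_nonneg hR.le]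
  have h1 : R / 2 ≤ ‖ξ‖ := by
    have := norm_sub_norm_le (R • θ) (-ξ)
    rw [sub_neg_eq_add, add_comm, norm_neg, hR'] at this
    linarith
  have h2 : ‖ξ‖ ≤ 3 / 2 * R := by
    have := norm_sub_le (ξ + R • θ) (R • θ)
    rw [add_sub_cancel_right, hR'] at this
    linarith
  refine ⟨h0, h1.trans (norm_le_waveNumber_div hθ h0), ?_⟩
  have hin' : inner ℝ θ ξ ≤ -(R / 2) := by rwa [real_inner_comm]
  have e : waveNumber θ ((2 * Real.pi) • ξ) / (2 * Real.pi) = ‖ξ‖ ^ 2 / (-inner ℝ θ ξ) := by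
    unfold waveNumber
    have hne : inner ℝ θ ξ ≠ 0 := by linarith
    rw [norm_smul, real_inner_smul_right, Real.norm_of_nonneg hπ.le]
    field_simp
  rw [e, div_le_iff₀ (by linarith)]
  nlinarith [norm_nonneg ξ]

theorem neg_im_regB_nonneg (hf : ContDiff ℝ 2 fun ξ ↦ (P ξ : ℂ)) (hC : 0 ≤ C)
    (hj : ∀ ξ, jet (fun ξ ↦ (P ξ : ℂ)) ξ ≤ C * jap ξ ^ (-s)) (hs : (n : ℝ) < 2 * s)
    (hc : 0 < c) (hP : ∀ ξ, c * jap ξ ^ (-s) ≤ P ξ) {q : L2 n}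
    (hq : (𝓕 q : L2 n) =ᵐ[volume] fun ξ ↦ (P ξ : ℂ)) {ε : ℝ} (hε : 0 < ε) (θ η : Rn n) :
    0 ≤ -(regB ε θ q η).im := by
  rcases lt_or_ge (inner ℝ η θ) 0 with h | h
  · rw [regB_eq_quadB hε q h, quadB_congr hq, ← Complex.ofReal_inv, Complex.im_ofReal_mul,
      ← mul_neg, quadB, neg_im_resForm _ (by positivity) _ _
        (integrable_mul_sub_of_jet hf hC hj hs _ _)]
    refine mul_nonneg (by positivity) (integral_nonneg fun ξ ↦ mul_nonneg (mul_pos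
      (pos_of_jap_le hc hP _) (pos_of_jap_le hc hP _)).le (lor_nonneg _ (by positivity) _))
  · rw [regB_of_nonneg q h]; simp

theorem exists_le_neg_im_limB (hn : 2 ≤ n) (hf : ContDiff ℝ 2 fun ξ ↦ (P ξ : ℂ)) (hC : 0 ≤ C)
    (hj : ∀ ξ, jet (fun ξ ↦ (P ξ : ℂ)) ξ ≤ C * jap ξ ^ (-s)) (hs : (n : ℝ) < 2 * s)
    (hc : 0 < c) (hP : ∀ ξ, c * jap ξ ^ (-s) ≤ P ξ) {q : L2 n}
    (hq : (𝓕 q : L2 n) =ᵐ[volume] fun ξ ↦ (P ξ : ℂ)) {a : ℝ}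
    (ha : a = s + 1 ∨ a = 2 * s + 2 - n) :
    (∀ θ η : Rn n, 0 ≤ -(limB θ q η).im) ∧
    ∃ c', 0 < c' ∧ ∀ R, 2 ≤ R → ∀ θ : Rn n, ‖θ‖ = 1 → ∀ ξ : Rn n, ‖ξ + R • θ‖ ≤ R / 2 →
      c' * R ^ (-a) ≤ -(limB θ q ((2 * Real.pi) • ξ)).im := by
  have hlim : ∀ θ η : Rn n, Tendsto (fun ε ↦ -(regB ε θ q η).im) (𝓝[>] 0)
      (𝓝 (-(limB θ q η).im)) := fun θ η ↦
    ((Complex.continuous_im.tendsto _).comp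
      (isB_limB_of_exists (exists_isB_of_contDiff hn hf hC hj hs hq θ η))).neg
  refine ⟨fun θ η ↦ ge_of_tendsto (hlim θ η) ?_, ?_⟩
  · filter_upwards [self_mem_nhdsWithin] with ε hε
    exact neg_im_regB_nonneg hf hC hj hs hc hP hq hε θ η
  have ha0 : 0 ≤ a := by
    have : (2 : ℝ) ≤ n := by exact_mod_cast hn
    rcases ha with rfl | rfl <;> linarith
  obtain ⟨c', hc', hb⟩ := exists_le_neg_im_resForm hn hf hC hj hs hc hP ha
  refine ⟨(4 * Real.pi ^ 2)⁻¹ * (c' * 5 ^ (-a)), by positivity, fun R hR θ hθ ξ hξ ↦ ?_⟩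
  obtain ⟨h0, h1, h2⟩ := waveNumber_div_bounds hθ (by linarith) hξ
  set κ := waveNumber θ ((2 * Real.pi) • ξ) / (2 * Real.pi) with hκ
  have hκ1 : 1 ≤ κ := by linarith
  refine ge_of_tendsto (hlim θ _) ?_
  filter_upwards [Ioo_mem_nhdsGT (show (0 : ℝ) < 1 / 2 by norm_num)] with ε hε
  have hπ1 : 1 ≤ 4 * Real.pi ^ 2 := by nlinarith [Real.pi_gt_three]
  have hε2 : ε / (4 * Real.pi ^ 2) ≤ κ / 2 := by
    have := div_le_self hε.1.le hπ1
    linarith [hε.2]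
  rw [regB_eq_quadB hε.1 q h0, quadB_congr hq, ← Complex.ofReal_inv, Complex.im_ofReal_mul,
    ← mul_neg, mul_assoc (4 * Real.pi ^ 2)⁻¹]
  refine mul_le_mul_of_nonneg_left ?_ (by positivity)
  have hv : (2 * Real.pi)⁻¹ • (waveNumber θ ((2 * Real.pi) • ξ) • θ) = κ • θ := by
    rw [smul_smul, hκ, div_eq_inv_mul]
  have hw : ‖(2 * Real.pi)⁻¹ • ((2 * Real.pi) • ξ + waveNumber θ ((2 * Real.pi) • ξ) • θ)‖ ≤
      2 * κ := by
    have e1 := norm_add_waveNumber hθ h0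
    have e2 : ‖(2 * Real.pi) • ξ + waveNumber θ ((2 * Real.pi) • ξ) • θ‖ ≤
        waveNumber θ ((2 * Real.pi) • ξ) :=
      abs_le_of_sq_le_sq' (by nlinarith [sq_nonneg ‖(2 * Real.pi) • ξ‖]) (waveNumber_pos h0).le
        |>.2
    rw [norm_smul, Real.norm_of_nonneg (by positivity), inv_mul_le_iff₀ (by positivity)]
    have e3 : waveNumber θ ((2 * Real.pi) • ξ) = 2 * Real.pi * κ := by rw [hκ]; field_simp
    have : 0 ≤ 2 * Real.pi * κ := by positivity
    linarith
  have hfin := hb κ hκ1 θ hθ _ hw (ε / (4 * Real.pi ^ 2)) (div_pos hε.1 (by positivity)) hε2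
  rw [← hv] at hfin
  refine le_trans ?_ hfin
  rw [mul_assoc, ← Real.mul_rpow (by norm_num) (by linarith)]
  exact mul_le_mul_of_nonneg_left
    (Real.rpow_le_rpow_of_nonpos (by linarith) h2 (by linarith)) hc'.le

end lower

/-! ### Localized Sobolev regularity and averages of the Fourier transform -/

/-- The translate `ζ ↦ bumpHat (ζ - x)` as a Schwartz function. -/
def bumpAt (x : Rn n) : 𝓢(Rn n, ℂ) :=
  (𝓕 autoBump : 𝓢(Rn n, ℂ)).compSubConstCLM ℂ x

theorem bumpAt_apply (x ζ : Rn n) : bumpAt x ζ = (bumpHat (ζ - x) : ℂ) := by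
  rw [← fourier_autoBump]; rfl

/-- The transform of a translated bump is a modulated copy of the reflected autocorrelation,
supported in the unit ball. Hence pairing `𝓕 u` with it sees u only there, and local regularity is
enough. -/
theorem fourier_bumpAt_eq_zero (x : Rn n) {y : Rn n} (hy : 1 < ‖y‖) :
    (𝓕 (bumpAt x) : 𝓢(Rn n, ℂ)) y = 0 := by
  have hx : x = -((2 * Real.pi)⁻¹ • (-((2 * Real.pi) • x))) := by
    rw [smul_neg, neg_neg, smul_smul, inv_mul_cancel₀ (by positivity), one_smul]
  have h : (𝓕 (𝓕 autoBump : 𝓢(Rn n, ℂ)) : 𝓢(Rn n, ℂ)) y = 0 := by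
    have h1 : (𝓕⁻ (𝓕 autoBump : 𝓢(Rn n, ℂ)) : 𝓢(Rn n, ℂ)) (-y) = 0 := by
      rw [fourierInv_fourier_eq]
      exact autoBump_eq_zero (by rwa [norm_neg])
    rwa [SchwartzMap.fourierInv_coe, Real.fourierInv_eq_fourier_neg, neg_neg,
      ← SchwartzMap.fourier_coe] at h1
  rw [bumpAt, hx, fourier_comp_add_apply, h, mul_zero]

theorem hasCompactSupport_radialCut (j : ℕ) :
    HasCompactSupport fun ξ : Rn n ↦ (radialCut j ξ : ℂ) :=
  hasCompactSupport_of_norm (R := 2 * ((j : ℝ) + 1)) fun ξ h ↦ by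
    rw [radialCut_eq_zero h, Complex.ofReal_zero]

theorem smulLeft_radialCut_fourier_bumpAt (x : Rn n) :
    SchwartzMap.smulLeftCLM ℂ (fun ξ : Rn n ↦ (radialCut 0 ξ : ℂ)) (𝓕 (bumpAt x)) =
      (𝓕 (bumpAt x) : 𝓢(Rn n, ℂ)) := by
  ext y
  rw [SchwartzMap.smulLeftCLM_apply_apply
    ((hasCompactSupport_radialCut 0).hasTemperateGrowth (contDiff_radialCut 0)), smul_eq_mul]
  rcases le_or_gt ‖y‖ 1 with h | h
  · rw [radialCut_eq_one (by simpa using h), Complex.ofReal_one, one_mul]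
  · rw [fourier_bumpAt_eq_zero x h, mul_zero]

theorem exists_fourier_bumpAt_eq {α : ℝ} {u : 𝓢'(Rn n, ℂ)} (h : MemSobolevLoc α u) :
    ∃ f : L2 n, ∀ x : Rn n, 𝓕 u (bumpAt x) =
      ∫ ζ, (dualWeight (-(α / 2)) ζ : ℂ) * (bumpHat (ζ - x) : ℂ) * f ζ := by
  -- The cut-off equals 1 on the unit ball, so multiplying u by it does not change any of the
  -- pairings.
  obtain ⟨g, hg⟩ := exists_of_sobolevNorm_lt_top
    (h _ (contDiff_radialCut 0) (hasCompactSupport_radialCut 0))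
  rw [japX_zero] at hg
  refine ⟨𝓕 g, fun x ↦ ?_⟩
  have h1 := congrArg (fun v : 𝓢'(Rn n, ℂ) ↦ TemperedDistribution.smulLeftCLM ℂ
    (fun ξ : Rn n ↦ (dualWeight (-(α / 2)) ξ : ℂ)) (𝓕 v) (bumpAt x)) hg
  simp only [fourier_japD, smulLeft_dualWeight_comp, neg_add_cancel,
    smulLeft_dualWeight_zero, Lp.fourier_toTemperedDistribution_eq] at h1
  rw [TemperedDistribution.fourier_apply, TemperedDistribution.smulLeftCLM_apply_apply,
    TemperedDistribution.smulLeftCLM_apply_apply, smulLeft_radialCut_fourier_bumpAt,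
    ← TemperedDistribution.fourier_apply, Lp.toTemperedDistribution_apply] at h1
  rw [← h1]
  refine integral_congr_ae (ae_of_all _ fun ζ ↦ ?_)
  simp only [SchwartzMap.smulLeftCLM_apply_apply (hasTemperateGrowth_dualWeight _), smul_eq_mul,
    bumpAt_apply]

theorem jap_rpow_neg_le_abs (α : ℝ) (x ζ : Rn n) :
    jap ζ ^ (-α) ≤ 2 ^ |α| * jap (ζ - x) ^ |α| * jap x ^ (-α) := by
  rcases le_total 0 α with h | h
  · rw [abs_of_nonneg h, jap_sub_comm]
    exact jap_rpow_neg_le h x ζ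
  · rw [abs_of_nonpos h, ← Real.mul_rpow (by norm_num) (jap_pos _).le,
      ← Real.mul_rpow (by have := jap_pos (ζ - x); positivity) (jap_pos _).le]
    have := jap_add_le_mul (ζ - x) x
    rw [sub_add_cancel] at this
    exact Real.rpow_le_rpow (jap_pos _).le this (by linarith)

/-- Young's inequality for L¹ and L², by Cauchy–Schwarz with the kernel split into two square roots.
-/
theorem lintegral_conv_sq_le {k H : Rn n → ℝ≥0∞} (hk : Measurable k) (hH : Measurable H) :
    ∫⁻ x, (∫⁻ ζ, k (ζ - x) * H ζ) ^ 2 ≤ (∫⁻ z, k z) ^ 2 * ∫⁻ ζ, H ζ ^ 2 := by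
  have hk2 : Measurable fun p : Rn n × Rn n ↦ k (p.2 - p.1) :=
    hk.comp (measurable_snd.sub measurable_fst)
  have hroot : ∀ t : ℝ≥0∞, (t ^ (1 / 2 : ℝ)) ^ 2 = t := fun t ↦ by
    rw [← ENNReal.rpow_natCast, ← ENNReal.rpow_mul]
    norm_num
  have h1 : ∀ x : Rn n, (∫⁻ ζ, k (ζ - x) * H ζ) ^ 2 ≤
      (∫⁻ z, k z) * ∫⁻ ζ, k (ζ - x) * H ζ ^ 2 := fun x ↦ by
    have hkx : Measurable fun ζ ↦ k (ζ - x) := hk.comp (measurable_id.sub_const x)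
    have hf : Measurable fun ζ ↦ k (ζ - x) ^ (1 / 2 : ℝ) := hkx.pow_const _
    have hfH : Measurable fun ζ ↦ k (ζ - x) ^ (1 / 2 : ℝ) * H ζ := hf.mul hH
    have := sq_lintegral_mul_le (μ := volume) hf.aemeasurable hfH.aemeasurable
    simp only [mul_pow, hroot] at this
    rw [lintegral_sub_right_eq_self k x] at this
    refine le_trans (le_of_eq ?_) this
    congr 1
    refine lintegral_congr fun ζ ↦ ?_
    rw [← mul_assoc, ← pow_two, hroot]
  calc ∫⁻ x, (∫⁻ ζ, k (ζ - x) * H ζ) ^ 2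
      ≤ ∫⁻ x, (∫⁻ z, k z) * ∫⁻ ζ, k (ζ - x) * H ζ ^ 2 := lintegral_mono h1
    _ = (∫⁻ z, k z) * ∫⁻ x, ∫⁻ ζ, k (ζ - x) * H ζ ^ 2 :=
        lintegral_const_mul _ (Measurable.lintegral_prod_right'
          (f := fun p : Rn n × Rn n ↦ k (p.2 - p.1) * H p.2 ^ 2)
          (hk2.mul ((hH.comp measurable_snd).pow_const 2)))
    _ = (∫⁻ z, k z) * ∫⁻ ζ, ∫⁻ x, k (ζ - x) * H ζ ^ 2 := by
        rw [lintegral_lintegral_swap (hk2.mul ((hH.comp measurable_snd).pow_const 2)).aemeasurable]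
    _ = (∫⁻ z, k z) * ∫⁻ ζ, (∫⁻ z, k z) * H ζ ^ 2 := by
        congr 1
        refine lintegral_congr fun ζ ↦ ?_
        have hkζ : Measurable fun x ↦ k (ζ - x) := hk.comp (measurable_const.sub measurable_id)
        rw [lintegral_mul_const _ hkζ, lintegral_sub_left_eq_self k ζ]
    _ = _ := by rw [lintegral_const_mul _ (hH.pow_const 2)]; ring

/-- Peetre's inequality moves the weight of order α onto the rapidly decreasing bump, and Young's
inequality concludes. Working with an explicit majorant T avoids discussing measurability of the
pairing in x. -/
theorem exists_lintegral_bumpAt_le {α : ℝ} {u : 𝓢'(Rn n, ℂ)} (h : MemSobolevLoc α u) :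
    ∃ T : Rn n → ℝ≥0∞, (∀ x, ENNReal.ofReal (jap x ^ α) * ‖𝓕 u (bumpAt x)‖ₑ ≤ T x) ∧
      ∫⁻ x, T x ^ 2 < ⊤ := by
  obtain ⟨f, hf⟩ := exists_fourier_bumpAt_eq h
  obtain ⟨D, hD0, hD⟩ := exists_dualWeight_le (n := n) (-(α / 2))
  set k : Rn n → ℝ≥0∞ := fun z ↦
    ENNReal.ofReal (D * 2 ^ |α|) * ‖japMul |α| (𝓕 autoBump : 𝓢(Rn n, ℂ)) z‖ₑ with hk
  have hkm : Measurable k :=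
    (SchwartzMap.continuous _).measurable.enorm.const_mul _
  have hfm : Measurable fun ζ ↦ ‖f ζ‖ₑ := (Lp.stronglyMeasurable f).measurable.enorm
  refine ⟨fun x ↦ ∫⁻ ζ, k (ζ - x) * ‖f ζ‖ₑ, fun x ↦ ?_, ?_⟩
  · rw [hf]
    have hx := jap_pos x
    calc ENNReal.ofReal (jap x ^ α) *
          ‖∫ ζ, (dualWeight (-(α / 2)) ζ : ℂ) * (bumpHat (ζ - x) : ℂ) * f ζ‖ₑ
        ≤ ENNReal.ofReal (jap x ^ α) *
          ∫⁻ ζ, ‖(dualWeight (-(α / 2)) ζ : ℂ) * (bumpHat (ζ - x) : ℂ) * f ζ‖ₑ := by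
          gcongr; exact enorm_integral_le_lintegral_enorm _
      _ = ∫⁻ ζ, ENNReal.ofReal (jap x ^ α) *
          ‖(dualWeight (-(α / 2)) ζ : ℂ) * (bumpHat (ζ - x) : ℂ) * f ζ‖ₑ :=
          (lintegral_const_mul' _ _ ENNReal.ofReal_ne_top).symm
      _ ≤ ∫⁻ ζ, k (ζ - x) * ‖f ζ‖ₑ := lintegral_mono fun ζ ↦ by
          rw [enorm_mul _ (f ζ), ← mul_assoc]
          gcongr
          have h0 := bumpHat_nonneg (ζ - x)
          have h1 := dualWeight_pos (-(α / 2)) ζ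
          have h2 := jap_pos (ζ - x)
          rw [hk]
          simp only [← ofReal_norm]
          rw [← ENNReal.ofReal_mul (by positivity), ← ENNReal.ofReal_mul (by positivity),
            norm_japMul_apply, fourier_autoBump, norm_mul, Complex.norm_real, Complex.norm_real,
            Real.norm_of_nonneg h0, Real.norm_of_nonneg h1.le]
          refine ENNReal.ofReal_le_ofReal ?_
          have e1 : dualWeight (-(α / 2)) ζ ≤ D * (2 ^ |α| * jap (ζ - x) ^ |α| * jap x ^ (-α)) := by
            refine (hD ζ).trans (mul_le_mul_of_nonneg_left ?_ hD0)
            have := jap_rpow_neg_le_abs α x ζ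
            rwa [show 2 * (-(α / 2)) = -α by ring]
          have e2 : jap x ^ α * jap x ^ (-α) = 1 := by
            rw [← Real.rpow_add hx, add_neg_cancel, Real.rpow_zero]
          calc jap x ^ α * (dualWeight (-(α / 2)) ζ * bumpHat (ζ - x))
              ≤ jap x ^ α * (D * (2 ^ |α| * jap (ζ - x) ^ |α| * jap x ^ (-α)) *
                  bumpHat (ζ - x)) := by gcongr
            _ = (jap x ^ α * jap x ^ (-α)) *
                  (D * 2 ^ |α| * (jap (ζ - x) ^ |α| * bumpHat (ζ - x))) := by ring
            _ = _ := by rw [e2, one_mul]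
  · refine (lintegral_conv_sq_le hkm hfm).trans_lt (ENNReal.mul_lt_top (ENNReal.pow_lt_top ?_) ?_)
    · rw [hk, lintegral_const_mul' _ _ ENNReal.ofReal_ne_top]
      exact ENNReal.mul_lt_top ENNReal.ofReal_lt_top (SchwartzMap.integrable _).2
    · have := (eLpNorm_lt_top_iff_lintegral_rpow_enorm_lt_top (by norm_num) (by norm_num)).1
        (Lp.memLp f).2
      simpa using this

/-- The fixed sign of the imaginary part and the positivity of the bump turn a lower bound near x
into one for the average, whatever happens far away. -/
theorem le_neg_im_integral_bumpAt {F : Rn n → ℂ} {x : Rn n} {ρ c m : ℝ}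
    (hb : ∀ ξ : Rn n, ‖ξ‖ ≤ ρ → c ≤ bumpHat ξ)
    (hi : Integrable fun ζ ↦ bumpAt x ζ * F ζ) (hF : ∀ ζ, 0 ≤ -(F ζ).im)
    (hm0 : 0 ≤ m) (hm : ∀ ζ, ‖ζ - x‖ ≤ ρ → m ≤ -(F ζ).im) :
    c * m * (volume : Measure (Rn n)).real (Metric.closedBall 0 ρ) ≤
      ‖∫ ζ, bumpAt x ζ * F ζ‖ := by
  have hvol : (volume : Measure (Rn n)).real (Metric.closedBall x ρ) =
      (volume : Measure (Rn n)).real (Metric.closedBall 0 ρ) := by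
    rw [measureReal_def, measureReal_def, ← Measure.addHaar_closedBall_center volume x]
  have him : ∀ ζ, -(bumpAt x ζ * F ζ).im = bumpHat (ζ - x) * -(F ζ).im := fun ζ ↦ by
    rw [bumpAt_apply, Complex.im_ofReal_mul, mul_neg]
  have hi' : Integrable fun ζ ↦ bumpHat (ζ - x) * -(F ζ).im :=
    (hi.im.neg).congr (ae_of_all _ fun ζ ↦ him ζ)
  have hint : ∫ ζ, bumpHat (ζ - x) * -(F ζ).im = -(∫ ζ, bumpAt x ζ * F ζ).im := by
    have h1 := Complex.imCLM.integral_comp_comm hi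
    rw [← Complex.imCLM_apply, ← h1, ← integral_neg]
    exact integral_congr_ae (ae_of_all _ fun ζ ↦ (him ζ).symm)
  calc c * m * (volume : Measure (Rn n)).real (Metric.closedBall 0 ρ)
      = ∫ _ζ in Metric.closedBall x ρ, c * m := by
        rw [setIntegral_const, hvol, smul_eq_mul]; ring
    _ ≤ ∫ ζ in Metric.closedBall x ρ, bumpHat (ζ - x) * -(F ζ).im := by
        refine setIntegral_mono_on (integrableOn_const measure_closedBall_lt_top.ne)
          hi'.integrableOn measurableSet_closedBall fun ζ hζ ↦ ?_
        have hd : ‖ζ - x‖ ≤ ρ := by rw [← dist_eq_norm]; exact hζ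
        exact mul_le_mul (hb _ hd) (hm ζ hd) hm0 (bumpHat_nonneg _)
    _ ≤ ∫ ζ, bumpHat (ζ - x) * -(F ζ).im := setIntegral_le_integral hi' (ae_of_all _ fun ζ ↦
        mul_nonneg (bumpHat_nonneg _) (hF ζ))
    _ = -(∫ ζ, bumpAt x ζ * F ζ).im := hint
    _ ≤ _ := (neg_le_abs _).trans (Complex.abs_im_le_norm _)

theorem exists_le_rpow (α : ℝ) : ∃ c, 0 < c ∧ ∀ R t : ℝ, 0 < R → R / 2 ≤ t → t ≤ 2 * R →
    c * R ^ α ≤ t ^ α := by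
  rcases le_total 0 α with h | h
  · refine ⟨(1 / 2) ^ α, by positivity, fun R t hR h1 _ ↦ ?_⟩
    rw [← Real.mul_rpow (by norm_num) hR.le]
    exact Real.rpow_le_rpow (by positivity) (by linarith) h
  · refine ⟨2 ^ α, by positivity, fun R t hR h1 h2 ↦ ?_⟩
    rw [← Real.mul_rpow (by norm_num) hR.le]
    exact Real.rpow_le_rpow_of_nonpos (by linarith) h2 h

/-- On a ball of radius R/4 about −Rθ the weighted averages are at least a multiple of R^(α−a).
Their square integral is at least of order R^(2(α−a)+n), which is unbounded when a < α + n/2. -/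
theorem not_memSobolevLoc {F : Rn n → ℂ} {u : 𝓢'(Rn n, ℂ)} (hu : ∀ φ : 𝓢(Rn n, ℂ),
      Integrable (fun ξ ↦ φ ξ * F ξ) ∧ 𝓕 u φ = ∫ ξ, φ ξ * F ξ)
    (hF : ∀ ζ, 0 ≤ -(F ζ).im) {θ : Rn n} (hθ : ‖θ‖ = 1) {a c α : ℝ} (hc : 0 < c)
    (hl : ∀ R, 2 ≤ R → ∀ ξ : Rn n, ‖ξ + R • θ‖ ≤ R / 2 → c * R ^ (-a) ≤ -(F ξ).im)
    (haα : a < α + n / 2) : ¬ MemSobolevLoc α u := by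
  intro h
  obtain ⟨T, hT, hTfin⟩ := exists_lintegral_bumpAt_le h
  obtain ⟨ρ, c₁, hρ, hρ1, hc₁, hb⟩ := exists_le_bumpHat (n := n)
  obtain ⟨c₂, hc₂, hpow⟩ := exists_le_rpow α
  have hV : 0 < (volume : Measure (Rn n)).real (Metric.closedBall 0 ρ) :=
    ENNReal.toReal_pos (Metric.measure_closedBall_pos _ _ hρ).ne' measure_closedBall_lt_top.ne
  set V := (volume : Measure (Rn n)).real (Metric.closedBall 0 ρ) with hVdef
  have hV1 : 0 < (volume : Measure (Rn n)).real (Metric.ball 0 1) :=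
    ENNReal.toReal_pos (Metric.measure_ball_pos _ _ one_pos).ne' measure_ball_lt_top.ne
  set V1 := (volume : Measure (Rn n)).real (Metric.ball 0 1) with hV1def
  -- the lower bound on a ball
  have hlow : ∀ R, 4 ≤ R → ENNReal.ofReal ((c₂ * (c₁ * c * V)) ^ 2 * V1 * (1 / 4) ^ n *
      R ^ (2 * (α - a) + n)) ≤ ∫⁻ x, T x ^ 2 := fun R hR ↦ by
    have hR0 : 0 < R := by linarith
    have hpt : ∀ x ∈ Metric.ball (-(R • θ)) (R / 4),
        ENNReal.ofReal ((c₂ * (c₁ * c * V) * R ^ (α - a)) ^ 2) ≤ T x ^ 2 := fun x hx ↦ by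
      have hx1 : ‖x + R • θ‖ ≤ R / 4 := by
        have : dist x (-(R • θ)) < R / 4 := hx
        rw [dist_eq_norm, sub_neg_eq_add] at this
        exact this.le
      have hRθ : ‖R • θ‖ = R := by rw [norm_smul, hθ, mul_one, Real.norm_of_nonneg hR0.le]
      have hx2 : ‖x‖ ≤ 5 / 4 * R := by
        have := norm_sub_le (x + R • θ) (R • θ)
        rw [add_sub_cancel_right, hRθ] at this
        linarith
      have hx3 : 3 / 4 * R ≤ ‖x‖ := by
        have := norm_sub_norm_le (R • θ) (-x)
        rw [sub_neg_eq_add, add_comm, norm_neg, hRθ] at this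
        linarith
      have hjx : c₂ * R ^ α ≤ jap x ^ α :=
        hpow R _ hR0 (by linarith [norm_le_jap x]) (by linarith [jap_le x])
      have hK := le_neg_im_integral_bumpAt (x := x) hb (hu (bumpAt x)).1 hF
        (m := c * R ^ (-a)) (by positivity) fun ζ hζ ↦ hl R (by linarith) ζ (by
          have := norm_add_le (ζ - x) (x + R • θ)
          rw [show ζ - x + (x + R • θ) = ζ + R • θ by abel] at this
          linarith)
      rw [← (hu (bumpAt x)).2, ← hVdef] at hK
      rw [ENNReal.ofReal_pow (by positivity)]
      refine pow_le_pow_left' (le_trans ?_ (hT x)) 2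
      rw [← ofReal_norm, ← ENNReal.ofReal_mul (Real.rpow_nonneg (jap_pos x).le _)]
      refine ENNReal.ofReal_le_ofReal ?_
      calc c₂ * (c₁ * c * V) * R ^ (α - a) = (c₂ * R ^ α) * (c₁ * (c * R ^ (-a)) * V) := by
            rw [sub_eq_add_neg, Real.rpow_add hR0]; ring
        _ ≤ _ := mul_le_mul hjx hK (by positivity) (Real.rpow_nonneg (jap_pos x).le _)
    have hvol : volume (Metric.ball (-(R • θ)) (R / 4)) = ENNReal.ofReal ((R / 4) ^ n * V1) := by
      have hnt : Nontrivial (Rn n) := ⟨⟨θ, 0, fun h0 ↦ by simp [h0] at hθ⟩⟩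
      rw [Measure.addHaar_ball _ _ (by positivity), finrank_euclideanSpace_fin,
        ENNReal.ofReal_mul (by positivity), hV1def, measureReal_def,
        ENNReal.ofReal_toReal measure_ball_lt_top.ne]
    calc ENNReal.ofReal ((c₂ * (c₁ * c * V)) ^ 2 * V1 * (1 / 4) ^ n * R ^ (2 * (α - a) + n))
        = ENNReal.ofReal ((c₂ * (c₁ * c * V) * R ^ (α - a)) ^ 2) *
          volume (Metric.ball (-(R • θ)) (R / 4)) := by
          rw [hvol, ← ENNReal.ofReal_mul (by positivity)]
          congr 1
          rw [Real.rpow_add hR0, Real.rpow_natCast, two_mul, Real.rpow_add hR0, div_pow, div_pow]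
          ring
      _ = ∫⁻ _x in Metric.ball (-(R • θ)) (R / 4),
          ENNReal.ofReal ((c₂ * (c₁ * c * V) * R ^ (α - a)) ^ 2) := (setLIntegral_const _ _).symm
      _ ≤ ∫⁻ x in Metric.ball (-(R • θ)) (R / 4), T x ^ 2 :=
          setLIntegral_mono' measurableSet_ball hpt
      _ ≤ ∫⁻ x, T x ^ 2 := setLIntegral_le_lintegral _ _
  have hexp : 0 < 2 * (α - a) + n := by linarith
  have hK0 : 0 < (c₂ * (c₁ * c * V)) ^ 2 * V1 * (1 / 4) ^ n := by positivity
  have htend := ((tendsto_rpow_atTop hexp).const_mul_atTop hK0)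
  obtain ⟨R, hR1, hR2⟩ := ((htend.eventually_gt_atTop (∫⁻ x, T x ^ 2).toReal).and
    (eventually_ge_atTop 4)).exists
  have := (ENNReal.ofReal_le_iff_le_toReal hTfin.ne).1 (hlow R hR2)
  linarith

/-! ### Conclusion of the converse -/

theorem le_of_memSobolevLoc (hn : 2 ≤ n) {α β : ℝ} (hβ : 0 ≤ β) {θ : Rn n} (hθ : ‖θ‖ = 1)
    (h : ∀ q : L2 n, sobolevNorm β 0 (q : 𝓢'(Rn n, ℂ)) < ⊤ →
      IsRealValued q → IsRadial q → IsCompactlySupported q →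
        ∀ u : 𝓢'(Rn n, ℂ), IsQ θ q u → MemSobolevLoc α u) :
    α ≤ min (β + 1) (2 * β - ((n : ℝ) - 4) / 2) := by
  have key : ∀ s a : ℝ, (n : ℝ) / 2 + β < s → (a = s + 1 ∨ a = 2 * s + 2 - n) →
      ¬ a < α + n / 2 := fun s a hs ha haα ↦ by
    obtain ⟨q, P, c, C, hc, hC, hf, hj, hP, hq, h1, h2, h3⟩ :=
      exists_potential (n := n) (s := s) (by linarith)
    have hsn : (n : ℝ) < 2 * s := by linarith
    obtain ⟨u, hu, hF⟩ := exists_isQ hn hf hC hj hsn hq hθ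
    obtain ⟨hpos, c', hc', hl⟩ := exists_le_neg_im_limB hn hf hC hj hsn hc hP hq ha
    refine not_memSobolevLoc hF (fun ζ ↦ ?_) hθ hc' (fun R hR ξ hξ ↦ ?_) haα
      (h q (sobolevNorm_potential_lt_top (by linarith) hq hj) h1 h2 h3 u hu)
    · have := hpos θ ((2 * Real.pi) • ζ)
      have := hpos (-θ) ((2 * Real.pi) • ζ)
      rw [Complex.add_im]
      linarith
    -- The summand for −θ has the same sign, so it can only help.
    · have := hl R hR θ hθ ξ hξ
      have := hpos (-θ) ((2 * Real.pi) • ξ)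
      rw [Complex.add_im]
      linarith
  refine le_min ?_ ?_
  · by_contra! hlt
    -- The midpoint between n/2 + β, above which the potential lies in the Sobolev space, and the
    -- value of s at which a = α + n/2; likewise in the second case.
    exact key ((n / 2 + β + (α + n / 2 - 1)) / 2) _ (by linarith) (Or.inl rfl) (by linarith)
  · by_contra! hlt
    exact key ((n / 2 + β + (α + 3 * n / 2 - 2) / 2) / 2) _ (by linarith) (Or.inr rfl)
      (by linarith)

end FixedAngle

end

open FixedAngle in
theorem theorem3 (n : ℕ) (hn : 2 ≤ n) (α β : ℝ) (hβ : 0 ≤ β) :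
    ((((n : ℝ) - 3) / 2 < β ∧ β < ((n : ℝ) - 1) / 2 ∧ α < 2 * β - ((n : ℝ) - 3) / 2 ∨
        ((n : ℝ) - 1) / 2 ≤ β ∧ α < β + 1) →
      ∃ C : ℝ≥0, ∀ θ : Rn n, ‖θ‖ = 1 → ∀ C₀ : ℝ, 1 < C₀ → ∀ χ : Rn n → ℝ, IsCutoff C₀ χ →
        ∀ q : L2 n, sobolevNorm β 2 (q : 𝓢'(Rn n, ℂ)) < ⊤ →
          ∃ u : 𝓢'(Rn n, ℂ), IsFilteredQ χ θ q u ∧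
            sobolevNorm α 0 u ≤ C * sobolevNorm β 2 (q : 𝓢'(Rn n, ℂ)) ^ 2) ∧
    (∀ θ : Rn n, ‖θ‖ = 1 →
      (∀ q : L2 n, sobolevNorm β 0 (q : 𝓢'(Rn n, ℂ)) < ⊤ →
        IsRealValued q → IsRadial q → IsCompactlySupported q →
          ∀ u : 𝓢'(Rn n, ℂ), IsQ θ q u → MemSobolevLoc α u) →
      α ≤ min (β + 1) (2 * β - ((n : ℝ) - 4) / 2)) := by
  exact ⟨fun h ↦ exists_filteredQ hn hβ h, fun θ hθ h ↦ le_of_memSobolevLoc hn hβ hθ h⟩
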